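/- Let $\gamma,\beta,\mu>0$ be constants, let $1\le p,s\le 2\le q\le\infty$, let $\ell\ge 0$ be real and let $j\ge 0$ be an integer. Then there is a constant $C>0$, depending only on $\gamma,\beta,\mu,p,s,q,\ell,j$, such that the following holds. Let $U=[n,u,E,B]$, where $n$ is scalar-valued and $u,E,B$ take values in three-dimensional vectors, satisfy the linearized Navier–Stokes–Maxwell system $$ \begin{cases} \partial_t n+\gamma\nabla\cdot u=0,\\ \partial_t u+\gamma\nabla n+\beta E-\mu\Delta u=0,\\ \partial_t E-\nabla\times B-\beta u=0,\\ \partial_t B+\nabla\times E=0,\\ \nabla\cdot E=-\frac{\beta}{\gamma}n,\quad \nabla\cdot B=0, \end{cases} \qquad t>0,\ x\in\mathbb{R}^3, $$ with initial data $U|_{t=0}=U_0=[n_0,u_0,E_0,B_0]$; here $U(t)$ is a tempered distribution in $x$ for every $t\ge0$, the equations hold after pairing with every Schwartz function of $x$, and these pairings converge to those of $U_0$ as $t\to0^+$. Then for every $t\ge 0$ $$ \|\nabla^jU(t)\|_{L^q}\le C(1+t)^{-\frac34\left(\frac1p-\frac1q\right)-\frac j4}\|U_0\|_{L^p}+C(1+t)^{-\frac{\ell}{2}}\|\nabla^{m(j+\ell,s,q)}U_0\|_{L^s},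 $$ where an $L^r$ norm is $+\infty$ if the distribution is not an $L^r$ function (so that the left side is finite whenever the right side is), and where, for real $\ell$, $$ m(\ell,s,q)= \begin{cases} 0 & \text{if } \ell+3\left(\frac1s-\frac1q\right)<0,\\ \ell & \text{if } \ell+3\left(\frac1s-\frac1q\right)\ge0,\ s=q=2\text{ and }\ell\text{ is an integer},\\ \left[\ell+3\left(\frac1s-\frac1q\right)\right]+1 & \text{otherwise}, \end{cases} $$ with $[\cdot]$ denoting the integer part. -/

import Mathlib

open MeasureTheory Filter Topology
open scoped ENNReal SchwartzMap LineDeriv Laplacian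

namespace NSM

noncomputable section

/-- The physical space `ℝ³` with its Euclidean norm and Lebesgue measure. -/
abbrev Space := EuclideanSpace ℝ (Fin 3)

/-- Complex-valued tempered distributions on `ℝ³`; real-valued fields are a special case. -/
abbrev Distr := 𝓢'(Space, ℂ)

/-- The distributional partial derivative `∂ᵢ`. -/
def pderiv (i : Fin 3) (T : Distr) : Distr :=
  ∂_{(EuclideanSpace.single i (1 : ℝ) : Space)} T

/-- The iterated partial derivative `∂_{I 0} ⋯ ∂_{I (j - 1)}`. -/
def iterPderiv {j : ℕ} (I : Fin j → Fin 3) (T : Distr) : Distr :=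
  ∂^{fun a => (EuclideanSpace.single (I a) (1 : ℝ) : Space)} T

/-- The divergence `∇ · V`. -/
def divergence (V : Fin 3 → Distr) : Distr := ∑ i, pderiv i (V i)

/-- The curl `∇ × V`. -/
def curl (V : Fin 3 → Distr) : Fin 3 → Distr :=
  ![pderiv 1 (V 2) - pderiv 2 (V 1),
    pderiv 2 (V 0) - pderiv 0 (V 2),
    pderiv 0 (V 1) - pderiv 1 (V 0)]

/-- The unknowns `U = [n, u, E, B]` at a fixed time. -/
structure Fields where
  n : Distr
  u : Fin 3 → Distr
  E : Fin 3 → Distr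
  B : Fin 3 → Distr

/-- Index set of the ten scalar components of `[n, u, E, B]`. -/
abbrev Comp := Unit ⊕ Fin 3 ⊕ Fin 3 ⊕ Fin 3

/-- The ten scalar components of `[n, u, E, B]`. -/
def Fields.components (U : Fields) : Comp → Distr :=
  Sum.elim (fun _ => U.n) (Sum.elim U.u (Sum.elim U.E U.B))

/-- `‖T‖_{L^p} ∈ [0, ∞]` for a finite family `T` of tempered distributions: the `L^p` norm of the
pointwise Euclidean norm of the function representing `T`, and `∞` if `T` is not represented by
an `L^p` function. -/
def lpNorm {ι : Type} [Fintype ι] (p : ℝ≥0∞) (T : ι → Distr) : ℝ≥0∞ :=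
  ⨅ (f : Space → EuclideanSpace ℂ ι) (_ : MemLp f p volume)
    (_ : ∀ (i : ι) (φ : 𝓢(Space, ℂ)), T i φ = ∫ x, φ x * f x i), eLpNorm f p volume

/-- The family `∇^j U` of all partial derivatives of order `j` of all components of `U`. -/
def Fields.grad (j : ℕ) (U : Fields) : (Fin j → Fin 3) × Comp → Distr :=
  fun a => iterPderiv a.1 (U.components a.2)

/-- The curve `T` of tempered distributions has time derivative `T'` at `t`, tested against every
Schwartz function. -/
def HasTimeDerivAt (T : ℝ → Distr) (T' : Distr) (t : ℝ) : Prop :=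
  ∀ φ : 𝓢(Space, ℂ), HasDerivAt (fun τ => T τ φ) (T' φ) t

/-- `U = [n, u, E, B]` solves the linearized Navier-Stokes-Maxwell system for `t > 0` in the sense
of tempered distributions in `x`, with initial data `U₀`, attained continuously. -/
structure IsSolution (γ β μ : ℝ) (U₀ : Fields) (U : ℝ → Fields) : Prop where
  mass : ∀ t, 0 < t →
    HasTimeDerivAt (fun τ => (U τ).n) (-((γ : ℂ) • divergence (U t).u)) t
  momentum : ∀ t, 0 < t → ∀ i,
    HasTimeDerivAt (fun τ => (U τ).u i)
      (-((γ : ℂ) • pderiv i (U t).n) - (β : ℂ) • (U t).E i + (μ : ℂ) • Δ ((U t).u i)) t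
  ampere : ∀ t, 0 < t → ∀ i,
    HasTimeDerivAt (fun τ => (U τ).E i) (curl (U t).B i + (β : ℂ) • (U t).u i) t
  faraday : ∀ t, 0 < t → ∀ i,
    HasTimeDerivAt (fun τ => (U τ).B i) (-(curl (U t).E i)) t
  gauss_E : ∀ t, 0 < t → divergence (U t).E = -(((β / γ : ℝ) : ℂ) • (U t).n)
  gauss_B : ∀ t, 0 < t → divergence (U t).B = 0
  initial : U 0 = U₀
  continuous_initial : ∀ (c : Comp) (φ : 𝓢(Space, ℂ)),
    Tendsto (fun t => (U t).components c φ) (𝓝[>] 0) (𝓝 (U₀.components c φ))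

open Classical in
/-- The regularity index `m(ℓ, s, q)`, a number of derivatives. -/
def regIndex (ℓ : ℝ) (s q : ℝ≥0∞) : ℕ :=
  if ℓ + 3 * ((s⁻¹).toReal - (q⁻¹).toReal) < 0 then 0
  else if s = 2 ∧ q = 2 ∧ ∃ k : ℤ, ℓ = k then ⌊ℓ⌋₊
  else ⌊ℓ + 3 * ((s⁻¹).toReal - (q⁻¹).toReal)⌋₊ + 1

end

end NSM

/-! On the Fourier side the system is a linear ODE for each frequency ξ, and everything rests on the
pointwise bound |Û(t,ξ)|² ≤ 3 exp(-c ρ(ξ) t) |Û₀(ξ)|² with ρ = |ξ|⁴/(1+|ξ|²)³ (`exists_flow_decay`).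
Only u is dissipated directly. The energy is therefore corrected by small multiples of Re⟨u, E⟩,
whose derivative dissipates E and, through Gauss's law, n, and of Re⟨E, -iξ×B⟩, whose derivative
dissipates the divergence-free B. Balancing the error terms with weights in |ξ| produces the rate ρ.

At low frequency ρ is comparable to |ξ|⁴, so the relevant scale is |ξ| ~ (1+t)^(-1/4): each
derivative gains (1+t)^(-1/4), and passing from L^p to L^q gains (1+t)^(-(3/4)(1/p-1/q)). At high
frequency ρ is comparable to |ξ|⁻², so exp(-cρt) is bounded by (1+t)^(-ℓ/2)|ξ|^ℓ up to a constant: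
decay is bought with ℓ derivatives of the data.

These pointwise bounds become L^p–L^q bounds by a weighted L² argument instead of Hausdorff–Young.
Cutting an L^p function at an optimal height gives ‖w f̂‖₂ ≤ 2‖w‖₂^(2/p-1)‖f‖_p for a weight 0 ≤ w ≤
1, and interpolation between L² and L^∞ gives ‖𝓕⁻(wG)‖_q ≤ ‖w‖₂^(1-2/q)‖G‖₂. Hence a multiplier
dominated by w² maps L^p to L^q with norm of order ‖w‖₂^(2(1/p-1/q)) (`exists_multiplier_bound`).
Low frequencies use one Gaussian weight; high frequencies use indicators of dyadic shells and a
geometric series, with Plancherel in the endpoint case s = q = 2.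

Since a solution is only a curve of tempered distributions, it must also be shown that Û(t) is the
function exp(tL(ξ))Û₀(ξ), with L the symbol (`Evolves.eq_integral_exp`). Against a compactly
supported test function the successive time derivatives are obtained by letting the transposed
symbol act on the test function. Banach–Steinhaus bounds the n-th one by K Mⁿ on [0, t], so the
Taylor series at time 0 converges to the solution. Density of compactly supported functions finishes
the identification. -/

namespace NSM

noncomputable section

/-! ### Completeness of the Schwartz space and Banach–Steinhaus -/

section SchwartzComplete

variable {E : Type*} [NormedAddCommGroup E] [NormedSpace ℝ E]

/-- A series of Schwartz functions that converges absolutely in every seminorm has a sum. -/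
theorem exists_schwartz_tsum (d : ℕ → 𝓢(E, ℂ))
    (hd : ∀ k l, Summable fun i => SchwartzMap.seminorm ℂ k l (d i)) :
    ∃ f : 𝓢(E, ℂ), (∀ x, f x = ∑' i, d i x) ∧
      ∀ k l, SchwartzMap.seminorm ℂ k l f ≤ ∑' i, SchwartzMap.seminorm ℂ k l (d i) := by
  have hb : ∀ (k i : ℕ) (x : E), ‖iteratedFDeriv ℝ k (d i) x‖ ≤ SchwartzMap.seminorm ℂ 0 k (d i) :=
    fun k i x => SchwartzMap.norm_iteratedFDeriv_le_seminorm ℂ (d i) k x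
  have hsm : ContDiff ℝ ((⊤ : ℕ∞) : WithTop ℕ∞) fun x => ∑' i, d i x :=
    contDiff_tsum (N := ⊤) (v := fun k i => SchwartzMap.seminorm ℂ 0 k (d i))
      (fun i => (d i).smooth ⊤) (fun k _ => hd 0 k) (fun k i x _ => hb k i x)
  have hbound : ∀ (k l : ℕ) (x : E), ‖x‖ ^ k * ‖iteratedFDeriv ℝ l (fun x => ∑' i, d i x) x‖ ≤
      ∑' i, SchwartzMap.seminorm ℂ k l (d i) := by
    intro k l x
    rw [iteratedFDeriv_tsum_apply (N := ⊤) (v := fun k i => SchwartzMap.seminorm ℂ 0 k (d i))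
      (fun i => (d i).smooth ⊤) (fun k _ => hd 0 k) (fun k i x _ => hb k i x) le_top]
    have hs : Summable fun i => ‖iteratedFDeriv ℝ l (d i) x‖ :=
      (hd 0 l).of_nonneg_of_le (fun _ => norm_nonneg _) (fun i => hb l i x)
    calc ‖x‖ ^ k * ‖∑' i, iteratedFDeriv ℝ l (d i) x‖
        ≤ ‖x‖ ^ k * ∑' i, ‖iteratedFDeriv ℝ l (d i) x‖ := by
          gcongr; exact norm_tsum_le_tsum_norm hs
      _ = ∑' i, ‖x‖ ^ k * ‖iteratedFDeriv ℝ l (d i) x‖ := tsum_mul_left.symm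
      _ ≤ _ := (hs.mul_left _).tsum_le_tsum
          (fun i => SchwartzMap.le_seminorm ℂ k l (d i) x) (hd k l)
  refine ⟨⟨fun x => ∑' i, d i x, hsm, fun k l => ⟨_, hbound k l⟩⟩, fun x => rfl, fun k l => ?_⟩
  exact SchwartzMap.seminorm_le_bound ℂ k l _
    (tsum_nonneg fun i => apply_nonneg _ _) (hbound k l)

theorem tendsto_schwartz_iff {ι : Type*} {l : Filter ι} (u : ι → 𝓢(E, ℂ)) (f : 𝓢(E, ℂ)) :
    Tendsto u l (𝓝 f) ↔
      ∀ k n, Tendsto (fun i => SchwartzMap.seminorm ℂ k n (u i - f)) l (𝓝 0) := by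
  rw [(schwartz_withSeminorms ℂ E ℂ).tendsto_nhds]
  constructor
  · intro h k n
    rw [Metric.tendsto_nhds]
    intro ε hε
    filter_upwards [h (k, n) ε hε] with i hi
    rw [Real.dist_0_eq_abs, abs_of_nonneg (apply_nonneg _ _)]
    exact hi
  · rintro h ⟨k, n⟩ ε hε
    exact (h k n).eventually_lt_const hε

instance : (uniformity 𝓢(E, ℂ)).IsCountablyGenerated :=
  IsUniformAddGroup.uniformity_countably_generated

/-- Completeness, with the countably generated uniformity, makes the Schwartz space a Baire space
and hence barrelled, which is what Banach–Steinhaus needs. -/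
instance : CompleteSpace 𝓢(E, ℂ) := by
  have hcont : ∀ k l, Continuous (SchwartzMap.seminorm ℂ k l : Seminorm ℂ 𝓢(E, ℂ)) :=
    fun k l => (schwartz_withSeminorms ℂ E ℂ).continuous_seminorm (k, l)
  -- The N-th neighbourhood bounds all seminorms with indices at most N by 2⁻ᴺ. Consecutive
  -- differences of a controlled sequence are then summable in the seminorm (k, l), after the first
  -- max k l terms are discarded, and the sequence converges as a telescoping series.
  let V : ℕ → Set 𝓢(E, ℂ) := fun N =>
    ⋂ k ∈ Finset.range (N + 1), ⋂ l ∈ Finset.range (N + 1),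
      {f | SchwartzMap.seminorm ℂ k l f < (1 / 2) ^ N}
  have hV : ∀ N, V N ∈ 𝓝 (0 : 𝓢(E, ℂ)) := by
    intro N
    refine (biInter_finset_mem _).2 fun k _ => (biInter_finset_mem _).2 fun l _ => ?_
    refine (isOpen_lt (hcont k l) continuous_const).mem_nhds ?_
    simp
  refine UniformSpace.complete_of_convergent_controlled_sequences
    (fun N => {p : 𝓢(E, ℂ) × 𝓢(E, ℂ) | p.2 - p.1 ∈ V N}) (fun N => ?_) fun u hu => ?_
  · rw [uniformity_eq_comap_nhds_zero]
    exact preimage_mem_comap (hV N)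
  have hsm : ∀ n k l, Summable fun i => SchwartzMap.seminorm ℂ k l (u (i + n + 1) - u (i + n)) := by
    intro n k l
    have h2 : Summable fun i : ℕ => ((1 : ℝ) / 2) ^ i := summable_geometric_two
    refine (summable_nat_add_iff (max k l)).1
      (h2.of_nonneg_of_le (fun _ => apply_nonneg _ _) fun i => ?_)
    have h3 := hu (i + max k l + n) (i + max k l + n) (i + max k l + n + 1) le_rfl (by omega)
    simp only [V, Set.mem_ofPred_eq, Set.mem_iInter, Finset.mem_range] at h3
    refine (h3 k (by omega) l (by omega)).le.trans ?_
    exact pow_le_pow_of_le_one (by norm_num) (by norm_num) (by omega)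
  choose f hf hfb using fun n => exists_schwartz_tsum _ (hsm n)
  have key : ∀ n, u n - (u 0 + f 0) = - f n := by
    intro n
    ext x
    have hsx : Summable fun i => (u (i + 0 + 1) - u (i + 0)) x :=
      Summable.of_norm ((hsm 0 0 0).of_nonneg_of_le (fun _ => norm_nonneg _)
        fun i => SchwartzMap.norm_le_seminorm ℂ _ x)
    have h4 := hsx.sum_add_tsum_nat_add n
    have h5 : ∑ i ∈ Finset.range n, (u (i + 0 + 1) - u (i + 0)) x = u n x - u 0 x := by
      simpa using Finset.sum_range_sub (fun i => u i x) n
    have h6 := hf n x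
    have h7 := hf 0 x
    simp only [sub_apply, add_apply, neg_apply] at h4 h5 h6 h7 ⊢
    rw [h6, h7, ← h4, h5]
    simp only [add_zero]
    ring
  refine ⟨u 0 + f 0, (tendsto_schwartz_iff _ _).2 fun k l => ?_⟩
  simp_rw [key, map_neg_eq_map]
  refine squeeze_zero (fun n => apply_nonneg _ _) (fun n => hfb n k l) ?_
  have := tendsto_sum_nat_add (fun i => SchwartzMap.seminorm ℂ k l (u (i + 1) - u i))
  refine this.congr fun n => tsum_congr fun i => ?_
  rfl

/-- Banach-Steinhaus for tempered distributions: a pointwise bounded family is bounded by one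
continuous Schwartz seminorm. -/
theorem exists_uniform_seminorm_bound {ι : Type*} (T : ι → 𝓢'(E, ℂ))
    (hT : ∀ φ, ∃ C : ℝ, ∀ i, ‖T i φ‖ ≤ C) :
    ∃ (m : ℕ × ℕ) (C : ℝ), 0 ≤ C ∧ ∀ i φ, ‖T i φ‖ ≤
      C * (Finset.Iic m).sup (schwartzSeminormFamily ℂ E ℂ) φ := by
  let F : ι → 𝓢(E, ℂ) →L[ℂ] ℂ := fun i => ⟨(T i).toLinearMap, (T i).cont⟩
  have h1 := (norm_withSeminorms ℂ ℂ).banach_steinhaus (𝓕 := F) (by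
    intro k φ
    obtain ⟨C, hC⟩ := hT φ
    exact ⟨C, by rintro _ ⟨i, rfl⟩; exact hC i⟩)
  obtain ⟨p, hp, hp'⟩ := ((norm_withSeminorms ℂ ℂ).uniformEquicontinuous_iff_exists_continuous_seminorm
    (fun i => (F i).toLinearMap)).1 h1 0
  obtain ⟨s, C, -, hC⟩ := Seminorm.bound_of_continuous (schwartz_withSeminorms ℂ E ℂ) p hp
  refine ⟨s.sup id, C, C.2, fun i φ => (hp' i φ).trans ((hC φ).trans ?_)⟩
  simp only [smul_apply, NNReal.smul_def, smul_eq_mul]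
  refine mul_le_mul_of_nonneg_left ?_ C.2
  have : s ⊆ Finset.Iic (s.sup id) := fun a ha =>
    Finset.mem_Iic.2 (Finset.le_sup (f := id) ha)
  exact (Finset.sup_mono (f := schwartzSeminormFamily ℂ E ℂ) this) φ

end SchwartzComplete

/-! ### Multiplication and cut-off in the Schwartz space -/

section SchwartzCutoff

variable {E : Type*} [NormedAddCommGroup E] [NormedSpace ℝ E]

/-- Multiplication by a smooth function is bounded, with no loss of derivatives, on Schwartz
functions supported in a fixed ball. -/
theorem exists_seminorm_smulLeftCLM_le [ProperSpace E] {g : E → ℂ} (hg : g.HasTemperateGrowth)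
    (R : ℝ) (m : ℕ × ℕ) :
    ∃ C : ℝ, 0 ≤ C ∧ ∀ φ : 𝓢(E, ℂ), tsupport φ ⊆ Metric.closedBall 0 R →
      (Finset.Iic m).sup (schwartzSeminormFamily ℂ E ℂ) (SchwartzMap.smulLeftCLM ℂ g φ) ≤
        C * (Finset.Iic m).sup (schwartzSeminormFamily ℂ E ℂ) φ := by
  have hG : ∀ i : ℕ, ∃ B : ℝ, 0 ≤ B ∧ ∀ x ∈ Metric.closedBall (0 : E) R,
      ‖iteratedFDeriv ℝ i g x‖ ≤ B := by
    intro i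
    have hc : Continuous (iteratedFDeriv ℝ i g) :=
      hg.1.continuous_iteratedFDeriv (mod_cast le_top)
    obtain ⟨B, hB⟩ := (isCompact_closedBall (0 : E) R).exists_bound_of_continuousOn hc.continuousOn
    exact ⟨max B 0, le_max_right _ _, fun x hx => (hB x hx).trans (le_max_left _ _)⟩
  choose B hB0 hB using hG
  -- Leibniz constants, with the derivatives of `g` bounded on the ball. Terms with fewer
  -- derivatives on `φ` are still controlled by the seminorm over `Iic m`, so `m` does not grow and
  -- the bound can be iterated.
  let C : ℝ := ∑ l ∈ Finset.range (m.2 + 1), ∑ i ∈ Finset.range (l + 1), (l.choose i : ℝ) * B i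
  have hC0 : 0 ≤ C := Finset.sum_nonneg fun l _ => Finset.sum_nonneg fun i _ =>
    mul_nonneg (Nat.cast_nonneg _) (hB0 i)
  refine ⟨C, hC0, fun φ hφ => ?_⟩
  refine Seminorm.finset_sup_apply_le (mul_nonneg hC0 (apply_nonneg _ _)) ?_
  rintro ⟨k, l⟩ hkl
  rw [Finset.mem_Iic] at hkl
  refine SchwartzMap.seminorm_le_bound ℂ k l _ (mul_nonneg hC0 (apply_nonneg _ _)) fun x => ?_
  have hfun : (SchwartzMap.smulLeftCLM ℂ g φ : E → ℂ) = fun x => g x * φ x := by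
    ext x; simp [SchwartzMap.smulLeftCLM_apply_apply hg]
  rw [hfun]
  set Q := (Finset.Iic m).sup (schwartzSeminormFamily ℂ E ℂ) φ with hQ
  have hterm : ∀ i ∈ Finset.range (l + 1), ‖x‖ ^ k * ((l.choose i : ℝ) *
      ‖iteratedFDeriv ℝ i g x‖ * ‖iteratedFDeriv ℝ (l - i) φ x‖) ≤ (l.choose i : ℝ) * B i * Q := by
    intro i _
    by_cases hx : x ∈ Metric.closedBall (0 : E) R
    · have h1 : ‖x‖ ^ k * ‖iteratedFDeriv ℝ (l - i) φ x‖ ≤ Q := by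
        refine (SchwartzMap.le_seminorm ℂ k (l - i) φ x).trans ?_
        exact Seminorm.le_finset_sup_apply (p := schwartzSeminormFamily ℂ E ℂ)
          (i := (k, l - i)) (Finset.mem_Iic.2 ⟨hkl.1, (Nat.sub_le _ _).trans hkl.2⟩)
      have h2 := hB i x hx
      calc _ = (l.choose i : ℝ) * ‖iteratedFDeriv ℝ i g x‖ *
            (‖x‖ ^ k * ‖iteratedFDeriv ℝ (l - i) φ x‖) := by ring
        _ ≤ _ := by
          have := hB0 i
          gcongr
    · have : iteratedFDeriv ℝ (l - i) φ x = 0 := by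
        by_contra h
        exact hx (hφ (support_iteratedFDeriv_subset (l - i) h))
      rw [this]
      simp only [norm_zero, mul_zero]
      exact mul_nonneg (mul_nonneg (Nat.cast_nonneg _) (hB0 i)) (apply_nonneg _ _)
  calc ‖x‖ ^ k * ‖iteratedFDeriv ℝ l (fun x => g x * φ x) x‖
      ≤ ‖x‖ ^ k * ∑ i ∈ Finset.range (l + 1), (l.choose i : ℝ) *
        ‖iteratedFDeriv ℝ i g x‖ * ‖iteratedFDeriv ℝ (l - i) φ x‖ := by
        gcongr
        exact norm_iteratedFDeriv_mul_le (N := ((⊤ : ℕ∞) : WithTop ℕ∞)) hg.1 (φ.smooth ⊤) x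
          (mod_cast le_top)
    _ ≤ ∑ i ∈ Finset.range (l + 1), (l.choose i : ℝ) * B i * Q := by
        rw [Finset.mul_sum]; exact Finset.sum_le_sum hterm
    _ = (∑ i ∈ Finset.range (l + 1), (l.choose i : ℝ) * B i) * Q := by rw [Finset.sum_mul]
    _ ≤ C * Q := by
        refine mul_le_mul_of_nonneg_right ?_ (apply_nonneg _ _)
        exact Finset.single_le_sum (f := fun l => ∑ i ∈ Finset.range (l + 1), (l.choose i : ℝ) * B i)
          (fun l _ => Finset.sum_nonneg fun i _ => mul_nonneg (Nat.cast_nonneg _) (hB0 i))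
          (Finset.mem_range.2 (Nat.lt_succ_of_le hkl.2))

variable [FiniteDimensional ℝ E] [HasContDiffBump E]

/-- Compactly supported functions are sequentially dense in the Schwartz space. -/
theorem exists_compactSupport_tendsto (φ : 𝓢(E, ℂ)) :
    ∃ ψ : ℕ → 𝓢(E, ℂ), (∀ n, HasCompactSupport (ψ n)) ∧ (∀ n x, ‖ψ n x‖ ≤ ‖φ x‖) ∧
      Tendsto ψ atTop (𝓝 φ) := by
  let b : ContDiffBump (0 : E) := ⟨1, 2, one_pos, one_lt_two⟩
  have hbc : HasCompactSupport (Complex.ofRealCLM ∘ b) := b.hasCompactSupport.comp_left rfl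
  have hbs : ContDiff ℝ ((⊤ : ℕ∞) : WithTop ℕ∞) (Complex.ofRealCLM ∘ b) :=
    Complex.ofRealCLM.contDiff.comp b.contDiff
  let Ψ : 𝓢(E, ℂ) := hbc.toSchwartzMap hbs
  have hΨ : ∀ x, Ψ x = (b x : ℂ) := fun x => rfl
  let L : ℝ → E →L[ℝ] E := fun c => c • ContinuousLinearMap.id ℝ E
  have hL : ∀ c, 0 ≤ c → c ≤ 1 → ‖L c‖ ≤ 1 := by
    intro c hc0 hc1
    refine ContinuousLinearMap.opNorm_le_bound _ zero_le_one fun x => ?_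
    simp only [L, smul_apply, ContinuousLinearMap.id_apply, norm_smul,
      Real.norm_eq_abs, abs_of_nonneg hc0]
    gcongr
  let c : ℕ → ℝ := fun n => 1 / ((n : ℝ) + 1)
  have hc0 : ∀ n, 0 < c n := fun n => Nat.one_div_pos_of_nat
  have hc1 : ∀ n, c n ≤ 1 := fun n => by
    simp only [c]; rw [div_le_one (by positivity)]; linarith [n.cast_nonneg (α := ℝ)]
  have hχc : ∀ n, HasCompactSupport (fun x => Ψ (L (c n) x)) := by
    intro n
    refine HasCompactSupport.intro (isCompact_closedBall (0 : E) (2 / c n)) fun x hx => ?_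
    have h1 : 2 / c n < ‖x‖ := by simpa using hx
    rw [hΨ, Complex.ofReal_eq_zero]
    refine b.zero_of_le_dist ?_
    simp only [L, smul_apply, ContinuousLinearMap.id_apply, dist_zero_right,
      norm_smul, Real.norm_eq_abs, abs_of_pos (hc0 n)]
    rw [div_lt_iff₀ (hc0 n)] at h1
    change (2 : ℝ) ≤ _
    linarith
  have hχs : ∀ n, ContDiff ℝ ((⊤ : ℕ∞) : WithTop ℕ∞) (fun x => Ψ (L (c n) x)) :=
    fun n => (Ψ.smooth ⊤).comp (L (c n)).contDiff
  have hχ : ∀ n, (fun x => Ψ (L (c n) x)).HasTemperateGrowth := fun n =>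
    ((hχc n).toSchwartzMap (hχs n)).hasTemperateGrowth
  let ψ : ℕ → 𝓢(E, ℂ) := fun n => SchwartzMap.smulLeftCLM ℂ (fun x => Ψ (L (c n) x)) φ
  have hψ : ∀ n x, ψ n x = Ψ (L (c n) x) * φ x := fun n x => by
    simp [ψ, SchwartzMap.smulLeftCLM_apply_apply (hχ n)]
  refine ⟨ψ, fun n => ?_, fun n x => ?_, (tendsto_schwartz_iff _ _).2 fun k l => ?_⟩
  · have : (ψ n : E → ℂ) = fun x => Ψ (L (c n) x) * φ x := funext (hψ n)
    rw [this]
    exact (hχc n).mul_right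
  · rw [hψ, hΨ, norm_mul, Complex.norm_real, Real.norm_of_nonneg b.nonneg]
    exact mul_le_of_le_one_left (norm_nonneg _) b.le_one
  let B : ℕ → ℝ := fun i => SchwartzMap.seminorm ℂ 0 i Ψ + 1
  have hB0 : ∀ i, 0 ≤ B i := fun i => add_nonneg (apply_nonneg _ _) zero_le_one
  -- The cut-off minus 1 vanishes near every point with c‖x‖ < 1, and elsewhere c‖x‖ ≥ 1 may be
  -- inserted for free. The factor ‖x‖ raises the seminorm index from k to k + 1, and the factor c
  -- tends to zero.
  have hD : ∀ n i x, ‖iteratedFDeriv ℝ i (fun x => Ψ (L (c n) x) - 1) x‖ ≤ B i * (c n * ‖x‖) := by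
    intro n i x
    rcases lt_or_ge (c n * ‖x‖) 1 with h | h
    · have hev : (fun x => Ψ (L (c n) x) - 1) =ᶠ[𝓝 x] fun _ => 0 := by
        have : ∀ᶠ y in 𝓝 x, c n * ‖y‖ < 1 :=
          (continuous_const.mul continuous_norm).tendsto x |>.eventually_lt_const h
        filter_upwards [this] with y hy
        have : b (L (c n) y) = 1 := by
          refine b.one_of_mem_closedBall ?_
          simp only [L, smul_apply, ContinuousLinearMap.id_apply,
            mem_closedBall_zero_iff, norm_smul, Real.norm_eq_abs, abs_of_pos (hc0 n)]
          exact hy.le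
        simp [hΨ, this]
      rw [(hev.iteratedFDeriv ℝ i).eq_of_nhds]
      have : iteratedFDeriv ℝ i (fun _ : E => (0 : ℂ)) x = 0 := by
        rw [iteratedFDeriv_fun_zero]; rfl
      rw [this, norm_zero]
      exact mul_nonneg (hB0 i) (mul_nonneg (hc0 n).le (norm_nonneg _))
    · refine le_trans ?_ (le_mul_of_one_le_right (hB0 i) h)
      rcases Nat.eq_zero_or_pos i with rfl | hi
      · rw [norm_iteratedFDeriv_zero]
        refine (norm_sub_le _ _).trans ?_
        rw [norm_one]
        exact add_le_add_left (SchwartzMap.norm_le_seminorm ℂ Ψ _) 1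
      · have h0 : iteratedFDeriv ℝ i (fun x => Ψ (L (c n) x) - 1) x =
            iteratedFDeriv ℝ i (fun x => Ψ (L (c n) x)) x := by
          have h1 := iteratedFDeriv_sub_apply (𝕜 := ℝ) (i := i) (x := x)
            (f := fun x => Ψ (L (c n) x)) (g := fun _ => (1 : ℂ))
            (((hχs n).of_le (mod_cast le_top)).contDiffAt) contDiffAt_const
          have h2 : iteratedFDeriv ℝ i (fun _ : E => (1 : ℂ)) x = 0 := by
            rw [iteratedFDeriv_const_of_ne hi.ne']; rfl
          rw [h2, sub_zero] at h1
          exact h1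
        rw [h0]
        have h3 := (L (c n)).iteratedFDeriv_comp_right (Ψ.smooth ⊤) x (i := i) (mod_cast le_top)
        have h4 : (fun x => Ψ (L (c n) x)) = Ψ ∘ L (c n) := rfl
        rw [h4, h3]
        refine (ContinuousMultilinearMap.norm_compContinuousLinearMap_le _ _).trans ?_
        calc _ ≤ ‖iteratedFDeriv ℝ i Ψ (L (c n) x)‖ * 1 := by
              gcongr
              exact Finset.prod_le_one (fun _ _ => norm_nonneg _)
                (fun _ _ => hL _ (hc0 n).le (hc1 n))
          _ ≤ B i := by
              rw [mul_one]
              exact (SchwartzMap.norm_iteratedFDeriv_le_seminorm ℂ Ψ i _).trans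
                (le_add_of_nonneg_right zero_le_one)
  let K : ℝ := ∑ i ∈ Finset.range (l + 1),
    (l.choose i : ℝ) * B i * SchwartzMap.seminorm ℂ (k + 1) (l - i) φ
  have hK0 : 0 ≤ K := Finset.sum_nonneg fun i _ =>
    mul_nonneg (mul_nonneg (Nat.cast_nonneg _) (hB0 i)) (apply_nonneg _ _)
  have hbd : ∀ n, SchwartzMap.seminorm ℂ k l (ψ n - φ) ≤ c n * K := by
    intro n
    refine SchwartzMap.seminorm_le_bound ℂ k l _ (mul_nonneg (hc0 n).le hK0) fun x => ?_
    have hfun : (ψ n - φ : E → ℂ) = fun x => (Ψ (L (c n) x) - 1) * φ x := by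
      ext x; simp [hψ]; ring
    have hfun' : ((ψ n - φ : 𝓢(E, ℂ)) : E → ℂ) = fun x => (Ψ (L (c n) x) - 1) * φ x := by
      rw [← hfun]; rfl
    rw [hfun']
    calc _ ≤ ‖x‖ ^ k * ∑ i ∈ Finset.range (l + 1), (l.choose i : ℝ) *
          ‖iteratedFDeriv ℝ i (fun x => Ψ (L (c n) x) - 1) x‖ *
            ‖iteratedFDeriv ℝ (l - i) φ x‖ := by
          gcongr
          exact norm_iteratedFDeriv_mul_le (N := ((⊤ : ℕ∞) : WithTop ℕ∞))
            ((hχs n).sub contDiff_const) (φ.smooth ⊤) x (mod_cast le_top)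
      _ ≤ c n * K := by
          simp only [K, Finset.mul_sum]
          refine Finset.sum_le_sum fun i _ => ?_
          calc _ ≤ ‖x‖ ^ k * ((l.choose i : ℝ) * (B i * (c n * ‖x‖)) *
                ‖iteratedFDeriv ℝ (l - i) φ x‖) := by gcongr; exact hD n i x
            _ = c n * ((l.choose i : ℝ) * B i *
                (‖x‖ ^ (k + 1) * ‖iteratedFDeriv ℝ (l - i) φ x‖)) := by ring
            _ ≤ _ := by
              have := SchwartzMap.le_seminorm ℂ (k + 1) (l - i) φ x
              have := hB0 i
              have := (hc0 n).le
              gcongr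
  refine squeeze_zero (fun n => apply_nonneg _ _) hbd ?_
  have := (tendsto_one_div_add_atTop_nhds_zero_nat (𝕜 := ℝ)).mul_const K
  rwa [zero_mul] at this

end SchwartzCutoff

/-! ### The Fourier symbol as a 10 × 10 matrix -/

abbrev cn : Comp := Sum.inl ()
abbrev cu (i : Fin 3) : Comp := Sum.inr (Sum.inl i)
abbrev cE (i : Fin 3) : Comp := Sum.inr (Sum.inr (Sum.inl i))
abbrev cB (i : Fin 3) : Comp := Sum.inr (Sum.inr (Sum.inr i))

/-- The matrix of `w ↦ d × w`. -/
def crossEntry (d : Fin 3 → ℂ) : Fin 3 → Fin 3 → ℂ :=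
  ![![0, -d 2, d 1], ![d 2, 0, -d 0], ![-d 1, d 0, 0]]

/-- The symbol of the linearized system, with `d i` in place of `∂ᵢ`. -/
def symb (γ β μ : ℝ) (d : Fin 3 → ℂ) : Comp → Comp → ℂ :=
  Sum.elim
    (fun _ => Sum.elim (fun _ => 0) (Sum.elim (fun l => -(γ * d l)) (fun _ => 0)))
    (Sum.elim
      (fun i => Sum.elim (fun _ => -(γ * d i))
        (Sum.elim (fun l => if i = l then μ * ∑ a, d a ^ 2 else 0)
          (Sum.elim (fun l => if i = l then -(β : ℂ) else 0) (fun _ => 0))))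
      (Sum.elim
        (fun i => Sum.elim (fun _ => 0)
          (Sum.elim (fun l => if i = l then (β : ℂ) else 0)
            (Sum.elim (fun _ => 0) (fun l => crossEntry d i l))))
        (fun i => Sum.elim (fun _ => 0)
          (Sum.elim (fun _ => 0) (Sum.elim (fun l => -crossEntry d i l) (fun _ => 0))))))

/-- The real inner product on `ℂ`. -/
def rip (z w : ℂ) : ℝ := z.re * w.re + z.im * w.im

theorem rip_self (z : ℂ) : rip z z = ‖z‖ ^ 2 := by
  rw [Complex.sq_norm, Complex.normSq_apply, rip]

theorem hasDerivAt_rip {f g : ℝ → ℂ} {f' g' : ℂ} {t : ℝ} (hf : HasDerivAt f f' t)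
    (hg : HasDerivAt g g' t) :
    HasDerivAt (fun s => rip (f s) (g s)) (rip f' (g t) + rip (f t) g') t := by
  have h1 : HasDerivAt (fun s => (f s).re) f'.re t :=
    Complex.reCLM.hasFDerivAt.comp_hasDerivAt t hf
  have h2 : HasDerivAt (fun s => (f s).im) f'.im t :=
    Complex.imCLM.hasFDerivAt.comp_hasDerivAt t hf
  have h3 : HasDerivAt (fun s => (g s).re) g'.re t :=
    Complex.reCLM.hasFDerivAt.comp_hasDerivAt t hg
  have h4 : HasDerivAt (fun s => (g s).im) g'.im t :=
    Complex.imCLM.hasFDerivAt.comp_hasDerivAt t hg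
  refine ((h1.mul h3).add (h2.mul h4)).congr_deriv ?_
  simp only [rip]; ring

/-- `d × w`. -/
def crossApply (d w : Fin 3 → ℂ) (i : Fin 3) : ℂ := ∑ l, crossEntry d i l * w l

theorem crossApply_zero (d w : Fin 3 → ℂ) : crossApply d w 0 = d 1 * w 2 - d 2 * w 1 := by
  simp [crossApply, crossEntry, Fin.sum_univ_three]; ring

theorem crossApply_one (d w : Fin 3 → ℂ) : crossApply d w 1 = d 2 * w 0 - d 0 * w 2 := by
  simp [crossApply, crossEntry, Fin.sum_univ_three]; ring

theorem crossApply_two (d w : Fin 3 → ℂ) : crossApply d w 2 = d 0 * w 1 - d 1 * w 0 := by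
  simp [crossApply, crossEntry, Fin.sum_univ_three]; ring

/-- The action of the symbol on a vector. -/
def symbApply (γ β μ : ℝ) (d : Fin 3 → ℂ) (v : Comp → ℂ) (c : Comp) : ℂ :=
  ∑ c', symb γ β μ d c c' * v c'

theorem sum_comp {M : Type*} [AddCommMonoid M] (f : Comp → M) :
    ∑ c, f c = f cn + (∑ i, f (cu i) + (∑ i, f (cE i) + ∑ i, f (cB i))) := by
  simp [Fintype.sum_sum_type]

section

variable (γ β μ : ℝ) (d : Fin 3 → ℂ) (v : Comp → ℂ)

theorem symbApply_n : symbApply γ β μ d v cn = -(γ * ∑ l, d l * v (cu l)) := by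
  simp [symbApply, symb, Fintype.sum_sum_type, Fin.sum_univ_three]; ring

theorem symbApply_u (i : Fin 3) : symbApply γ β μ d v (cu i) =
    -(γ * (d i * v cn)) - β * v (cE i) + μ * ((∑ a, d a ^ 2) * v (cu i)) := by
  simp [symbApply, symb, Fintype.sum_sum_type]; ring

theorem symbApply_E (i : Fin 3) : symbApply γ β μ d v (cE i) =
    crossApply d (fun l => v (cB l)) i + β * v (cu i) := by
  simp [symbApply, symb, Fintype.sum_sum_type, crossApply]; ring

theorem symbApply_B (i : Fin 3) : symbApply γ β μ d v (cB i) =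
    -crossApply d (fun l => v (cE l)) i := by
  simp [symbApply, symb, Fintype.sum_sum_type, crossApply]

end

/-- The divergence constraints on the Fourier side. -/
def Constr (γ β : ℝ) (d : Fin 3 → ℂ) (v : Comp → ℂ) : Prop :=
  ∑ i, d i * v (cE i) = -((β / γ : ℝ) * v cn) ∧ ∑ i, d i * v (cB i) = 0

/-! ### Lyapunov estimate for a single Fourier mode -/

section Identities

variable (γ β μ : ℝ) (ξ : Fin 3 → ℝ) (v : Comp → ℂ)

/-- The pressure, electric and curl couplings are antisymmetric and cancel in pairs; only viscosity
survives. -/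
theorem energy_identity :
    ∑ c, rip (symbApply γ β μ (fun i => Complex.I * ξ i) v c) (v c) =
      -(μ * (∑ i, ξ i ^ 2) * ∑ i, rip (v (cu i)) (v (cu i))) := by
  simp only [sum_comp, symbApply_n,
    symbApply_u, symbApply_E, symbApply_B, Fin.sum_univ_three, crossApply_zero, crossApply_one,
    crossApply_two, rip]
  simp [pow_two]
  ring

/-- This pairing produces the dissipation of E. The pressure term tested against E becomes a
divergence of E, which Gauss's law turns into the dissipation -β|n|². -/
theorem electric_identity (hγ : γ ≠ 0)
    (h : Constr γ β (fun i => Complex.I * ξ i) v) :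
    ∑ i, (rip (symbApply γ β μ (fun i => Complex.I * ξ i) v (cu i)) (v (cE i)) +
        rip (v (cu i)) (symbApply γ β μ (fun i => Complex.I * ξ i) v (cE i))) =
      -(β * ∑ i, rip (v (cE i)) (v (cE i))) - β * rip (v cn) (v cn) +
        β * (∑ i, rip (v (cu i)) (v (cu i))) -
        μ * (∑ i, ξ i ^ 2) * (∑ i, rip (v (cu i)) (v (cE i))) +
        ∑ i, rip (v (cu i)) (crossApply (fun i => Complex.I * ξ i) (fun l => v (cB l)) i) := by
  have h1 := congrArg Complex.re h.1
  have h2 := congrArg Complex.im h.1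
  simp only [Fin.sum_univ_three] at h1 h2
  simp only [symbApply_u, symbApply_E, Fin.sum_univ_three, crossApply_zero, crossApply_one,
    crossApply_two, rip]
  simp [pow_two] at h1 h2 ⊢
  have h3 : β * (v cn).re = γ * (ξ 0 * (v (cE 0)).im + ξ 1 * (v (cE 1)).im +
      ξ 2 * (v (cE 2)).im) := by
    field_simp at h1; linear_combination h1
  have h4 : β * (v cn).im = -γ * (ξ 0 * (v (cE 0)).re + ξ 1 * (v (cE 1)).re +
      ξ 2 * (v (cE 2)).re) := by
    field_simp at h2; linear_combination h2
  linear_combination (v cn).re * h3 + (v cn).im * h4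

/-- This pairing produces -|ξ×B|², which equals -|ξ|²|B|² because ξ·B = 0. The last bracket is
|ξ×E|², of the wrong sign, to be absorbed by the electric dissipation. -/
theorem magnetic_identity (h : Constr γ β (fun i => Complex.I * ξ i) v) :
    ∑ i, (rip (symbApply γ β μ (fun i => Complex.I * ξ i) v (cE i))
          (-crossApply (fun i => Complex.I * ξ i) (fun l => v (cB l)) i) +
        rip (v (cE i)) (-crossApply (fun i => Complex.I * ξ i)
          (fun l => symbApply γ β μ (fun i => Complex.I * ξ i) v (cB l)) i)) =
      -((∑ i, ξ i ^ 2) * ∑ i, rip (v (cB i)) (v (cB i))) -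
        β * (∑ i, rip (v (cu i)) (crossApply (fun i => Complex.I * ξ i) (fun l => v (cB l)) i)) +
        ((∑ i, ξ i ^ 2) * (∑ i, rip (v (cE i)) (v (cE i))) -
          ‖∑ i, (ξ i : ℂ) * v (cE i)‖ ^ 2) := by
  have h1 := congrArg Complex.re h.2
  have h2 := congrArg Complex.im h.2
  simp only [Fin.sum_univ_three] at h1 h2
  simp only [symbApply_E, symbApply_B, Fin.sum_univ_three, crossApply_zero, crossApply_one,
    crossApply_two, ← rip_self, rip]
  simp [pow_two] at h1 h2 ⊢
  have h3 : ξ 0 * (v (cB 0)).im + ξ 1 * (v (cB 1)).im + ξ 2 * (v (cB 2)).im = 0 := by linarith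
  have h4 : ξ 0 * (v (cB 0)).re + ξ 1 * (v (cB 1)).re + ξ 2 * (v (cB 2)).re = 0 := by linarith
  linear_combination (ξ 0 * (v (cB 0)).im + ξ 1 * (v (cB 1)).im + ξ 2 * (v (cB 2)).im) * h3 +
    (ξ 0 * (v (cB 0)).re + ξ 1 * (v (cB 1)).re + ξ 2 * (v (cB 2)).re) * h4

end Identities

/-- Young's inequality with a free parameter: (sA + S/(4s))² - AS is a perfect square. -/
theorem abs_le_of_sq_le_mul {y A S s : ℝ} (hA : 0 ≤ A) (hS : 0 ≤ S) (hs : 0 < s)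
    (h : y ^ 2 ≤ A * S) : |y| ≤ s * A + S / (4 * s) := by
  refine abs_le_of_sq_le_sq (h.trans ?_) (by positivity)
  have : (s * A + S / (4 * s)) ^ 2 - A * S = (s * A - S / (4 * s)) ^ 2 := by
    field_simp; ring
  linarith [sq_nonneg (s * A - S / (4 * s))]

/-- The algebraic inequality behind the decay of the Lyapunov functional. -/
theorem lyapunov_ineq {β μ r q A N Es Bs X Y z κ : ℝ} (hβ : 0 < β) (hμ : 0 < μ) (hr : 0 ≤ r)
    (hq : q * (1 + r) = 1) (hA : 0 ≤ A) (hN : 0 ≤ N) (hE : 0 ≤ Es) (hB : 0 ≤ Bs) (hz : 0 ≤ z)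
    (hX : X ^ 2 ≤ A * Es) (hY : Y ^ 2 ≤ A * (r * Bs)) (hκ : 0 < κ)
    (hκM : κ * (β + μ ^ 2 / β + 4 / β + β / 4 * β ^ 2) ≤ μ) :
    2 * -(μ * r * A) + κ * (r * q ^ 2) * (-(β * Es) - β * N + β * A - μ * r * X + Y) +
      κ * (β / 4) * (r * q ^ 3) * (-(r * Bs) - β * Y + (r * Es - z)) ≤
    -(min μ (κ * (β / 8)) * (r ^ 2 * q ^ 3) * (N + A + Es + Bs)) := by
  have hq0 : 0 < q := by
    by_contra h; nlinarith
  have hq1 : q ≤ 1 := by nlinarith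
  have hrq : r * q ≤ 1 := by nlinarith
  have hrq0 : 0 ≤ r * q := by positivity
  have hq2 : q ^ 2 ≤ 1 := by nlinarith
  have hq3 : q ^ 3 ≤ 1 := pow_le_one₀ hq0.le hq1
  -- The Young parameters here and in `t2`, `t3` are chosen so that, after multiplication by the
  -- weights, the errors cost at most a quarter of the electric dissipation and a quarter each of
  -- the magnetic one. The rest falls on A = |u|². The factor 1 + r = 1/q in `t2` converts the
  -- weight rq² into rq³ on the magnetic side.
  have t1 : -(r * X) ≤ (μ / β) * (r ^ 2 * A) + Es / (4 * (μ / β)) := by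
    have := abs_le_of_sq_le_mul (y := r * X) (A := r ^ 2 * A) (S := Es) (s := μ / β)
      (by positivity) hE (by positivity) (by nlinarith [sq_nonneg r])
    linarith [neg_abs_le (r * X)]
  have t2 : Y ≤ (4 / β) * ((1 + r) * A) + (q * (r * Bs)) / (4 * (4 / β)) := by
    refine (le_abs_self Y).trans (abs_le_of_sq_le_mul (by positivity) (by positivity)
      (by positivity) (hY.trans (le_of_eq ?_)))
    linear_combination (-(A * r * Bs)) * hq
  have t3 : -Y ≤ β * A + (r * Bs) / (4 * β) := by
    have := abs_le_of_sq_le_mul (y := Y) hA (by positivity : 0 ≤ r * Bs) hβ hY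
    linarith [neg_abs_le Y]
  obtain ⟨w2, hw2⟩ : ∃ w2, w2 = r * q ^ 2 := ⟨_, rfl⟩
  obtain ⟨w3, hw3⟩ : ∃ w3, w3 = r * q ^ 3 := ⟨_, rfl⟩
  rw [← hw2, ← hw3]
  have hw20 : 0 ≤ w2 := by rw [hw2]; positivity
  have hw30 : 0 ≤ w3 := by rw [hw3]; positivity
  have hw2r : w2 ≤ r := by rw [hw2]; exact mul_le_of_le_one_right hr hq2
  have hw3r : w3 ≤ r := by rw [hw3]; exact mul_le_of_le_one_right hr hq3
  have hρ : r ^ 2 * q ^ 3 = w3 * r := by rw [hw3]; ring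
  have hρ2 : w3 * r ≤ w2 := by
    have : w3 * r = w2 * (r * q) := by rw [hw3, hw2]; ring
    rw [this]; exact mul_le_of_le_one_right hw20 hrq
  have i1 : w2 * (-(μ * r * X)) ≤ μ ^ 2 / β * (r * A) + β / 4 * (w2 * Es) := by
    have h1 : w2 * (-(μ * r * X)) ≤ w2 * (μ * ((μ / β) * (r ^ 2 * A) + Es / (4 * (μ / β)))) := by
      refine mul_le_mul_of_nonneg_left ?_ hw20
      have := mul_le_mul_of_nonneg_left t1 hμ.le
      linarith
    have h2 : w2 * (μ * ((μ / β) * (r ^ 2 * A) + Es / (4 * (μ / β)))) =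
        μ ^ 2 / β * (w2 * r ^ 2 * A) + β / 4 * (w2 * Es) := by
      field_simp
    have h3 : w2 * r ^ 2 * A ≤ r * A := by
      refine mul_le_mul_of_nonneg_right ?_ hA
      have : w2 * r ^ 2 = r * (r * q) ^ 2 := by rw [hw2]; ring
      rw [this]
      exact mul_le_of_le_one_right hr (pow_le_one₀ hrq0 hrq)
    have h4 : μ ^ 2 / β * (w2 * r ^ 2 * A) ≤ μ ^ 2 / β * (r * A) :=
      mul_le_mul_of_nonneg_left h3 (by positivity)
    linarith
  have i2 : w2 * Y ≤ 4 / β * (r * A) + β / 16 * (w3 * r * Bs) := by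
    have h1 := mul_le_mul_of_nonneg_left t2 hw20
    have h2 : w2 * ((4 / β) * ((1 + r) * A) + (q * (r * Bs)) / (4 * (4 / β))) =
        4 / β * ((r * q) * (q * (1 + r)) * A) + β / 16 * (w3 * r * Bs) := by
      rw [hw2, hw3]; field_simp; ring
    rw [h2, hq, mul_one] at h1
    have h3 : r * q * A ≤ r * A := by
      refine mul_le_mul_of_nonneg_right ?_ hA
      exact mul_le_of_le_one_right hr hq1
    have h4 : 4 / β * (r * q * A) ≤ 4 / β * (r * A) :=
      mul_le_mul_of_nonneg_left h3 (by positivity)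
    linarith
  have i3 : w3 * (-(β * Y)) ≤ β ^ 2 * (r * A) + 1 / 4 * (w3 * r * Bs) := by
    have h1 : w3 * (-(β * Y)) ≤ w3 * (β * (β * A + (r * Bs) / (4 * β))) := by
      refine mul_le_mul_of_nonneg_left ?_ hw30
      have := mul_le_mul_of_nonneg_left t3 hβ.le
      linarith
    have h2 : w3 * (β * (β * A + (r * Bs) / (4 * β))) =
        β ^ 2 * (w3 * A) + 1 / 4 * (w3 * r * Bs) := by field_simp
    have h3 : β ^ 2 * (w3 * A) ≤ β ^ 2 * (r * A) := by gcongr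
    linarith
  have i4 : w2 * (β * A) ≤ β * (r * A) := by
    have := mul_le_mul_of_nonneg_left (mul_le_mul_of_nonneg_right hw2r hA) hβ.le
    linarith
  have i5 : w3 * (r * Es - z) ≤ w2 * Es := by
    have := mul_le_mul_of_nonneg_right hρ2 hE
    have := mul_nonneg hw30 hz
    linarith
  have hrA : 0 ≤ r * A := mul_nonneg hr hA
  -- Magnetic balance: β/4 - β/16 - β/16 = β/8. Electric balance: β - β/4 - β/4 = β/2, where the
  -- second quarter pays for |ξ×E|². Since w3 r ≤ w2, all of these dominate β/8 times the common
  -- weight w3 r = r²q³.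
  have total : w2 * (-(β * Es) - β * N + β * A - μ * r * X + Y) +
      (β / 4) * (w3 * (-(r * Bs) - β * Y + (r * Es - z))) ≤
      (β + μ ^ 2 / β + 4 / β + β / 4 * β ^ 2) * (r * A) - β / 8 * (w3 * r) * (N + Es + Bs) := by
    have e1 := mul_le_mul_of_nonneg_right hρ2 hN
    have e2 := mul_le_mul_of_nonneg_right hρ2 hE
    have e3 : 0 ≤ w3 * r * Bs := by positivity
    have e4 : 0 ≤ w3 * r * Es := by positivity
    have e5 : 0 ≤ w3 * r * N := by positivity
    have e6 := mul_le_mul_of_nonneg_left i5 (by positivity : 0 ≤ β / 4)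
    have e7 := mul_le_mul_of_nonneg_left i3 (by positivity : 0 ≤ β / 4)
    have e8 := mul_le_mul_of_nonneg_left e1 hβ.le
    have e9 := mul_le_mul_of_nonneg_left e2 hβ.le
    have e10 := mul_nonneg hβ.le e3
    have e11 := mul_nonneg hβ.le e4
    have e12 := mul_nonneg hβ.le e5
    linarith
  have hm1 : min μ (κ * (β / 8)) ≤ μ := min_le_left _ _
  have hm2 : min μ (κ * (β / 8)) ≤ κ * (β / 8) := min_le_right _ _
  have hw3rr : w3 * r ≤ r := hρ2.trans hw2r
  have f1 : min μ (κ * (β / 8)) * ((w3 * r) * A) ≤ μ * (r * A) := by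
    have : 0 ≤ w3 * r := by positivity
    have := mul_le_mul_of_nonneg_right hw3rr hA
    gcongr
  have f2 : min μ (κ * (β / 8)) * ((w3 * r) * (N + Es + Bs)) ≤
      κ * (β / 8) * ((w3 * r) * (N + Es + Bs)) := by gcongr
  have f3 := mul_le_mul_of_nonneg_left total hκ.le
  have f4 := mul_le_mul_of_nonneg_right hκM hrA
  rw [hρ]
  linarith

theorem sum_rip_sq_le (p w : Fin 3 → ℂ) :
    (∑ i, rip (p i) (w i)) ^ 2 ≤ (∑ i, rip (p i) (p i)) * ∑ i, rip (w i) (w i) := by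
  have h1 : ∀ i, |rip (p i) (w i)| ≤ ‖p i‖ * ‖w i‖ := by
    intro i
    refine abs_le_of_sq_le_sq ?_ (by positivity)
    rw [mul_pow, ← rip_self, ← rip_self, rip, rip, rip]
    nlinarith [sq_nonneg ((p i).re * (w i).im - (p i).im * (w i).re)]
  have h2 : |∑ i, rip (p i) (w i)| ≤ ∑ i, ‖p i‖ * ‖w i‖ :=
    (Finset.abs_sum_le_sum_abs _ _).trans (Finset.sum_le_sum fun i _ => h1 i)
  rw [← sq_abs]
  simp_rw [rip_self]
  exact (pow_le_pow_left₀ (abs_nonneg _) h2 2).trans (Finset.sum_mul_sq_le_sq_mul_sq _ _ _)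

/-- Lagrange's identity: the defect is |ξ·w|². -/
theorem cross_norm_le (ξ : Fin 3 → ℝ) (w : Fin 3 → ℂ) :
    ∑ i, rip (crossApply (fun i => Complex.I * ξ i) w i) (crossApply (fun i => Complex.I * ξ i) w i)
      ≤ (∑ i, ξ i ^ 2) * ∑ i, rip (w i) (w i) := by
  have : (∑ i, ξ i ^ 2) * (∑ i, rip (w i) (w i)) - ∑ i,
      rip (crossApply (fun i => Complex.I * ξ i) w i) (crossApply (fun i => Complex.I * ξ i) w i) =
      (ξ 0 * (w 0).re + ξ 1 * (w 1).re + ξ 2 * (w 2).re) ^ 2 +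
      (ξ 0 * (w 0).im + ξ 1 * (w 1).im + ξ 2 * (w 2).im) ^ 2 := by
    simp only [crossApply_zero, crossApply_one, crossApply_two, Fin.sum_univ_three, rip]
    simp [pow_two]
    ring
  nlinarith [sq_nonneg (ξ 0 * (w 0).re + ξ 1 * (w 1).re + ξ 2 * (w 2).re),
    sq_nonneg (ξ 0 * (w 0).im + ξ 1 * (w 1).im + ξ 2 * (w 2).im)]

/-- The divergence constraints are propagated by the flow. -/
theorem constr_of_flow {γ β μ : ℝ} (hγ : γ ≠ 0) {d : Fin 3 → ℂ} {v : ℝ → Comp → ℂ}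
    (hv : ∀ t c, HasDerivAt (fun s => v s c) (symbApply γ β μ d (v t) c) t)
    (h0 : Constr γ β d (v 0)) (t : ℝ) : Constr γ β d (v t) := by
  have hγ' : (γ : ℂ) ≠ 0 := by exact_mod_cast hγ
  constructor
  -- The divergence of a curl vanishes, and the remaining β div u cancels against β/γ times the mass
  -- equation.
  · have hd : ∀ t, HasDerivAt (fun s => ∑ i, d i * v s (cE i) + (β / γ : ℝ) * v s cn) 0 t := by
      intro t
      refine ((HasDerivAt.fun_sum fun i _ => (hv t (cE i)).const_mul (d i)).add
        ((hv t cn).const_mul _)).congr_deriv ?_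
      simp only [symbApply_E, symbApply_n, Fin.sum_univ_three, crossApply_zero, crossApply_one,
        crossApply_two, Complex.ofReal_div]
      field_simp
      ring
    have := is_const_of_deriv_eq_zero (fun t => (hd t).differentiableAt) (fun t => (hd t).deriv) t 0
    rw [h0.1] at this
    rw [eq_neg_iff_add_eq_zero, this]
    ring
  · have hd : ∀ t, HasDerivAt (fun s => ∑ i, d i * v s (cB i)) 0 t := by
      intro t
      refine (HasDerivAt.fun_sum fun i _ => (hv t (cB i)).const_mul (d i)).congr_deriv ?_
      simp only [symbApply_B, Fin.sum_univ_three, crossApply_zero, crossApply_one,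
        crossApply_two]
      ring
    have := is_const_of_deriv_eq_zero (fun t => (hd t).differentiableAt) (fun t => (hd t).deriv) t 0
    rw [this, h0.2]

/-- Pointwise decay of the Fourier modes. -/
theorem exists_flow_decay {γ β μ : ℝ} (hγ : 0 < γ) (hβ : 0 < β) (hμ : 0 < μ) :
    ∃ a : ℝ, 0 < a ∧ ∀ (ξ : Fin 3 → ℝ) (v : ℝ → Comp → ℂ),
      (∀ t c, HasDerivAt (fun s => v s c)
        (symbApply γ β μ (fun i => Complex.I * ξ i) (v t) c) t) →
      Constr γ β (fun i => Complex.I * ξ i) (v 0) → ∀ t, 0 ≤ t →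
      ∑ c, ‖v t c‖ ^ 2 ≤ 3 * Real.exp (-(a * ((∑ i, ξ i ^ 2) ^ 2 / (1 + ∑ i, ξ i ^ 2) ^ 3)) * t) *
        ∑ c, ‖v 0 c‖ ^ 2 := by
  set M := β + μ ^ 2 / β + 4 / β + β / 4 * β ^ 2 with hM
  have hM0 : 0 < M := by positivity
  -- The first bound lets half of the viscous dissipation absorb all errors; the second makes the
  -- corrected energy equivalent to the energy.
  set κ := min (μ / M) (1 / (1 + β / 4)) with hκ
  have hκ0 : 0 < κ := lt_min (by positivity) (by positivity)
  have hκ1 : κ * M ≤ μ := by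
    have : κ ≤ μ / M := min_le_left _ _
    rwa [le_div_iff₀ hM0] at this
  have hκ2 : κ * (1 + β / 4) ≤ 1 := by
    have : κ ≤ 1 / (1 + β / 4) := min_le_right _ _
    rwa [le_div_iff₀ (by positivity)] at this
  set c0 := min μ (κ * (β / 8)) with hc0
  have hc00 : 0 < c0 := lt_min hμ (by positivity)
  refine ⟨2 / 3 * c0, by positivity, fun ξ v hv h0 t ht => ?_⟩
  have hcon := constr_of_flow hγ.ne' hv h0
  set r := ∑ i, ξ i ^ 2 with hr
  have hr0 : 0 ≤ r := Finset.sum_nonneg fun i _ => sq_nonneg _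
  set q := 1 / (1 + r) with hq
  have hqr : q * (1 + r) = 1 := by rw [hq]; field_simp
  have hq0 : 0 < q := by positivity
  have hq1 : q ≤ 1 := by nlinarith
  have hrq : r * q ≤ 1 := by nlinarith
  let d : Fin 3 → ℂ := fun i => Complex.I * ξ i
  let W : ℝ → ℝ := fun t => ∑ c, rip (v t c) (v t c)
  let X : ℝ → ℝ := fun t => ∑ i, rip (v t (cu i)) (v t (cE i))
  let Z : ℝ → ℝ := fun t => ∑ i, rip (v t (cE i)) (-crossApply d (fun l => v t (cB l)) i)
  let A : ℝ → ℝ := fun t => ∑ i, rip (v t (cu i)) (v t (cu i))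
  let Es : ℝ → ℝ := fun t => ∑ i, rip (v t (cE i)) (v t (cE i))
  let Bs : ℝ → ℝ := fun t => ∑ i, rip (v t (cB i)) (v t (cB i))
  -- The Lyapunov functional. The weights are bounded multiples of r/(1+r)² and r/(1+r)³, which
  -- keeps the corrections below W/2 at all frequencies.
  let Q : ℝ → ℝ := fun t => W t + κ * (r * q ^ 2) * X t + κ * (β / 4) * (r * q ^ 3) * Z t
  have hrip0 : ∀ z, 0 ≤ rip z z := fun z => by rw [rip_self]; positivity
  have hA0 : ∀ t, 0 ≤ A t := fun t => Finset.sum_nonneg fun i _ => hrip0 _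
  have hE0 : ∀ t, 0 ≤ Es t := fun t => Finset.sum_nonneg fun i _ => hrip0 _
  have hB0 : ∀ t, 0 ≤ Bs t := fun t => Finset.sum_nonneg fun i _ => hrip0 _
  have hWsum : ∀ t, W t = rip (v t cn) (v t cn) + A t + Es t + Bs t := fun t => by
    simp only [W, A, Es, Bs, sum_comp]; ring
  have hcross : ∀ t i, HasDerivAt (fun s => -crossApply d (fun l => v s (cB l)) i)
      (-crossApply d (fun l => symbApply γ β μ d (v t) (cB l)) i) t := fun t i =>
    (HasDerivAt.fun_sum fun l _ => (hv t (cB l)).const_mul (crossEntry d i l)).neg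
  have hW : ∀ t, HasDerivAt W (2 * -(μ * r * A t)) t := by
    intro t
    refine (HasDerivAt.fun_sum fun c _ => hasDerivAt_rip (hv t c) (hv t c)).congr_deriv ?_
    rw [Finset.sum_add_distrib]
    have h1 := energy_identity γ β μ ξ (v t)
    have h2 : ∑ c, rip (v t c) (symbApply γ β μ d (v t) c) =
        ∑ c, rip (symbApply γ β μ d (v t) c) (v t c) :=
      Finset.sum_congr rfl fun c _ => by simp only [rip]; ring
    rw [h2, h1]; ring
  have hX : ∀ t, HasDerivAt X (-(β * Es t) - β * rip (v t cn) (v t cn) + β * A t - μ * r * X t +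
      ∑ i, rip (v t (cu i)) (crossApply d (fun l => v t (cB l)) i)) t := by
    intro t
    refine (HasDerivAt.fun_sum fun i _ =>
      hasDerivAt_rip (hv t (cu i)) (hv t (cE i))).congr_deriv ?_
    exact electric_identity γ β μ ξ (v t) hγ.ne' (hcon t)
  have hZ : ∀ t, HasDerivAt Z (-(r * Bs t) - β * (∑ i, rip (v t (cu i))
      (crossApply d (fun l => v t (cB l)) i)) + (r * Es t - ‖∑ i, (ξ i : ℂ) * v t (cE i)‖ ^ 2)) t := by
    intro t
    refine (HasDerivAt.fun_sum fun i _ =>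
      hasDerivAt_rip (hv t (cE i)) (hcross t i)).congr_deriv ?_
    exact magnetic_identity γ β μ ξ (v t) (hcon t)
  have hXsq : ∀ t, X t ^ 2 ≤ A t * Es t := fun t => sum_rip_sq_le _ _
  have hcrossB : ∀ t, ∑ i, rip (crossApply d (fun l => v t (cB l)) i)
      (crossApply d (fun l => v t (cB l)) i) ≤ r * Bs t := fun t => cross_norm_le ξ _
  have hQ : ∀ t, ∃ Q', HasDerivAt Q Q' t ∧ Q' ≤ -(c0 * (r ^ 2 * q ^ 3) * W t) := by
    intro t
    refine ⟨_, ((hW t).add ((hX t).const_mul _)).add ((hZ t).const_mul _), ?_⟩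
    have := lyapunov_ineq hβ hμ hr0 hqr (hA0 t) (hrip0 (v t cn)) (hE0 t) (hB0 t)
      (sq_nonneg ‖∑ i, (ξ i : ℂ) * v t (cE i)‖) (hXsq t)
      ((sum_rip_sq_le _ _).trans (mul_le_mul_of_nonneg_left (hcrossB t) (hA0 t))) hκ0 hκ1
    rw [hWsum]
    exact this
  have hw2 : r * q ^ 2 ≤ 1 := by nlinarith
  have hXb : ∀ t, |κ * (r * q ^ 2) * X t| ≤ κ * ((A t + Es t) / 2) := by
    intro t
    have h1 := abs_le_of_sq_le_mul (hA0 t) (hE0 t) (by norm_num : (0 : ℝ) < 1 / 2) (hXsq t)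
    rw [abs_mul, abs_of_nonneg (by positivity), mul_assoc]
    refine mul_le_mul_of_nonneg_left ?_ hκ0.le
    have h2 : r * q ^ 2 * |X t| ≤ 1 * |X t| := mul_le_mul_of_nonneg_right hw2 (abs_nonneg _)
    linarith
  have hZb : ∀ t, |κ * (β / 4) * (r * q ^ 3) * Z t| ≤ κ * (β / 4) * ((Es t + Bs t) / 2) := by
    intro t
    have hZsq : (r * q ^ 3 * Z t) ^ 2 ≤ Es t * Bs t := by
      have h1 : Z t ^ 2 ≤ Es t * (r * Bs t) := by
        refine (sum_rip_sq_le _ _).trans (mul_le_mul_of_nonneg_left ?_ (hE0 t))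
        refine le_trans (le_of_eq ?_) (hcrossB t)
        exact Finset.sum_congr rfl fun i _ => by simp [rip]
      have h2 : (r * q ^ 3 * Z t) ^ 2 ≤ (r * q ^ 3) ^ 2 * (Es t * (r * Bs t)) := by
        rw [mul_pow]; exact mul_le_mul_of_nonneg_left h1 (sq_nonneg _)
      have h3 : (r * q ^ 3) ^ 2 * (Es t * (r * Bs t)) = ((r * q) ^ 3 * q ^ 3) * (Es t * Bs t) := by
        ring
      have h4 : (r * q) ^ 3 * q ^ 3 ≤ 1 :=
        mul_le_one₀ (pow_le_one₀ (by positivity) hrq) (by positivity) (pow_le_one₀ hq0.le hq1)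
      have h5 := mul_nonneg (hE0 t) (hB0 t)
      nlinarith
    have h1 := abs_le_of_sq_le_mul (hE0 t) (hB0 t) (by norm_num : (0 : ℝ) < 1 / 2) hZsq
    rw [mul_assoc (κ * (β / 4)), abs_mul, abs_of_nonneg (by positivity : 0 ≤ κ * (β / 4))]
    refine mul_le_mul_of_nonneg_left ?_ (by positivity)
    linarith
  have hQW : ∀ t, W t / 2 ≤ Q t ∧ Q t ≤ 3 / 2 * W t := by
    intro t
    have h1 := abs_le.1 (hXb t)
    have h2 := abs_le.1 (hZb t)
    have h3 := hWsum t
    have h4 := hrip0 (v t cn)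
    have h5 := hA0 t
    have h6 := hE0 t
    have h7 := hB0 t
    have h8 : κ * ((A t + Es t) / 2) + κ * (β / 4) * ((Es t + Bs t) / 2) ≤ W t / 2 := by
      have : κ * ((A t + Es t) / 2) + κ * (β / 4) * ((Es t + Bs t) / 2) ≤
          κ * (1 + β / 4) * (W t / 2) := by
        have e1 : A t + Es t ≤ W t := by linarith
        have e2 : Es t + Bs t ≤ W t := by linarith
        have e3 : κ * ((A t + Es t) / 2) ≤ κ * (W t / 2) := by gcongr
        have e4 : κ * (β / 4) * ((Es t + Bs t) / 2) ≤ κ * (β / 4) * (W t / 2) := by gcongr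
        linarith
      have e5 : 0 ≤ W t / 2 := by linarith
      nlinarith
    constructor <;> simp only [Q] <;> linarith [h1.1, h1.2, h2.1, h2.2]
  set ρ := r ^ 2 * q ^ 3 with hρ
  have hρ0 : 0 ≤ ρ := by positivity
  -- Gronwall: Q' ≤ -c0 ρ W and Q ≤ (3/2) W give Q' ≤ -(2/3) c0 ρ Q. The factor 3 in the conclusion
  -- is (3/2)/(1/2).
  have hanti : Antitone fun t => Real.exp (2 / 3 * c0 * ρ * t) * Q t := by
    choose Q' hQ'd hQ'l using hQ
    have hd : ∀ t, HasDerivAt (fun t => Real.exp (2 / 3 * c0 * ρ * t) * Q t)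
        (Real.exp (2 / 3 * c0 * ρ * t) * (2 / 3 * c0 * ρ) * Q t +
          Real.exp (2 / 3 * c0 * ρ * t) * Q' t) t := by
      intro t
      refine HasDerivAt.mul ?_ (hQ'd t)
      have := ((hasDerivAt_id t).const_mul (2 / 3 * c0 * ρ)).exp
      simpa using this
    refine antitone_of_deriv_nonpos (fun t => (hd t).differentiableAt) fun t => ?_
    rw [(hd t).deriv]
    have h1 : 2 / 3 * c0 * ρ * Q t + Q' t ≤ 0 := by
      have h2 := (hQW t).2
      have h3 := mul_le_mul_of_nonneg_left h2 (by positivity : 0 ≤ 2 / 3 * c0 * ρ)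
      have h4 := hQ'l t
      linarith
    have h2 := Real.exp_pos (2 / 3 * c0 * ρ * t)
    nlinarith
  have hfin := hanti ht
  simp only [mul_zero, Real.exp_zero, one_mul] at hfin
  have hWn : ∀ t, ∑ c, ‖v t c‖ ^ 2 = W t := fun t => by simp only [W, rip_self]
  rw [hWn, hWn]
  have hρq : r ^ 2 / (1 + r) ^ 3 = ρ := by rw [hρ, hq]; field_simp
  rw [hρq]
  have h1 := (hQW t).1
  have h2 := (hQW 0).2
  have h3 := Real.exp_pos (2 / 3 * c0 * ρ * t)
  have h4 : -(2 / 3 * c0 * ρ) * t = -(2 / 3 * c0 * ρ * t) := by ring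
  rw [h4, Real.exp_neg]
  have h5 : Q t ≤ (Real.exp (2 / 3 * c0 * ρ * t))⁻¹ * Q 0 := by
    rw [← div_eq_inv_mul, le_div_iff₀ h3]; linarith
  have h6 : (Real.exp (2 / 3 * c0 * ρ * t))⁻¹ * Q 0 ≤
      (Real.exp (2 / 3 * c0 * ρ * t))⁻¹ * (3 / 2 * W 0) := by gcongr
  linarith

/-! ### Distributions represented by functions, and their Fourier transforms -/

open FourierTransform

/-- The functional `T` on Schwartz functions is integration against the function `g`. -/
structure IsRep (T : 𝓢(Space, ℂ) → ℂ) (g : Space → ℂ) : Prop where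
  meas : AEStronglyMeasurable g volume
  loc : LocallyIntegrable g volume
  int : ∀ φ : 𝓢(Space, ℂ), Integrable (fun x => φ x * g x) volume
  eq : ∀ φ : 𝓢(Space, ℂ), T φ = ∫ x, φ x * g x

namespace IsRep

variable {T S : 𝓢(Space, ℂ) → ℂ} {g h : Space → ℂ}

theorem ae_eq_of_eqOn (hg : LocallyIntegrable g volume) (hh : LocallyIntegrable h volume)
    (H : ∀ φ : 𝓢(Space, ℂ), HasCompactSupport φ → ∫ x, φ x * g x = ∫ x, φ x * h x) :
    g =ᵐ[volume] h := by
  refine ae_eq_of_integral_contDiff_smul_eq hg hh fun f hf hfc => ?_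
  have h1 : HasCompactSupport (Complex.ofRealCLM ∘ f) := hfc.comp_left rfl
  have h2 : ContDiff ℝ ((⊤ : ℕ∞) : WithTop ℕ∞) (Complex.ofRealCLM ∘ f) :=
    Complex.ofRealCLM.contDiff.comp hf
  have := H (h1.toSchwartzMap h2) h1
  simpa using this

theorem ae_eq (hT : IsRep T g) (hT' : IsRep T h) : g =ᵐ[volume] h :=
  ae_eq_of_eqOn hT.loc hT'.loc fun φ _ => by rw [← hT.eq, ← hT'.eq]

theorem congr (hT : IsRep T g) (hTS : ∀ φ, S φ = T φ) : IsRep S g :=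
  ⟨hT.meas, hT.loc, hT.int, fun φ => (hTS φ).trans (hT.eq φ)⟩

theorem add (hT : IsRep T g) (hS : IsRep S h) :
    IsRep (fun φ => T φ + S φ) (fun x => g x + h x) where
  meas := hT.meas.add hS.meas
  loc := hT.loc.add hS.loc
  int φ := by simp only [mul_add]; exact (hT.int φ).add (hS.int φ)
  eq φ := by rw [hT.eq, hS.eq]; simp only [mul_add]; rw [integral_add (hT.int φ) (hS.int φ)]

theorem const_mul (hT : IsRep T g) (c : ℂ) : IsRep (fun φ => c * T φ) (fun x => c * g x) where
  meas := hT.meas.const_mul c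
  loc := hT.loc.smul c
  int φ := by
    refine ((hT.int φ).const_mul c).congr (Eventually.of_forall fun x => ?_)
    simp only []; ring
  eq φ := by
    rw [hT.eq, ← integral_const_mul]
    exact integral_congr_ae (Eventually.of_forall fun x => by simp only []; ring)

theorem zero : IsRep (fun _ => 0) (fun _ => 0) where
  meas := aestronglyMeasurable_const
  loc := locallyIntegrable_zero
  int φ := by simp
  eq φ := by simp

theorem sum {ι : Type*} (s : Finset ι) {T : ι → 𝓢(Space, ℂ) → ℂ} {g : ι → Space → ℂ}
    (h : ∀ i ∈ s, IsRep (T i) (g i)) :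
    IsRep (fun φ => ∑ i ∈ s, T i φ) (fun x => ∑ i ∈ s, g i x) := by
  classical
  induction s using Finset.induction_on with
  | empty => simpa using zero
  | insert a s ha ih =>
    simp only [Finset.sum_insert ha]
    exact (h a (Finset.mem_insert_self _ _)).add
      (ih fun i hi => h i (Finset.mem_insert_of_mem hi))

theorem smulLeft (hT : IsRep T g) {a : Space → ℂ} (ha : a.HasTemperateGrowth) :
    IsRep (fun φ => T (SchwartzMap.smulLeftCLM ℂ a φ)) (fun x => a x * g x) where
  meas := ha.1.continuous.aestronglyMeasurable.mul hT.meas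
  loc := by
    have := hT.loc.locallyIntegrableOn Set.univ
    rw [← locallyIntegrableOn_univ]
    exact this.continuousOn_mul ha.1.continuous.continuousOn isOpen_univ.isLocallyClosed
  int φ := by
    refine (hT.int (SchwartzMap.smulLeftCLM ℂ a φ)).congr (Eventually.of_forall fun x => ?_)
    simp only [SchwartzMap.smulLeftCLM_apply_apply ha, smul_eq_mul]; ring
  eq φ := by
    rw [hT.eq]
    refine integral_congr_ae (Eventually.of_forall fun x => ?_)
    simp only [SchwartzMap.smulLeftCLM_apply_apply ha, smul_eq_mul]; ring

/-- An `L^p` function defines a distribution. -/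
theorem of_memLp {p : ℝ≥0∞} (hp : 1 ≤ p) (hg : MemLp g p volume)
    (hT : ∀ φ : 𝓢(Space, ℂ), T φ = ∫ x, φ x * g x) : IsRep T g where
  meas := hg.1
  loc := hg.locallyIntegrable hp
  int φ := by
    have := ENNReal.HolderConjugate.inv_one_sub_inv' hp
    exact MemLp.integrable_mul (p := (1 - p⁻¹)⁻¹) (q := p) (φ.memLp _ volume) hg
  eq := hT

end IsRep

theorem integral_fourier_mul_of_integrable {f : Space → ℂ} (hf : Integrable f volume)
    (φ : 𝓢(Space, ℂ)) : ∫ x, 𝓕 φ x * f x = ∫ x, φ x * 𝓕 f x := by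
  have := VectorFourier.integral_bilin_fourierIntegral_eq_flip (ContinuousLinearMap.mul ℂ ℂ)
    (L := innerₗ Space) (μ := volume) (ν := volume) Real.continuous_fourierChar continuous_inner
    (φ.integrable (μ := volume)) hf
  simpa using! this

theorem integral_fourierInv_mul_of_integrable {f : Space → ℂ} (hf : Integrable f volume)
    (φ : 𝓢(Space, ℂ)) : ∫ x, 𝓕⁻ φ x * f x = ∫ x, φ x * 𝓕⁻ f x := by
  have h1 := integral_fourier_mul_of_integrable hf.comp_neg φ
  have h2 : 𝓕⁻ f = 𝓕 (fun x => f (-x)) := Real.fourierInv_eq_fourier_comp_neg f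
  rw [h2, ← h1, ← integral_neg_eq_self]
  refine integral_congr_ae (Eventually.of_forall fun x => ?_)
  simp only []
  rw [SchwartzMap.fourierInv_coe, Real.fourierInv_eq_fourier_neg, neg_neg]
  rfl

theorem norm_fourier_le_integral (f : Space → ℂ) (x : Space) : ‖𝓕 f x‖ ≤ ∫ y, ‖f y‖ :=
  VectorFourier.norm_fourierIntegral_le_integral_norm _ _ _ _ _

theorem norm_fourierInv_le_integral (f : Space → ℂ) (x : Space) : ‖𝓕⁻ f x‖ ≤ ∫ y, ‖f y‖ := by
  rw [Real.fourierInv_eq_fourier_neg]; exact norm_fourier_le_integral f _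

theorem continuous_fourier_of_integrable {f : Space → ℂ} (hf : Integrable f volume) :
    Continuous (𝓕 f) :=
  VectorFourier.fourierIntegral_continuous Real.continuous_fourierChar continuous_inner hf

theorem continuous_fourierInv_of_integrable {f : Space → ℂ} (hf : Integrable f volume) :
    Continuous (𝓕⁻ f) := by
  have : 𝓕⁻ f = fun x => 𝓕 f (-x) := funext fun x => Real.fourierInv_eq_fourier_neg f x
  rw [this]
  exact (continuous_fourier_of_integrable hf).comp continuous_neg

/-- The Fourier transform of an `L²` function. -/
theorem exists_fourier_memLp_two {f : Space → ℂ} (hf : MemLp f 2 volume) :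
    ∃ g : Space → ℂ, MemLp g 2 volume ∧ eLpNorm g 2 volume = eLpNorm f 2 volume ∧
      ∀ φ : 𝓢(Space, ℂ), ∫ x, 𝓕 φ x * f x = ∫ x, φ x * g x := by
  let F := hf.toLp f
  refine ⟨(𝓕 F : Lp ℂ 2 (volume : Measure Space)), Lp.memLp _, ?_, fun φ => ?_⟩
  · have h1 := Lp.norm_fourier_eq F
    rw [Lp.norm_def, Lp.norm_def, ENNReal.toReal_eq_toReal_iff' (Lp.eLpNorm_ne_top _)
      (Lp.eLpNorm_ne_top _)] at h1
    rw [h1, eLpNorm_congr_ae hf.coeFn_toLp]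
  · have h1 := congrArg (fun T : Distr => T φ) (Lp.fourier_toTemperedDistribution_eq F)
    simp only [TemperedDistribution.fourier_apply, Lp.toTemperedDistribution_apply,
      smul_eq_mul] at h1
    rw [← h1]
    refine integral_congr_ae ?_
    filter_upwards [hf.coeFn_toLp] with x hx
    rw [hx]

/-- The inverse Fourier transform of an `L²` function. -/
theorem exists_fourierInv_memLp_two {f : Space → ℂ} (hf : MemLp f 2 volume) :
    ∃ g : Space → ℂ, MemLp g 2 volume ∧ eLpNorm g 2 volume = eLpNorm f 2 volume ∧
      ∀ φ : 𝓢(Space, ℂ), ∫ x, 𝓕⁻ φ x * f x = ∫ x, φ x * g x := by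
  let F := hf.toLp f
  refine ⟨(𝓕⁻ F : Lp ℂ 2 (volume : Measure Space)), Lp.memLp _, ?_, fun φ => ?_⟩
  · have h1 := Lp.norm_fourier_eq (𝓕⁻ F)
    rw [FourierTransform.fourier_fourierInv_eq, Lp.norm_def, Lp.norm_def,
      ENNReal.toReal_eq_toReal_iff' (Lp.eLpNorm_ne_top _) (Lp.eLpNorm_ne_top _)] at h1
    rw [← h1, eLpNorm_congr_ae hf.coeFn_toLp]
  · have h1 := congrArg (fun T : Distr => T φ) (Lp.fourierInv_toTemperedDistribution_eq F)
    simp only [TemperedDistribution.fourierInv_apply, Lp.toTemperedDistribution_apply,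
      smul_eq_mul] at h1
    rw [← h1]
    refine integral_congr_ae ?_
    filter_upwards [hf.coeFn_toLp] with x hx
    rw [hx]

/-! ### Weighted L² bounds for Fourier transforms -/

theorem lintegral_rpow_eq {f : Space → ℂ} {p : ℝ≥0∞} (hp0 : p ≠ 0) (hpt : p ≠ ∞)
    (hf : MemLp f p volume) :
    ∫⁻ x, ‖f x‖ₑ ^ p.toReal = ENNReal.ofReal ((eLpNorm f p volume).toReal ^ p.toReal) := by
  have hp : 0 < p.toReal := ENNReal.toReal_pos hp0 hpt
  rw [← ENNReal.ofReal_rpow_of_nonneg ENNReal.toReal_nonneg hp.le,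
    ENNReal.ofReal_toReal hf.2.ne, eLpNorm_eq_lintegral_rpow_enorm_toReal hp0 hpt, one_div,
    ENNReal.rpow_inv_rpow hp.ne']

theorem enorm_le_of_lt {z : ℂ} {l p : ℝ} (hl : 0 < l) (hp : 1 ≤ p) (hz : l < ‖z‖) :
    ‖z‖ₑ ≤ ENNReal.ofReal (l ^ (1 - p)) * ‖z‖ₑ ^ p := by
  have hz0 : 0 < ‖z‖ := hl.trans hz
  rw [← ofReal_norm, ENNReal.ofReal_rpow_of_pos hz0, ← ENNReal.ofReal_mul (by positivity)]
  refine ENNReal.ofReal_le_ofReal ?_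
  have h1 : ‖z‖ ^ (1 - p) ≤ l ^ (1 - p) :=
    Real.rpow_le_rpow_of_nonpos hl hz.le (by linarith)
  calc ‖z‖ = ‖z‖ ^ (1 - p) * ‖z‖ ^ p := by
        rw [← Real.rpow_add hz0]; simp
    _ ≤ _ := by gcongr

theorem enorm_sq_le_of_le {z : ℂ} {l p : ℝ} (hp : 1 ≤ p) (hp2 : p ≤ 2) (hz : ‖z‖ ≤ l) :
    ‖z‖ₑ ^ (2 : ℝ) ≤ ENNReal.ofReal (l ^ (2 - p)) * ‖z‖ₑ ^ p := by
  have hl : 0 ≤ l := (norm_nonneg _).trans hz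
  rw [← ofReal_norm, ENNReal.ofReal_rpow_of_nonneg (norm_nonneg _) (by linarith),
    ENNReal.ofReal_rpow_of_nonneg (norm_nonneg _) (by linarith),
    ← ENNReal.ofReal_mul (by positivity)]
  refine ENNReal.ofReal_le_ofReal ?_
  calc ‖z‖ ^ (2 : ℝ) = ‖z‖ ^ (2 - p) * ‖z‖ ^ p := by
        rw [← Real.rpow_add_of_nonneg (norm_nonneg _) (by linarith) (by linarith)]; simp
    _ ≤ _ := by
      have : ‖z‖ ^ (2 - p) ≤ l ^ (2 - p) := Real.rpow_le_rpow (norm_nonneg _) hz (by linarith)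
      gcongr

/-- Splitting the Fourier transform of an `L^p` function, `1 ≤ p ≤ 2`, into a bounded and a square
integrable part, by cutting the function at height `l`. -/
theorem exists_fourier_split {p : ℝ≥0∞} (hp : 1 ≤ p) (hp2 : p ≤ 2) {f : Space → ℂ}
    (hf : MemLp f p volume) {l : ℝ} (hl : 0 < l) :
    ∃ g₁ g₂ : Space → ℂ, Continuous g₁ ∧ MemLp g₂ 2 volume ∧
      (∀ x, ‖g₁ x‖ ≤ l ^ (1 - p.toReal) * (eLpNorm f p volume).toReal ^ p.toReal) ∧
      eLpNorm g₂ 2 volume ≤ ENNReal.ofReal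
        ((l ^ (2 - p.toReal) * (eLpNorm f p volume).toReal ^ p.toReal) ^ (1 / 2 : ℝ)) ∧
      IsRep (fun φ => ∫ x, 𝓕 φ x * f x) (fun x => g₁ x + g₂ x) := by
  -- A strongly measurable representative makes the level set {|f| > l} measurable.
  wlog hfm : StronglyMeasurable f generalizing f
  · have hae := hf.1.ae_eq_mk
    have hf' := (memLp_congr_ae hae).1 hf
    obtain ⟨g₁, g₂, h1, h2, h3, h4, h5⟩ := this hf' hf.1.stronglyMeasurable_mk
    rw [← eLpNorm_congr_ae hae] at h3 h4
    refine ⟨g₁, g₂, h1, h2, h3, h4, h5.congr fun φ => integral_congr_ae ?_⟩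
    filter_upwards [hae] with x hx
    rw [hx]
  have hpt : p ≠ ∞ := ne_top_of_le_ne_top ENNReal.ofNat_ne_top hp2
  have hp0 : p ≠ 0 := (zero_lt_one.trans_le hp).ne'
  have hpr : 1 ≤ p.toReal := by
    simpa using ENNReal.toReal_mono hpt hp
  have hpr2 : p.toReal ≤ 2 := by
    simpa using ENNReal.toReal_mono ENNReal.ofNat_ne_top hp2
  set F := (eLpNorm f p volume).toReal with hF
  have hF0 : 0 ≤ F := ENNReal.toReal_nonneg
  let s : Set Space := {x | l < ‖f x‖}
  have hs : MeasurableSet s := measurableSet_lt measurable_const hfm.norm.measurable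
  let f₁ := s.indicator f
  let f₂ := sᶜ.indicator f
  have hlin := lintegral_rpow_eq hp0 hpt hf
  have hb1 : ∫⁻ x, ‖f₁ x‖ₑ ≤ ENNReal.ofReal (l ^ (1 - p.toReal) * F ^ p.toReal) := by
    rw [ENNReal.ofReal_mul (by positivity), ← hlin,
      ← lintegral_const_mul' _ _ ENNReal.ofReal_ne_top]
    refine lintegral_mono fun x => ?_
    by_cases hx : x ∈ s
    · simp only [f₁, Set.indicator_of_mem hx]
      exact enorm_le_of_lt hl hpr hx
    · simp [f₁, Set.indicator_of_notMem hx]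
  have hb2 : ∫⁻ x, ‖f₂ x‖ₑ ^ (2 : ℝ) ≤ ENNReal.ofReal (l ^ (2 - p.toReal) * F ^ p.toReal) := by
    rw [ENNReal.ofReal_mul (by positivity), ← hlin,
      ← lintegral_const_mul' _ _ ENNReal.ofReal_ne_top]
    refine lintegral_mono fun x => ?_
    by_cases hx : x ∈ s
    · simp [f₂, hx]
    · have hx' : x ∈ sᶜ := hx
      simp only [f₂, Set.indicator_of_mem hx']
      exact enorm_sq_le_of_le hpr hpr2 (not_lt.1 hx)
  have hm1 : AEStronglyMeasurable f₁ volume := (hfm.indicator hs).aestronglyMeasurable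
  have hm2 : AEStronglyMeasurable f₂ volume := (hfm.indicator hs.compl).aestronglyMeasurable
  have hi1 : Integrable f₁ volume := ⟨hm1, hb1.trans_lt ENNReal.ofReal_lt_top⟩
  have hn2 : eLpNorm f₂ 2 volume ≤ ENNReal.ofReal ((l ^ (2 - p.toReal) * F ^ p.toReal) ^ (1 / 2 : ℝ)) := by
    rw [eLpNorm_eq_lintegral_rpow_enorm_toReal two_ne_zero ENNReal.ofNat_ne_top,
      ← ENNReal.ofReal_rpow_of_nonneg (by positivity) (by norm_num)]
    simp only [ENNReal.toReal_ofNat]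
    gcongr
  have hi2 : MemLp f₂ 2 volume := ⟨hm2, hn2.trans_lt ENNReal.ofReal_lt_top⟩
  obtain ⟨g₂, hg2, hg2n, hg2e⟩ := exists_fourier_memLp_two hi2
  have hcont := continuous_fourier_of_integrable hi1
  have hbound : ∀ x, ‖𝓕 f₁ x‖ ≤ l ^ (1 - p.toReal) * F ^ p.toReal := by
    intro x
    refine (norm_fourier_le_integral f₁ x).trans ?_
    rw [integral_norm_eq_lintegral_enorm hm1]
    refine ENNReal.toReal_le_of_le_ofReal (by positivity) hb1
  refine ⟨𝓕 f₁, g₂, hcont, hg2, hbound, hg2n.le.trans hn2, ?_⟩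
  have r1 : IsRep (fun φ => ∫ x, 𝓕 φ x * f₁ x) (𝓕 f₁) :=
    IsRep.of_memLp le_top (memLp_top_of_bound hcont.aestronglyMeasurable _
      (Eventually.of_forall hbound)) (integral_fourier_mul_of_integrable hi1)
  have r2 : IsRep (fun φ => ∫ x, 𝓕 φ x * f₂ x) g₂ := IsRep.of_memLp one_le_two hg2 hg2e
  refine (r1.add r2).congr fun φ => ?_
  have e1 : Integrable (fun x => 𝓕 φ x * f₁ x) volume :=
    (IsRep.of_memLp le_rfl (memLp_one_iff_integrable.2 hi1) (fun φ => rfl)).int (𝓕 φ)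
  have e2 : Integrable (fun x => 𝓕 φ x * f₂ x) volume :=
    (IsRep.of_memLp one_le_two hi2 (fun φ => rfl)).int (𝓕 φ)
  rw [← integral_add e1 e2]
  refine integral_congr_ae (Eventually.of_forall fun x => ?_)
  simp only [f₁, f₂, ← mul_add]
  rw [← Pi.add_apply (s.indicator f), Set.indicator_self_add_compl]

/-- The Fourier transform of an `L^p` function, `1 ≤ p ≤ 2`, is a function, square integrable against
square integrable weights. -/
theorem exists_fourier_weighted {p : ℝ≥0∞} (hp : 1 ≤ p) (hp2 : p ≤ 2) {f : Space → ℂ}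
    (hf : MemLp f p volume) :
    ∃ g : Space → ℂ, IsRep (fun φ => ∫ x, 𝓕 φ x * f x) g ∧
      (∀ w : Space → ℝ, (∀ x, 0 ≤ w x) → (∀ x, w x ≤ 1) → MemLp w 2 volume →
        eLpNorm (fun x => (w x : ℂ) * g x) 2 volume ≤ ENNReal.ofReal
          (2 * (eLpNorm w 2 volume).toReal ^ (2 * (p⁻¹).toReal - 1) *
            (eLpNorm f p volume).toReal)) ∧
      (p = 2 → eLpNorm g 2 volume = eLpNorm f 2 volume) := by
  have hpt : p ≠ ∞ := ne_top_of_le_ne_top ENNReal.ofNat_ne_top hp2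
  have hpr : 1 ≤ p.toReal := by
    simpa using ENNReal.toReal_mono hpt hp
  have hpr2 : p.toReal ≤ 2 := by
    simpa using ENNReal.toReal_mono ENNReal.ofNat_ne_top hp2
  -- Height 1 only serves to define the transform. Splittings at other heights represent the same
  -- functional, hence the same function almost everywhere, so the height may be optimized for each
  -- weight.
  obtain ⟨a, b, ha, hb, -, -, hrep⟩ := exists_fourier_split hp hp2 hf one_pos
  refine ⟨_, hrep, fun w hw0 hw1 hw => ?_, ?_⟩
  swap
  · rintro rfl
    obtain ⟨g, hg, hgn, hge⟩ := exists_fourier_memLp_two hf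
    rw [← hgn]
    exact eLpNorm_congr_ae (hrep.ae_eq (IsRep.of_memLp one_le_two hg hge))
  set F := (eLpNorm f p volume).toReal with hF
  have hF0 : 0 ≤ F := ENNReal.toReal_nonneg
  set W := (eLpNorm w 2 volume).toReal with hW
  have hW0 : 0 ≤ W := ENNReal.toReal_nonneg
  have hWe : eLpNorm w 2 volume = ENNReal.ofReal W := (ENNReal.ofReal_toReal hw.2.ne).symm
  rcases hW0.eq_or_lt with hW00 | hWpos
  · have hw0 : w =ᵐ[volume] 0 := by
      rw [← hW00, ENNReal.ofReal_zero] at hWe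
      exact (eLpNorm_eq_zero_iff hw.1 two_ne_zero).1 hWe
    have : (fun x => (w x : ℂ) * (a x + b x)) =ᵐ[volume] 0 := by
      filter_upwards [hw0] with x hx
      simp [hx]
    rw [eLpNorm_congr_ae this, eLpNorm_zero]
    exact zero_le
  have key : ∀ l : ℝ, 0 < l → eLpNorm (fun x => (w x : ℂ) * (a x + b x)) 2 volume ≤
      ENNReal.ofReal (W * (l ^ (1 - p.toReal) * F ^ p.toReal) +
        (l ^ (2 - p.toReal) * F ^ p.toReal) ^ (1 / 2 : ℝ)) := by
    intro l hl
    obtain ⟨g₁, g₂, hg1, hg2, hb1, hb2, hrep'⟩ := exists_fourier_split hp hp2 hf hl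
    have hae := hrep.ae_eq hrep'
    have h1 : (fun x => (w x : ℂ) * (a x + b x)) =ᵐ[volume]
        (fun x => (w x : ℂ) * g₁ x) + fun x => (w x : ℂ) * g₂ x := by
      filter_upwards [hae] with x hx
      simp only [Pi.add_apply, hx]; ring
    have hwc : AEStronglyMeasurable (fun x => (w x : ℂ)) volume :=
      Complex.continuous_ofReal.comp_aestronglyMeasurable hw.1
    rw [eLpNorm_congr_ae h1, ENNReal.ofReal_add (by positivity) (by positivity)]
    refine (eLpNorm_add_le (hwc.mul hg1.aestronglyMeasurable) (hwc.mul hg2.1) one_le_two).trans ?_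
    refine add_le_add ?_ ((eLpNorm_mono fun x => ?_).trans hb2)
    · have hK : 0 ≤ l ^ (1 - p.toReal) * F ^ p.toReal := by positivity
      have := eLpNorm_le_mul_eLpNorm_of_ae_le_mul (f := fun x => (w x : ℂ) * g₁ x) (g := w)
        (c := l ^ (1 - p.toReal) * F ^ p.toReal) (μ := volume)
        (Eventually.of_forall fun x => by
          rw [norm_mul, Complex.norm_real, mul_comm]
          exact mul_le_mul_of_nonneg_right (hb1 x) (norm_nonneg _)) 2
      refine this.trans (le_of_eq ?_)
      rw [hWe, ENNReal.ofReal_mul hW0, mul_comm]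
    · rw [Pi.mul_apply, norm_mul, Complex.norm_real, Real.norm_eq_abs, abs_of_nonneg (hw0 x)]
      exact mul_le_of_le_one_left (norm_nonneg _) (hw1 x)
  have hpinv : (p⁻¹).toReal = 1 / p.toReal := by rw [ENNReal.toReal_inv, one_div]
  rcases hF0.eq_or_lt with hF00 | hFpos
  · refine (key 1 one_pos).trans ?_
    rw [← hF00, Real.zero_rpow (by linarith)]
    simp
  -- This height makes the two contributions equal, which is where the factor 2 comes from.
  · refine (key (F * W ^ (2 / p.toReal)) (by positivity)).trans (ENNReal.ofReal_le_ofReal ?_)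
    have e1 : W * ((F * W ^ (2 / p.toReal)) ^ (1 - p.toReal) * F ^ p.toReal) =
        W ^ (2 * (p⁻¹).toReal - 1) * F := by
      rw [Real.mul_rpow hF0 (by positivity), ← Real.rpow_mul hW0]
      have : W * (F ^ (1 - p.toReal) * W ^ (2 / p.toReal * (1 - p.toReal)) * F ^ p.toReal) =
          (W ^ (1 : ℝ) * W ^ (2 / p.toReal * (1 - p.toReal))) *
            (F ^ (1 - p.toReal) * F ^ p.toReal) := by
        rw [Real.rpow_one]; ring
      rw [this, ← Real.rpow_add hWpos, ← Real.rpow_add hFpos, hpinv]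
      congr 1
      · congr 1; field_simp; ring
      · simp
    have e2 : ((F * W ^ (2 / p.toReal)) ^ (2 - p.toReal) * F ^ p.toReal) ^ (1 / 2 : ℝ) =
        W ^ (2 * (p⁻¹).toReal - 1) * F := by
      rw [Real.mul_rpow hF0 (by positivity), ← Real.rpow_mul hW0]
      have : F ^ (2 - p.toReal) * W ^ (2 / p.toReal * (2 - p.toReal)) * F ^ p.toReal =
          W ^ (2 / p.toReal * (2 - p.toReal)) * (F ^ (2 - p.toReal) * F ^ p.toReal) := by ring
      rw [this, ← Real.rpow_add hFpos, Real.mul_rpow (by positivity) (by positivity),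
        ← Real.rpow_mul hW0, ← Real.rpow_mul hF0, hpinv]
      congr 1
      · congr 1; field_simp
      · norm_num
    rw [e1, e2]
    linarith

/-- Interpolation between `L²` and `L^∞`. -/
theorem eLpNorm_le_of_bound_of_two {h : Space → ℂ} {q : ℝ≥0∞} (hq : 2 ≤ q) {M N : ℝ} (hM : 0 ≤ M) (hN : 0 ≤ N) (hb : ∀ x, ‖h x‖ ≤ M)
    (h2 : eLpNorm h 2 volume ≤ ENNReal.ofReal N) :
    eLpNorm h q volume ≤
      ENNReal.ofReal (M ^ (1 - 2 * (q⁻¹).toReal) * N ^ (2 * (q⁻¹).toReal)) := by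
  rcases eq_or_ne q ∞ with rfl | hqt
  · simp only [ENNReal.inv_top, ENNReal.toReal_zero, mul_zero, sub_zero, Real.rpow_one,
      Real.rpow_zero, mul_one]
    have := eLpNormEssSup_le_of_ae_bound (μ := volume) (Eventually.of_forall hb)
    rwa [← eLpNorm_exponent_top] at this
  have hq0 : q ≠ 0 := (zero_lt_two.trans_le hq).ne'
  have hqr : 2 ≤ q.toReal := by simpa using ENNReal.toReal_mono hqt hq
  have hqr0 : 0 < q.toReal := by linarith
  have h2' : ∫⁻ x, ‖h x‖ₑ ^ (2 : ℝ) ≤ ENNReal.ofReal (N ^ (2 : ℝ)) := by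
    rw [eLpNorm_eq_lintegral_rpow_enorm_toReal two_ne_zero ENNReal.ofNat_ne_top] at h2
    simp only [ENNReal.toReal_ofNat] at h2
    have := ENNReal.rpow_le_rpow h2 (zero_le_two (α := ℝ))
    rw [one_div, ENNReal.rpow_inv_rpow two_ne_zero,
      ENNReal.ofReal_rpow_of_nonneg hN zero_le_two] at this
    exact this
  rw [eLpNorm_eq_lintegral_rpow_enorm_toReal hq0 hqt]
  have h3 : ∫⁻ x, ‖h x‖ₑ ^ q.toReal ≤ ENNReal.ofReal (M ^ (q.toReal - 2) * N ^ (2 : ℝ)) := by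
    rw [ENNReal.ofReal_mul (by positivity)]
    refine le_trans ?_ (mul_le_mul_right h2' _)
    rw [← lintegral_const_mul' _ _ ENNReal.ofReal_ne_top]
    refine lintegral_mono fun x => ?_
    rw [← ofReal_norm, ENNReal.ofReal_rpow_of_nonneg (norm_nonneg _) (by linarith),
      ENNReal.ofReal_rpow_of_nonneg (norm_nonneg _) zero_le_two,
      ← ENNReal.ofReal_mul (by positivity)]
    refine ENNReal.ofReal_le_ofReal ?_
    calc ‖h x‖ ^ q.toReal = ‖h x‖ ^ (q.toReal - 2) * ‖h x‖ ^ (2 : ℝ) := by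
          rw [← Real.rpow_add_of_nonneg (norm_nonneg _) (by linarith) (by linarith)]; simp
      _ ≤ _ := by
        have : ‖h x‖ ^ (q.toReal - 2) ≤ M ^ (q.toReal - 2) :=
          Real.rpow_le_rpow (norm_nonneg _) (hb x) (by linarith)
        gcongr
  refine (ENNReal.rpow_le_rpow h3 (by positivity)).trans (le_of_eq ?_)
  rw [ENNReal.ofReal_rpow_of_nonneg (by positivity) (by positivity),
    Real.mul_rpow (by positivity) (by positivity), ← Real.rpow_mul hM, ← Real.rpow_mul hN,
    ENNReal.toReal_inv]
  congr 3
  · field_simp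
  · field_simp

/-- The inverse Fourier transform of a weighted `L²` function. -/
theorem exists_fourierInv_weighted {q : ℝ≥0∞} (hq : 2 ≤ q) {w : Space → ℝ}
    (hw0 : ∀ x, 0 ≤ w x) (hw1 : ∀ x, w x ≤ 1) (hw : MemLp w 2 volume)
    {G : Space → ℂ} (hG : MemLp G 2 volume) :
    ∃ h : Space → ℂ, MemLp h q volume ∧
      eLpNorm h q volume ≤ ENNReal.ofReal ((eLpNorm w 2 volume).toReal ^ (1 - 2 * (q⁻¹).toReal) *
        (eLpNorm G 2 volume).toReal) ∧
      IsRep (fun φ => ∫ x, 𝓕⁻ φ x * ((w x : ℂ) * G x)) h := by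
  set W := (eLpNorm w 2 volume).toReal with hW
  set N := (eLpNorm G 2 volume).toReal with hN
  have hW0 : 0 ≤ W := ENNReal.toReal_nonneg
  have hN0 : 0 ≤ N := ENNReal.toReal_nonneg
  have hwc : MemLp (fun x => (w x : ℂ)) 2 volume := hw.ofReal
  have hi : Integrable (fun x => (w x : ℂ) * G x) volume := hwc.integrable_mul hG
  have hle : eLpNorm (fun x => (w x : ℂ) * G x) 2 volume ≤ eLpNorm G 2 volume :=
    eLpNorm_mono fun x => by
      rw [norm_mul, Complex.norm_real, Real.norm_eq_abs, abs_of_nonneg (hw0 x)]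
      exact mul_le_of_le_one_left (norm_nonneg _) (hw1 x)
  have h2 : MemLp (fun x => (w x : ℂ) * G x) 2 volume := ⟨hi.1, hle.trans_lt hG.2⟩
  obtain ⟨g, hg, hgn, hge⟩ := exists_fourierInv_memLp_two h2
  -- By Cauchy–Schwarz the inverse transform is bounded by W N, and by Plancherel its L² norm is at
  -- most N. Interpolation gives (W N)^(1-2/q) N^(2/q) = W^(1-2/q) N.
  have hint : ∫ x, ‖(w x : ℂ) * G x‖ ≤ W * N := by
    rw [integral_norm_eq_lintegral_enorm hi.1]
    refine ENNReal.toReal_le_of_le_ofReal (by positivity) ?_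
    rw [ENNReal.ofReal_mul hW0, hW, hN, ENNReal.ofReal_toReal hw.2.ne,
      ENNReal.ofReal_toReal hG.2.ne, ← eLpNorm_one_eq_lintegral_enorm]
    have := eLpNorm_smul_le_mul_eLpNorm (p := 2) (q := 2) (r := 1) hG.1 hwc.1
    refine this.trans (le_of_eq ?_)
    congr 1
    exact eLpNorm_congr_norm_ae (Eventually.of_forall fun x => Complex.norm_real _)
  have hb : ∀ x, ‖𝓕⁻ (fun x => (w x : ℂ) * G x) x‖ ≤ W * N := fun x =>
    (norm_fourierInv_le_integral _ x).trans hint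
  have hcont := continuous_fourierInv_of_integrable hi
  have r1 : IsRep (fun φ => ∫ x, 𝓕⁻ φ x * ((w x : ℂ) * G x)) (𝓕⁻ fun x => (w x : ℂ) * G x) :=
    IsRep.of_memLp le_top (memLp_top_of_bound hcont.aestronglyMeasurable _
      (Eventually.of_forall hb)) (integral_fourierInv_mul_of_integrable hi)
  have r2 : IsRep (fun φ => ∫ x, 𝓕⁻ φ x * ((w x : ℂ) * G x)) g := IsRep.of_memLp one_le_two hg hge
  have hn2 : eLpNorm (𝓕⁻ fun x => (w x : ℂ) * G x) 2 volume ≤ ENNReal.ofReal N := by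
    rw [eLpNorm_congr_ae (r1.ae_eq r2), hgn, hN, ENNReal.ofReal_toReal hG.2.ne]
    exact hle
  have hfin := eLpNorm_le_of_bound_of_two hq (by positivity) hN0 hb hn2
  have hq1 : 2 * (q⁻¹).toReal ≤ 1 := by
    have : q⁻¹ ≤ 2⁻¹ := ENNReal.inv_le_inv.2 hq
    have := ENNReal.toReal_mono (by simp) this
    simp at this ⊢
    linarith
  have heq : (W * N) ^ (1 - 2 * (q⁻¹).toReal) * N ^ (2 * (q⁻¹).toReal) =
      W ^ (1 - 2 * (q⁻¹).toReal) * N := by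
    rw [Real.mul_rpow hW0 hN0, mul_assoc, ← Real.rpow_add_of_nonneg hN0 (by linarith)
      (by positivity)]
    simp
  rw [heq] at hfin
  exact ⟨_, ⟨hcont.aestronglyMeasurable, hfin.trans_lt ENNReal.ofReal_lt_top⟩, hfin, r1⟩

/-! ### Multiplier bounds from L^p to L^q -/

/-- The Fourier transform of the distribution `D` is the function `g`, which obeys the weighted `L²`
bounds of the Fourier transform of an `L^p` function of norm `F`. -/
structure IsFourier (p : ℝ≥0∞) (F : ℝ) (D : Distr) (g : Space → ℂ) : Prop where
  rep : IsRep (fun φ => D (𝓕 φ)) g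
  weighted : ∀ w : Space → ℝ, (∀ x, 0 ≤ w x) → (∀ x, w x ≤ 1) → MemLp w 2 volume →
    eLpNorm (fun x => (w x : ℂ) * g x) 2 volume ≤ ENNReal.ofReal
      (2 * (eLpNorm w 2 volume).toReal ^ (2 * (p⁻¹).toReal - 1) * F)
  two : p = 2 → eLpNorm g 2 volume ≤ ENNReal.ofReal F

theorem exists_isFourier {p : ℝ≥0∞} (hp : 1 ≤ p) (hp2 : p ≤ 2) {f : Space → ℂ}
    (hf : MemLp f p volume) {D : Distr} (hD : ∀ φ : 𝓢(Space, ℂ), D φ = ∫ x, φ x * f x) :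
    ∃ g, IsFourier p (eLpNorm f p volume).toReal D g := by
  obtain ⟨g, h1, h2, h3⟩ := exists_fourier_weighted hp hp2 hf
  refine ⟨g, h1.congr fun φ => hD _, h2, fun h => ?_⟩
  subst h
  rw [h3 rfl, ENNReal.ofReal_toReal hf.2.ne]

theorem IsFourier.weighted_mono {p : ℝ≥0∞} {F F' : ℝ} {D : Distr} {g : Space → ℂ}
    (h : IsFourier p F D g) (hF : F ≤ F') : IsFourier p F' D g where
  rep := h.rep
  weighted w h0 h1 h2 := (h.weighted w h0 h1 h2).trans (ENNReal.ofReal_le_ofReal (by gcongr))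
  two h' := (h.two h').trans (ENNReal.ofReal_le_ofReal hF)

theorem eLpNorm_finset_sum_norm_le {ι : Type*} (s : Finset ι) (g : ι → Space → ℂ)
    (hg : ∀ i ∈ s, AEStronglyMeasurable (g i) volume) :
    eLpNorm (fun x => ∑ i ∈ s, ‖g i x‖) 2 volume ≤ ∑ i ∈ s, eLpNorm (g i) 2 volume := by
  have h1 : (fun x => ∑ i ∈ s, ‖g i x‖) = ∑ i ∈ s, fun x => ‖g i x‖ := by
    ext x; simp
  rw [h1]
  refine (eLpNorm_sum_le (fun i hi => (hg i hi).norm) one_le_two).trans ?_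
  refine Finset.sum_le_sum fun i _ => ?_
  rw [eLpNorm_norm]

/-- Bernstein's inequality for a multiplier dominated by the square of a weight. -/
theorem exists_multiplier_bound {ι : Type*} [Fintype ι] {p q : ℝ≥0∞} (hp : 1 ≤ p) (hp2 : p ≤ 2)
    (hq : 2 ≤ q) {F : ι → ℝ} {D : ι → Distr} {f : ι → Space → ℂ}
    (hf : ∀ i, IsFourier p (F i) (D i) (f i)) {w : Space → ℝ}
    (hw0 : ∀ x, 0 ≤ w x) (hw1 : ∀ x, w x ≤ 1) (hw : MemLp w 2 volume) (hF0 : ∀ i, 0 ≤ F i)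
    {K : ℝ} (hK : 0 ≤ K) {g : Space → ℂ} (hgm : AEStronglyMeasurable g volume)
    (hg : ∀ᵐ x, ‖g x‖ ≤ K * w x ^ 2 * ∑ i, ‖f i x‖) :
    ∃ h : Space → ℂ, MemLp h q volume ∧
      eLpNorm h q volume ≤ ENNReal.ofReal (2 * K *
        (eLpNorm w 2 volume).toReal ^ (2 * ((p⁻¹).toReal - (q⁻¹).toReal)) * ∑ i, F i) ∧
      IsRep (fun φ => ∫ x, 𝓕⁻ φ x * g x) h := by
  set W := (eLpNorm w 2 volume).toReal with hW
  have hW0 : 0 ≤ W := ENNReal.toReal_nonneg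
  -- Of the two factors of w dominating g, one is spent on the weighted bound of the input and the
  -- other, restored as g = wG, on the inverse transform. Where w vanishes so does g almost
  -- everywhere, so the convention 0⁻¹ = 0 is harmless.
  let G : Space → ℂ := fun x => ((w x : ℂ))⁻¹ * g x
  have hwm : AEStronglyMeasurable (fun x => (w x : ℂ)) volume := hw.ofReal.1
  have hGm : AEStronglyMeasurable G volume :=
    (hwm.aemeasurable.inv.aestronglyMeasurable).mul hgm
  have hGb : ∀ᵐ x, ‖G x‖ ≤ K * ∑ i, ‖(w x : ℂ) * f i x‖ := by
    filter_upwards [hg] with x hx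
    simp only [G, norm_mul, norm_inv, Complex.norm_real, Real.norm_eq_abs, abs_of_nonneg (hw0 x)]
    rw [← Finset.mul_sum]
    rcases (hw0 x).eq_or_lt with h | h
    · rw [← h]; simp
    · rw [inv_mul_le_iff₀ h]
      refine hx.trans (le_of_eq ?_)
      ring
  have hθ : 0 ≤ 2 * (p⁻¹).toReal - 1 := by
    have : (2 : ℝ≥0∞)⁻¹ ≤ p⁻¹ := ENNReal.inv_le_inv.2 hp2
    have hpi : p⁻¹ ≠ ∞ := ENNReal.inv_ne_top.2 (zero_lt_one.trans_le hp).ne'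
    have := ENNReal.toReal_mono hpi this
    simp at this ⊢
    linarith
  have hq1 : 2 * (q⁻¹).toReal ≤ 1 := by
    have : q⁻¹ ≤ 2⁻¹ := ENNReal.inv_le_inv.2 hq
    have := ENNReal.toReal_mono (by simp) this
    simp at this ⊢
    linarith
  have hGn : eLpNorm G 2 volume ≤
      ENNReal.ofReal (2 * K * W ^ (2 * (p⁻¹).toReal - 1) * ∑ i, F i) := by
    have h1 := eLpNorm_le_mul_eLpNorm_of_ae_le_mul (f := G)
      (g := fun x => ∑ i, ‖(w x : ℂ) * f i x‖) (c := K) (μ := volume) (by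
        filter_upwards [hGb] with x hx
        rw [Real.norm_of_nonneg (Finset.sum_nonneg fun i _ => norm_nonneg _)]
        exact hx) 2
    refine h1.trans ?_
    have h2 := eLpNorm_finset_sum_norm_le Finset.univ (fun i x => (w x : ℂ) * f i x)
      (fun i _ => hwm.mul (hf i).rep.meas)
    have h3 : eLpNorm (fun x => ∑ i, ‖(w x : ℂ) * f i x‖) 2 volume ≤
        ENNReal.ofReal (∑ i, 2 * W ^ (2 * (p⁻¹).toReal - 1) * F i) := by
      rw [ENNReal.ofReal_sum_of_nonneg (fun i _ => by have := hF0 i; positivity)]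
      exact h2.trans (Finset.sum_le_sum fun i _ => (hf i).weighted w hw0 hw1 hw)
    refine (mul_le_mul_right h3 _).trans (le_of_eq ?_)
    rw [← ENNReal.ofReal_mul hK, ← Finset.mul_sum]
    congr 1; ring
  have hG2 : MemLp G 2 volume := ⟨hGm, hGn.trans_lt ENNReal.ofReal_lt_top⟩
  obtain ⟨h, hh, hhn, hhr⟩ := exists_fourierInv_weighted hq hw0 hw1 hw hG2
  refine ⟨h, hh, hhn.trans (ENNReal.ofReal_le_ofReal ?_), hhr.congr fun φ => ?_⟩
  · have hS : 0 ≤ ∑ i, F i := Finset.sum_nonneg fun i _ => hF0 i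
    have h1 : (eLpNorm G 2 volume).toReal ≤ 2 * K * W ^ (2 * (p⁻¹).toReal - 1) * ∑ i, F i :=
      ENNReal.toReal_le_of_le_ofReal (by positivity) hGn
    calc W ^ (1 - 2 * (q⁻¹).toReal) * (eLpNorm G 2 volume).toReal
        ≤ W ^ (1 - 2 * (q⁻¹).toReal) * (2 * K * W ^ (2 * (p⁻¹).toReal - 1) * ∑ i, F i) := by gcongr
      _ = 2 * K * (W ^ (1 - 2 * (q⁻¹).toReal) * W ^ (2 * (p⁻¹).toReal - 1)) * ∑ i, F i := by ring
      _ = _ := by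
        rw [← Real.rpow_add_of_nonneg hW0 (by linarith) hθ]
        ring_nf
  · refine integral_congr_ae ?_
    filter_upwards [hg] with x hx
    simp only [G]
    rcases eq_or_ne (w x) 0 with h | h
    · rw [h] at hx
      have : g x = 0 := by simpa using hx
      simp [this]
    · have : (w x : ℂ) ≠ 0 := by exact_mod_cast h
      rw [mul_inv_cancel_left₀ this]

/-- The `L²` bound for a bounded multiplier. -/
theorem exists_multiplier_bound_two {ι : Type*} [Fintype ι] {F : ι → ℝ} {D : ι → Distr}
    {f : ι → Space → ℂ} (hf : ∀ i, IsFourier 2 (F i) (D i) (f i)) (hF0 : ∀ i, 0 ≤ F i)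
    {K : ℝ} (hK : 0 ≤ K) {g : Space → ℂ} (hgm : AEStronglyMeasurable g volume)
    (hg : ∀ᵐ x, ‖g x‖ ≤ K * ∑ i, ‖f i x‖) :
    ∃ h : Space → ℂ, MemLp h 2 volume ∧
      eLpNorm h 2 volume ≤ ENNReal.ofReal (K * ∑ i, F i) ∧
      IsRep (fun φ => ∫ x, 𝓕⁻ φ x * g x) h := by
  have hgn : eLpNorm g 2 volume ≤ ENNReal.ofReal (K * ∑ i, F i) := by
    have h1 := eLpNorm_le_mul_eLpNorm_of_ae_le_mul (f := g)
      (g := fun x => ∑ i, ‖f i x‖) (c := K) (μ := volume) (by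
        filter_upwards [hg] with x hx
        rw [Real.norm_of_nonneg (Finset.sum_nonneg fun i _ => norm_nonneg _)]
        exact hx) 2
    refine h1.trans ?_
    rw [ENNReal.ofReal_mul hK, ENNReal.ofReal_sum_of_nonneg fun i _ => hF0 i]
    gcongr
    exact (eLpNorm_finset_sum_norm_le Finset.univ f fun i _ => (hf i).rep.meas).trans
      (Finset.sum_le_sum fun i _ => (hf i).two rfl)
  obtain ⟨h, hh, hhn, hhe⟩ :=
    exists_fourierInv_memLp_two (f := g) ⟨hgm, hgn.trans_lt ENNReal.ofReal_lt_top⟩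
  exact ⟨h, hh, hhn.le.trans hgn, IsRep.of_memLp one_le_two hh hhe⟩

/-! ### Distributional solutions are given by the matrix exponential -/

section evolution

variable {ι : Type} [Fintype ι] [DecidableEq ι]

/-- The operator on `ℂ^ι` with matrix `a`. -/
def matrixOp (a : ι → ι → ℂ) : (ι → ℂ) →L[ℂ] (ι → ℂ) :=
  ∑ c, ∑ c', a c c' • (ContinuousLinearMap.proj (R := ℂ) (φ := fun _ : ι => ℂ) c').smulRight
    (Pi.single c (1 : ℂ) : ι → ℂ)

theorem matrixOp_apply (a : ι → ι → ℂ) (v : ι → ℂ) (c : ι) :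
    matrixOp a v c = ∑ c', a c c' * v c' := by
  simp only [matrixOp, sum_apply, Finset.sum_apply,
    smul_apply, ContinuousLinearMap.smulRight_apply,
    ContinuousLinearMap.proj_apply, Pi.smul_apply, smul_eq_mul]
  rw [Finset.sum_eq_single c]
  · simp
  · intro b _ hb
    simp [hb.symm]
  · simp

theorem continuous_matrixOp {X : Type*} [TopologicalSpace X] {a : ι → ι → X → ℂ}
    (ha : ∀ c c', Continuous (a c c')) :
    Continuous fun k => matrixOp fun c c' => a c c' k := by
  unfold matrixOp
  exact continuous_finsetSum _ fun c _ => continuous_finsetSum _ fun c' _ =>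
    (ha c c').smul continuous_const

/-- Test functions obtained by letting powers of the transposed symbol act. -/
def testSeq (a : ι → ι → Space → ℂ) (c : ι) (φ : 𝓢(Space, ℂ)) : ℕ → ι → 𝓢(Space, ℂ)
  | 0 => Pi.single c φ
  | n + 1 => fun c' => ∑ c'', SchwartzMap.smulLeftCLM ℂ (a c'' c') (testSeq a c φ n c'')

variable {a : ι → ι → Space → ℂ}

/-- Duality: the transposed symbol acting n times on the test function is the n-th power of the
symbol acting on the vector. -/
theorem sum_testSeq_mul (ha : ∀ c c', (a c c').HasTemperateGrowth) (c : ι) (φ : 𝓢(Space, ℂ))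
    (n : ℕ) (k : Space) (v : ι → ℂ) :
    ∑ c', testSeq a c φ n c' k * v c' =
      φ k * ((matrixOp fun c c' => a c c' k) ^ n) v c := by
  induction n generalizing v with
  | zero =>
    rw [Finset.sum_eq_single c]
    · simp [testSeq]
    · intro b _ hb
      simp [testSeq, hb]
    · simp
  | succ n ih =>
    have h1 := ih ((matrixOp fun c c' => a c c' k) v)
    rw [pow_succ, mul_apply_eq_comp, ← h1]
    simp only [testSeq, matrixOp_apply, sum_apply,
      SchwartzMap.smulLeftCLM_apply_apply (ha _ _), smul_eq_mul, Finset.sum_mul, Finset.mul_sum]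
    rw [Finset.sum_comm]
    exact Finset.sum_congr rfl fun _ _ => Finset.sum_congr rfl fun _ _ => by ring

/-- Multiplication never enlarges the support, so the same constant applies at each step and the
growth is only geometric in n. This is why the test functions are taken with compact support. -/
theorem testSeq_bound (ha : ∀ c c', (a c c').HasTemperateGrowth) (c : ι) {φ : 𝓢(Space, ℂ)} {R : ℝ}
    (hR : tsupport φ ⊆ Metric.closedBall 0 R) (m : ℕ × ℕ) :
    ∃ M : ℝ, 0 ≤ M ∧ ∀ n c', tsupport (testSeq a c φ n c') ⊆ Metric.closedBall 0 R ∧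
      (Finset.Iic m).sup (schwartzSeminormFamily ℂ Space ℂ) (testSeq a c φ n c') ≤
        M ^ n * (Finset.Iic m).sup (schwartzSeminormFamily ℂ Space ℂ) φ := by
  choose C hC0 hC using fun c c' => exists_seminorm_smulLeftCLM_le (ha c c') R m
  refine ⟨∑ c, ∑ c', C c c', Finset.sum_nonneg fun _ _ => Finset.sum_nonneg fun _ _ => hC0 _ _,
    fun n => ?_⟩
  have hM : 0 ≤ ∑ c, ∑ c', C c c' :=
    Finset.sum_nonneg fun _ _ => Finset.sum_nonneg fun _ _ => hC0 _ _
  set S := (Finset.Iic m).sup (schwartzSeminormFamily ℂ Space ℂ)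
  induction n with
  | zero =>
    intro c'
    by_cases h : c' = c
    · subst h; simp [testSeq, hR]
    · simp only [testSeq, Pi.single_apply, h, if_false]
      refine ⟨by simp [tsupport], ?_⟩
      rw [map_zero]; simp
  | succ n ih =>
    intro c'
    constructor
    · refine closure_minimal ?_ Metric.isClosed_closedBall
      intro x hx
      by_contra hx'
      apply hx
      simp only [testSeq, sum_apply, SchwartzMap.smulLeftCLM_apply_apply (ha _ _)]
      refine Finset.sum_eq_zero fun c'' _ => ?_
      have : testSeq a c φ n c'' x = 0 := by
        by_contra h
        exact hx' ((ih c'').1 (subset_tsupport _ h))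
      rw [this, smul_zero]
    · calc S (testSeq a c φ (n + 1) c')
          ≤ ∑ c'', S (SchwartzMap.smulLeftCLM ℂ (a c'' c') (testSeq a c φ n c'')) := by
            simp only [testSeq]
            exact Finset.le_sum_of_subadditive S (map_zero S).le (fun x y => map_add_le_add S x y) _ _
        _ ≤ ∑ c'', C c'' c' * ((∑ c, ∑ c', C c c') ^ n * S φ) := by
            refine Finset.sum_le_sum fun c'' _ => ((hC _ _ _ (ih c'').1).trans ?_)
            exact mul_le_mul_of_nonneg_left (ih c'').2 (hC0 _ _)
        _ ≤ (∑ c, ∑ c', C c c') * ((∑ c, ∑ c', C c c') ^ n * S φ) := by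
            rw [← Finset.sum_mul]
            refine mul_le_mul_of_nonneg_right ?_ (mul_nonneg (pow_nonneg hM n) (apply_nonneg S φ))
            exact Finset.sum_le_sum fun c'' _ =>
              Finset.single_le_sum (f := fun c' => C c'' c') (fun _ _ => hC0 _ _) (Finset.mem_univ c')
        _ = _ := by ring

/-- A curve of tempered distributions evolving on the Fourier side by the symbol `a`. -/
structure Evolves (a : ι → ι → Space → ℂ) (V : ℝ → ι → Distr) : Prop where
  deriv : ∀ t, 0 < t → ∀ c φ, HasDerivAt (fun τ => V τ c φ)
    (∑ c', V t c' (SchwartzMap.smulLeftCLM ℂ (a c c') φ)) t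
  initial : ∀ c φ, Tendsto (fun τ => V τ c φ) (𝓝[>] 0) (𝓝 (V 0 c φ))

namespace Evolves

variable {V : ℝ → ι → Distr}

theorem continuousOn {κ : Type} [Fintype κ] {a : κ → κ → Space → ℂ} {V : ℝ → κ → Distr}
    (hV : Evolves a V) (c : κ) (φ : 𝓢(Space, ℂ)) (t : ℝ) :
    ContinuousOn (fun τ => V τ c φ) (Set.Icc 0 t) := by
  intro τ hτ
  rcases hτ.1.eq_or_lt with h | h
  · subst h
    have h1 : ContinuousWithinAt (fun τ => V τ c φ) (Set.Ioi 0) 0 := hV.initial c φ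
    exact (continuousWithinAt_Ioi_iff_Ici.1 h1).mono fun x hx => hx.1
  · exact (hV.deriv τ h c φ).continuousAt.continuousWithinAt

theorem hasDerivAt_testSeq (hV : Evolves a V) (c : ι) (φ : 𝓢(Space, ℂ)) (n : ℕ) {t : ℝ}
    (ht : 0 < t) :
    HasDerivAt (fun τ => ∑ c', V τ c' (testSeq a c φ n c'))
      (∑ c', V t c' (testSeq a c φ (n + 1) c')) t := by
  have h1 := HasDerivAt.fun_sum (u := Finset.univ) fun c' _ =>
    hV.deriv t ht c' (testSeq a c φ n c')
  refine h1.congr_deriv ?_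
  simp only [testSeq, map_sum]
  rw [Finset.sum_comm]

/-- Each pairing is continuous on the compact interval, hence bounded there, so Banach–Steinhaus
supplies one seminorm for all times; that seminorm grows geometrically along the test sequence. -/
theorem testSeq_uniform_bound (hV : Evolves a V) (ha : ∀ c c', (a c c').HasTemperateGrowth)
    (c : ι) {φ : 𝓢(Space, ℂ)} (hφ : HasCompactSupport φ) (t : ℝ) :
    ∃ M K : ℝ, 0 ≤ M ∧ 0 ≤ K ∧ ∀ n, ∀ τ ∈ Set.Icc 0 t,
      ‖∑ c', V τ c' (testSeq a c φ n c')‖ ≤ K * M ^ n := by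
  obtain ⟨R, hR⟩ := hφ.isBounded.subset_closedBall (0 : Space)
  obtain ⟨m, C, hC0, hC⟩ := exists_uniform_seminorm_bound
    (fun i : Set.Icc 0 t × ι => V i.1 i.2) (fun φ => by
      choose C hC using fun c' : ι =>
        (isCompact_Icc (a := (0 : ℝ)) (b := t)).exists_bound_of_continuousOn
          (hV.continuousOn c' φ t)
      refine ⟨∑ c', |C c'|, fun i => ((hC i.2 i.1 i.1.2).trans (le_abs_self _)).trans ?_⟩
      exact Finset.single_le_sum (f := fun c' => |C c'|) (fun _ _ => abs_nonneg _)
        (Finset.mem_univ i.2))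
  obtain ⟨M, hM, h⟩ := testSeq_bound ha c hR m
  refine ⟨M, Fintype.card ι * (C * (Finset.Iic m).sup (schwartzSeminormFamily ℂ Space ℂ) φ), hM,
    by positivity, fun n τ hτ => ?_⟩
  calc ‖∑ c', V τ c' (testSeq a c φ n c')‖ ≤ ∑ c', ‖V τ c' (testSeq a c φ n c')‖ :=
        norm_sum_le _ _
    _ ≤ ∑ _c' : ι, C * (M ^ n * (Finset.Iic m).sup (schwartzSeminormFamily ℂ Space ℂ) φ) :=
        Finset.sum_le_sum fun c' _ => (hC (⟨τ, hτ⟩, c') _).trans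
          (mul_le_mul_of_nonneg_left (h n c').2 hC0)
    _ = _ := by rw [Finset.sum_const, Finset.card_univ, nsmul_eq_mul]; ring

end Evolves

/-- Taylor expansion of a sequence of successive derivatives. -/
theorem hasDerivAt_taylor_sum {F : ℕ → ℝ → ℂ} {s : ℝ} (hF : ∀ n, HasDerivAt (F n) (F (n + 1) s) s)
    (t : ℝ) (N : ℕ) :
    HasDerivAt (fun τ => ∑ n ∈ Finset.range (N + 1), (((t - τ) ^ n / n.factorial : ℝ) : ℂ) * F n τ)
      ((((t - s) ^ N / N.factorial : ℝ) : ℂ) * F (N + 1) s) s := by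
  induction N with
  | zero => simpa using hF 0
  | succ N ih =>
    simp only [Finset.sum_range_succ _ (N + 1)]
    have h1 : HasDerivAt (fun τ : ℝ => (t - τ) ^ (N + 1) / (N + 1).factorial)
        (-((t - s) ^ N / N.factorial)) s := by
      have h2 : HasDerivAt (fun τ : ℝ => t - τ) (-1) s := by
        simpa using (hasDerivAt_id s).const_sub t
      refine ((h2.pow (N + 1)).div_const _).congr_deriv ?_
      rw [Nat.factorial_succ]
      push_cast
      have : (N.factorial : ℝ) ≠ 0 := by positivity
      have : (N + 1 : ℝ) ≠ 0 := by positivity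
      field_simp
    refine (ih.add (h1.ofReal_comp.mul (hF (N + 1)))).congr_deriv ?_
    push_cast; ring

/-- The Taylor polynomial centred at τ and evaluated at t is, as a function of τ, differentiable
with only the top term surviving. The mean value inequality then bounds the remainder by a multiple
of (tM)^N/N!. -/
theorem hasSum_taylor {F : ℕ → ℝ → ℂ} {t K M : ℝ} (ht : 0 ≤ t) (hM : 0 ≤ M) (hK : 0 ≤ K)
    (hc : ∀ n, ContinuousOn (F n) (Set.Icc 0 t))
    (hF : ∀ n, ∀ s, 0 < s → HasDerivAt (F n) (F (n + 1) s) s)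
    (hb : ∀ n, ∀ τ ∈ Set.Icc 0 t, ‖F n τ‖ ≤ K * M ^ n) :
    Tendsto (fun N => ∑ n ∈ Finset.range (N + 1), ((t ^ n / n.factorial : ℝ) : ℂ) * F n 0) atTop
      (𝓝 (F 0 t)) := by
  have key : ∀ N : ℕ, ‖F 0 t - ∑ n ∈ Finset.range (N + 1),
      ((t ^ n / n.factorial : ℝ) : ℂ) * F n 0‖ ≤ (K * M * t) * ((t * M) ^ N / N.factorial) := by
    intro N
    set G : ℝ → ℂ := fun τ => ∑ n ∈ Finset.range (N + 1),
      (((t - τ) ^ n / n.factorial : ℝ) : ℂ) * F n τ with hG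
    have hGt : G t = F 0 t := by
      simp only [hG, sub_self]
      rw [Finset.sum_eq_single 0]
      · simp
      · intro n _ hn; simp [hn]
      · simp
    have hG0 : G 0 = ∑ n ∈ Finset.range (N + 1), ((t ^ n / n.factorial : ℝ) : ℂ) * F n 0 := by
      simp [hG]
    have hGc : ContinuousOn G (Set.Icc 0 t) := by
      refine continuousOn_finsetSum _ fun n _ => ContinuousOn.mul ?_ (hc n)
      exact (Complex.continuous_ofReal.comp (by fun_prop)).continuousOn
    have hGd : ∀ s, 0 < s → HasDerivAt G ((((t - s) ^ N / N.factorial : ℝ) : ℂ) * F (N + 1) s) s :=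
      fun s hs => hasDerivAt_taylor_sum (fun n => hF n s hs) t N
    -- Derivatives are available only at positive times, so the estimate starts at ε > 0 and
    -- continuity lets ε tend to 0.
    have hle : ∀ ε ∈ Set.Ioc 0 t, ‖G t - G ε‖ ≤ (t ^ N / N.factorial * (K * M ^ (N + 1))) * t := by
      intro ε hε
      have h1 := norm_image_sub_le_of_norm_deriv_le_segment' (f := G) (a := ε) (b := t)
        (C := t ^ N / N.factorial * (K * M ^ (N + 1)))
        (fun s hs => (hGd s (hε.1.trans_le hs.1)).hasDerivWithinAt) (fun s hs => by
          have hs0 : 0 ≤ t - s := by linarith [hs.2]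
          rw [norm_mul, Complex.norm_real, Real.norm_of_nonneg (by positivity)]
          refine mul_le_mul ?_ (hb _ s ⟨hε.1.le.trans hs.1, hs.2.le⟩) (norm_nonneg _)
            (by positivity)
          gcongr
          linarith [hε.1, hs.1]) t ⟨hε.2, le_rfl⟩
      refine h1.trans (mul_le_mul_of_nonneg_left (by linarith [hε.1]) (by positivity))
    rcases ht.eq_or_lt with h | h
    · rw [← hG0, ← hGt, ← h]; simp
    have hlim : Tendsto (fun ε => ‖G t - G ε‖) (𝓝[>] 0) (𝓝 ‖G t - G 0‖) := by
      have h1 : Tendsto G (𝓝[>] 0) (𝓝 (G 0)) :=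
        (hGc 0 ⟨le_rfl, ht⟩).tendsto.mono_left <| by
          rw [← nhdsWithin_Ioo_eq_nhdsGT h]
          exact nhdsWithin_mono _ Set.Ioo_subset_Icc_self
      exact (tendsto_const_nhds.sub h1).norm
    rw [← hG0, ← hGt]
    have h2 := le_of_tendsto hlim (by filter_upwards [Ioc_mem_nhdsGT h] with ε hε using hle ε hε)
    refine h2.trans (le_of_eq ?_)
    rw [mul_pow]; ring
  rw [tendsto_iff_norm_sub_tendsto_zero]
  have h0 : Tendsto (fun N : ℕ => (K * M * t) * ((t * M) ^ N / N.factorial)) atTop (𝓝 0) := by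
    simpa using (FloorSemiring.tendsto_pow_div_factorial_atTop (t * M)).const_mul (K * M * t)
  exact squeeze_zero (fun _ => norm_nonneg _) (fun N => by rw [norm_sub_rev]; exact key N) h0

/-- Uniqueness and representation at once: the Taylor series at time 0 converges to the pairing at
time t, and its terms are the integrals of the terms of the exponential series. -/
theorem Evolves.eq_integral_exp {V : ℝ → ι → Distr} {g : ι → Space → ℂ} (hV : Evolves a V)
    (ha : ∀ c c', (a c c').HasTemperateGrowth) (hg : ∀ c, IsRep (fun φ => V 0 c φ) (g c))
    {t : ℝ} (ht : 0 ≤ t) (c : ι) {φ : 𝓢(Space, ℂ)} (hφ : HasCompactSupport φ) :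
    V t c φ = ∫ k, φ k *
      NormedSpace.exp ((t : ℂ) • matrixOp fun c c' => a c c' k) (fun c' => g c' k) c := by
  have : Nonempty ι := ⟨c⟩
  -- Gives the identity operator norm one, as needed by `norm_pow_le`.
  have : Nontrivial (ι → ℂ) := Function.nontrivial
  obtain ⟨M, K, hM, hK, hMK⟩ := hV.testSeq_uniform_bound ha c hφ t
  have h1 := hasSum_taylor ht hM hK
    (F := fun n τ => ∑ c', V τ c' (testSeq a c φ n c'))
    (fun n => continuousOn_finsetSum _ fun c' _ => hV.continuousOn c' _ t)
    (fun n s hs => hV.hasDerivAt_testSeq c φ n hs) hMK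
  have h0 : (∑ c', V t c' (testSeq a c φ 0 c')) = V t c φ := by
    rw [Finset.sum_eq_single c]
    · simp [testSeq]
    · intro b _ hb; simp [testSeq, hb]
    · simp
  simp only [h0] at h1
  set L : Space → (ι → ℂ) →L[ℂ] (ι → ℂ) := fun k => matrixOp fun c c' => a c c' k with hL
  have hLc : Continuous L := continuous_matrixOp fun c c' => (ha c c').1.continuous
  have hF0 : ∀ n, ∑ c', V 0 c' (testSeq a c φ n c') =
      ∫ k, φ k * ((L k) ^ n) (fun c' => g c' k) c := by
    intro n
    rw [Finset.sum_congr rfl fun c' _ => (hg c').eq (testSeq a c φ n c'),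
      ← integral_finsetSum _ fun c' _ => (hg c').int _]
    exact integral_congr_ae (Eventually.of_forall fun k =>
      sum_testSeq_mul ha c φ n k fun c' => g c' k)
  -- The symbol is unbounded on the whole space but bounded on the support of φ, which makes
  -- e^(t|B|) Σ|φ g| an integrable majorant of the exponential series.
  obtain ⟨B, hB⟩ := hφ.isCompact.exists_bound_of_continuousOn hLc.continuousOn
  have hint : Integrable (fun k => ∑ c', ‖φ k * g c' k‖) volume :=
    integrable_finsetSum _ fun c' _ => ((hg c').int φ).norm
  have hgn : ∀ k, ‖φ k‖ * ‖(fun c' => g c' k)‖ ≤ ∑ c', ‖φ k * g c' k‖ := fun k => by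
    simp only [norm_mul]
    rw [← Finset.mul_sum]
    refine mul_le_mul_of_nonneg_left ?_ (norm_nonneg _)
    refine (pi_norm_le_iff_of_nonneg (Finset.sum_nonneg fun _ _ => norm_nonneg _)).2 fun c' => ?_
    exact Finset.single_le_sum (f := fun c' => ‖g c' k‖) (fun _ _ => norm_nonneg _)
      (Finset.mem_univ c')
  have h2 : HasSum (fun n : ℕ => ∫ k, ((t ^ n / n.factorial : ℝ) : ℂ) *
      (φ k * ((L k) ^ n) (fun c' => g c' k) c))
      (∫ k, φ k * NormedSpace.exp ((t : ℂ) • L k) (fun c' => g c' k) c) := by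
    refine hasSum_integral_of_dominated_convergence
      (fun n k => (t * |B|) ^ n / n.factorial * ∑ c', ‖φ k * g c' k‖) (fun n => ?_)
      (fun n => Eventually.of_forall fun k => ?_) (Eventually.of_forall fun k => ?_) ?_
      (Eventually.of_forall fun k => ?_)
    · have : (fun k => ((t ^ n / n.factorial : ℝ) : ℂ) *
          (φ k * ((L k) ^ n) (fun c' => g c' k) c)) = fun k => ((t ^ n / n.factorial : ℝ) : ℂ) *
            ∑ c', testSeq a c φ n c' k * g c' k := by
        ext k; rw [sum_testSeq_mul ha c φ n k fun c' => g c' k]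
      rw [this]
      exact ((integrable_finsetSum _ fun c' _ => (hg c').int _).const_mul _).aestronglyMeasurable
    · by_cases hk : φ k = 0
      · simp only [hk, zero_mul, mul_zero, norm_zero]
        simp
      have hk' : ‖L k‖ ≤ |B| := (hB k (subset_tsupport _ hk)).trans (le_abs_self _)
      have h3 : ‖((L k) ^ n) (fun c' => g c' k) c‖ ≤ |B| ^ n * ‖(fun c' => g c' k)‖ := by
        refine (norm_le_pi_norm _ c).trans (((L k) ^ n).le_opNorm _ |>.trans ?_)
        gcongr
        exact (norm_pow_le _ n).trans (by gcongr)
      rw [norm_mul, norm_mul, Complex.norm_real, Real.norm_of_nonneg (by positivity)]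
      calc t ^ n / n.factorial * (‖φ k‖ * ‖((L k) ^ n) (fun c' => g c' k) c‖)
          ≤ t ^ n / n.factorial * (‖φ k‖ * (|B| ^ n * ‖(fun c' => g c' k)‖)) := by gcongr
        _ = (t * |B|) ^ n / n.factorial * (‖φ k‖ * ‖(fun c' => g c' k)‖) := by
            rw [mul_pow]; ring
        _ ≤ _ := by gcongr; exact hgn k
    · exact (Real.summable_pow_div_factorial _).mul_right _
    · simp only [tsum_mul_right]
      exact hint.const_mul _
    · have h4 := NormedSpace.exp_series_hasSum_exp' (𝕂 := ℂ) ((t : ℂ) • L k)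
      have h5 := (h4.mapL (ContinuousLinearMap.apply ℂ (ι → ℂ) (fun c' => g c' k)))
      have h6 := (h5.mapL (ContinuousLinearMap.proj (R := ℂ) (φ := fun _ : ι => ℂ) c)).mul_left
        (φ k)
      have h7 : ∀ n : ℕ, ((t ^ n / n.factorial : ℝ) : ℂ) * (φ k * ((L k) ^ n) (fun c' => g c' k) c) =
          φ k * ((n.factorial : ℂ)⁻¹ • ((t : ℂ) • L k) ^ n : (ι → ℂ) →L[ℂ] (ι → ℂ))
            (fun c' => g c' k) c := fun n => by
        have h8 : ∀ v, (((t : ℂ) • L k) ^ n) v = (t : ℂ) ^ n • (L k ^ n) v := by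
          induction n with
          | zero => intro v; simp
          | succ n ih =>
            intro v
            rw [pow_succ, mul_apply_eq_comp, ih, smul_apply, map_smul, smul_smul, pow_succ,
              pow_succ (L k), mul_apply_eq_comp]
        rw [smul_apply, h8]
        simp only [Pi.smul_apply, smul_eq_mul]
        push_cast
        field_simp
      simp only [h7]
      exact h6
  have h3 := h2.tendsto_sum_nat.comp (tendsto_add_atTop_nat 1)
  refine tendsto_nhds_unique h1 (h3.congr fun N => ?_)
  refine Finset.sum_congr rfl fun n _ => ?_
  rw [integral_const_mul, hF0]

end evolution

/-! ### The system on the Fourier side -/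

/-- The Fourier symbol of `∂ᵢ`. -/
def dsym (i : Fin 3) (k : Space) : ℂ := Complex.I * ((2 * Real.pi * k i : ℝ) : ℂ)

@[fun_prop]
theorem dsym_hasTemperateGrowth (i : Fin 3) : (dsym i).HasTemperateGrowth := by
  have h : (fun k : Space => (Complex.I * 2 * Real.pi) * Complex.ofRealCLM
      ((EuclideanSpace.proj (𝕜 := ℝ) i : Space →L[ℝ] ℝ) k)).HasTemperateGrowth := by
    fun_prop
  convert! h using 2 with k
  simp [dsym]; ring

theorem pderiv_fourier (i : Fin 3) (T : Distr) (φ : 𝓢(Space, ℂ)) :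
    pderiv i T (𝓕 φ) = T (𝓕 (SchwartzMap.smulLeftCLM ℂ (dsym i) φ)) := by
  have h : (fun k : Space => inner ℝ k (EuclideanSpace.single i (1 : ℝ) : Space)).HasTemperateGrowth
    := by fun_prop
  rw [pderiv, TemperedDistribution.lineDerivOp_apply_apply, SchwartzMap.lineDerivOp_fourier_eq,
    ← FourierTransform.fourier_neg]
  congr 2
  ext k
  rw [SchwartzMap.smulLeftCLM_apply_apply (by fun_prop), neg_apply, smul_apply,
    SchwartzMap.smulLeftCLM_apply_apply h]
  simp [dsym, EuclideanSpace.inner_single_right]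
  ring

theorem laplacian_fourier (T : Distr) (φ : 𝓢(Space, ℂ)) :
    (Δ T) (𝓕 φ) = T (𝓕 (SchwartzMap.smulLeftCLM ℂ (fun k => ∑ i, dsym i k ^ 2) φ)) := by
  have h1 : Δ T = ∑ i, pderiv i (pderiv i T) := by
    rw [TemperedDistribution.laplacian_eq_sum (EuclideanSpace.basisFun (Fin 3) ℝ)]
    simp [pderiv]
  rw [h1]
  simp only [sum_apply, pderiv_fourier]
  rw [SchwartzMap.smulLeftCLM_sum (fun i _ => by fun_prop), sum_apply, fourier_sum, map_sum]
  refine Finset.sum_congr rfl fun i _ => ?_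
  rw [SchwartzMap.smulLeftCLM_smulLeftCLM_apply (by fun_prop) (by fun_prop)]
  have h2 : (fun k => dsym i k ^ 2) = dsym i * dsym i := by ext k; simp [sq]
  rw [h2]

/-- The Fourier symbol of `∂_{I 0} ⋯ ∂_{I (j - 1)}`. -/
def dsymProd {j : ℕ} (I : Fin j → Fin 3) (k : Space) : ℂ := ∏ a, dsym (I a) k

@[fun_prop]
theorem dsymProd_hasTemperateGrowth {j : ℕ} (I : Fin j → Fin 3) :
    (dsymProd I).HasTemperateGrowth := by
  induction j with
  | zero => unfold dsymProd; simp only [Finset.univ_eq_empty, Finset.prod_empty]; fun_prop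
  | succ j ih =>
    have := (dsym_hasTemperateGrowth (I 0)).mul (ih (Fin.tail I))
    convert! this using 1
    ext k
    simp [dsymProd, Fin.prod_univ_succ, Fin.tail]

theorem iterPderiv_fourier {j : ℕ} (I : Fin j → Fin 3) (T : Distr) (φ : 𝓢(Space, ℂ)) :
    iterPderiv I T (𝓕 φ) = T (𝓕 (SchwartzMap.smulLeftCLM ℂ (dsymProd I) φ)) := by
  induction j generalizing T φ with
  | zero =>
    have : dsymProd I = fun _ => 1 := by ext k; simp [dsymProd]
    rw [this]; simp [iterPderiv]
  | succ j ih =>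
    have h1 : iterPderiv I T = pderiv (I 0) (iterPderiv (Fin.tail I) T) := by
      rw [iterPderiv, LineDeriv.iteratedLineDerivOp_succ_left]; rfl
    rw [h1, pderiv_fourier, ih, SchwartzMap.smulLeftCLM_smulLeftCLM_apply (by fun_prop)
      (by fun_prop)]
    have h2 : dsym (I 0) * dsymProd (Fin.tail I) = dsymProd I := by
      ext k; simp [dsymProd, Fin.prod_univ_succ, Fin.tail]
    rw [← h2, mul_comm]

theorem curl_fourier (W : Fin 3 → Distr) (i : Fin 3) (φ : 𝓢(Space, ℂ)) :
    curl W i (𝓕 φ) = ∑ l, W l (𝓕 (SchwartzMap.smulLeftCLM ℂ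
      (fun k => crossEntry (fun i => dsym i k) i l) φ)) := by
  have h1 : ∀ i, SchwartzMap.smulLeftCLM ℂ (fun k => -dsym i k) φ =
      -SchwartzMap.smulLeftCLM ℂ (dsym i) φ := fun i => by
    rw [SchwartzMap.smulLeftCLM_fun_neg (by fun_prop)]; rfl
  have h2 : ∀ i, SchwartzMap.smulLeftCLM ℂ (fun k => dsym i k) φ =
      SchwartzMap.smulLeftCLM ℂ (dsym i) φ := fun i => rfl
  fin_cases i <;>
  simp [curl, crossEntry, Fin.sum_univ_three, h1, h2, pderiv_fourier, sub_eq_add_neg, add_comm,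
    FourierTransform.fourier_neg, FourierTransform.fourier_zero]

theorem crossEntry_hasTemperateGrowth (i l : Fin 3) :
    (fun k => crossEntry (fun i => dsym i k) i l).HasTemperateGrowth := by
  fin_cases i <;> fin_cases l <;> simp [crossEntry] <;> fun_prop

theorem symb_hasTemperateGrowth (γ β μ : ℝ) (c c' : Comp) :
    (fun k => symb γ β μ (fun i => dsym i k) c c').HasTemperateGrowth := by
  have h := crossEntry_hasTemperateGrowth
  rcases c with _ | i | i | i <;> rcases c' with _ | l | l | l <;>
  simp only [symb, Sum.elim_inl, Sum.elim_inr] <;> first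
    | fun_prop
    | exact h i l
    | exact (h i l).neg
    | (split_ifs <;> fun_prop)

/-- Testing the equations against Fourier transforms turns every differential operator into
multiplication of the test function by its symbol. -/
theorem IsSolution.evolves {γ β μ : ℝ} {U₀ : Fields} {U : ℝ → Fields}
    (hU : IsSolution γ β μ U₀ U) :
    Evolves (fun c c' k => symb γ β μ (fun i => dsym i k) c c')
      (fun t c => 𝓕 ((U t).components c)) where
  initial c φ := by
    have := hU.continuous_initial c (𝓕 φ)
    simpa [hU.initial] using this
  deriv t ht c φ := by
    have h1 : ∀ (r : ℝ) i, SchwartzMap.smulLeftCLM ℂ (fun k => -(r * dsym i k)) φ =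
        -((r : ℂ) • SchwartzMap.smulLeftCLM ℂ (dsym i) φ) := fun r i => by
      ext k
      rw [SchwartzMap.smulLeftCLM_apply_apply (by fun_prop), neg_apply, smul_apply,
        SchwartzMap.smulLeftCLM_apply_apply (by fun_prop)]
      simp [mul_assoc]
    have h2 : ∀ (P : Prop) [Decidable P] (r : ℂ),
        SchwartzMap.smulLeftCLM ℂ (fun _ : Space => if P then r else 0) φ =
          if P then r • φ else 0 := fun P _ r => by split_ifs <;> simp
    have h3 : ∀ (P : Prop) [Decidable P],
        SchwartzMap.smulLeftCLM ℂ (fun k => if P then (μ : ℂ) * ∑ i, dsym i k ^ 2 else 0) φ =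
          if P then (μ : ℂ) • SchwartzMap.smulLeftCLM ℂ (fun k => ∑ i, dsym i k ^ 2) φ else 0 :=
      fun P _ => by
        have h : (fun k => ∑ i, dsym i k ^ 2).HasTemperateGrowth := by fun_prop
        split_ifs
        · ext k
          rw [SchwartzMap.smulLeftCLM_apply_apply (by fun_prop), smul_apply,
            SchwartzMap.smulLeftCLM_apply_apply h]
          simp [mul_assoc]
        · simp
    have h4 : ∀ i l, SchwartzMap.smulLeftCLM ℂ (fun k => -crossEntry (fun i => dsym i k) i l) φ =
        -SchwartzMap.smulLeftCLM ℂ (fun k => crossEntry (fun i => dsym i k) i l) φ := fun i l => by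
      have h := crossEntry_hasTemperateGrowth i l
      rw [SchwartzMap.smulLeftCLM_fun_neg h]; rfl
    have h5 : ∀ (W : Fin 3 → Distr) (i : Fin 3) (X : 𝓢(Space, ℂ)),
        ∑ l, W l (𝓕 (if i = l then X else 0)) = W i (𝓕 X) := fun W i X => by
      rw [Finset.sum_eq_single i]
      · simp
      · intro b _ hb; simp [hb.symm, FourierTransform.fourier_zero]
      · simp
    simp only [sum_comp]
    rcases c with _ | i | i | i
    · refine (hU.mass t ht (𝓕 φ)).congr_deriv ?_
      simp [symb, Fields.components, h1, divergence, pderiv_fourier, Finset.mul_sum,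
        fourier_smul, FourierTransform.fourier_neg, -Complex.coe_smul]
    · refine (hU.momentum t ht i (𝓕 φ)).congr_deriv ?_
      simp only [symb, Fields.components, h1, h2, h3, h5, Sum.elim_inl,
        Sum.elim_inr, TemperedDistribution.fourier_apply]
      simp [fourier_smul, FourierTransform.fourier_neg, pderiv_fourier, -Complex.coe_smul]
      rw [← TemperedDistribution.laplacian_apply_apply, laplacian_fourier]
      ring
    · refine (hU.ampere t ht i (𝓕 φ)).congr_deriv ?_
      simp only [symb, Fields.components, h2, h5, Sum.elim_inl,
        Sum.elim_inr, TemperedDistribution.fourier_apply]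
      simp [curl_fourier, fourier_smul, -Complex.coe_smul]
      ring
    · refine (hU.faraday t ht i (𝓕 φ)).congr_deriv ?_
      simp [symb, Fields.components, h4, curl_fourier, FourierTransform.fourier_neg]

/-! ### The transformed solution as a decaying function -/

theorem IsRep.norm_le_int {ι : Type*} [Fintype ι] {T : ι → 𝓢(Space, ℂ) → ℂ} {g : ι → Space → ℂ}
    (hg : ∀ i, IsRep (T i) (g i)) {h : Space → ℂ} (hm : AEStronglyMeasurable h volume) {K : ℝ}
    (hle : ∀ᵐ x, ‖h x‖ ≤ K * ∑ i, ‖g i x‖) (φ : 𝓢(Space, ℂ)) :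
    Integrable (fun x => φ x * h x) volume := by
  have h1 : Integrable (fun x => K * ∑ i, ‖φ x * g i x‖) volume :=
    (integrable_finsetSum _ fun i _ => ((hg i).int φ).norm).const_mul K
  refine h1.mono' (φ.continuous.aestronglyMeasurable.mul hm) ?_
  filter_upwards [hle] with x hx
  simp only [norm_mul, ← Finset.mul_sum]
  calc ‖φ x‖ * ‖h x‖ ≤ ‖φ x‖ * (K * ∑ i, ‖g i x‖) := by gcongr
    _ = _ := by ring

theorem IsRep.norm_le_loc {ι : Type*} [Fintype ι] {T : ι → 𝓢(Space, ℂ) → ℂ} {g : ι → Space → ℂ}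
    (hg : ∀ i, IsRep (T i) (g i)) {h : Space → ℂ} (hm : AEStronglyMeasurable h volume) {K : ℝ}
    (hle : ∀ᵐ x, ‖h x‖ ≤ K * ∑ i, ‖g i x‖) : LocallyIntegrable h volume := by
  have h1 : LocallyIntegrable (fun x => K * ∑ i, ‖g i x‖) volume :=
    (locallyIntegrable_finsetSum _ fun i _ => 
      (hg i).loc.mono (hg i).meas.norm (Eventually.of_forall fun x => by simp)).smul K
  refine h1.mono hm ?_
  filter_upwards [hle] with x hx
  exact hx.trans (le_abs_self _)

/-- A distribution given by a dominated function against compactly supported test functions is given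
by that function. -/
theorem IsRep.of_compactSupport {V : Distr} {h : Space → ℂ} (hm : AEStronglyMeasurable h volume)
    (hl : LocallyIntegrable h volume) (hi : ∀ φ : 𝓢(Space, ℂ), Integrable (fun x => φ x * h x) volume)
    (H : ∀ φ : 𝓢(Space, ℂ), HasCompactSupport φ → V φ = ∫ x, φ x * h x) :
    IsRep (fun φ => V φ) h := by
  refine ⟨hm, hl, hi, fun φ => ?_⟩
  obtain ⟨ψ, hψc, hψb, hψ⟩ := exists_compactSupport_tendsto φ
  have h1 : Tendsto (fun n => V (ψ n)) atTop (𝓝 (V φ)) := (V.continuous.tendsto φ).comp hψ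
  have h2 : Tendsto (fun n => ∫ x, ψ n x * h x) atTop (𝓝 (∫ x, φ x * h x)) := by
    refine tendsto_integral_of_dominated_convergence (fun x => ‖φ x * h x‖)
      (fun n => (hi (ψ n)).aestronglyMeasurable) (hi φ).norm
      (fun n => Eventually.of_forall fun x => ?_) (Eventually.of_forall fun x => ?_)
    · rw [norm_mul, norm_mul]; exact mul_le_mul_of_nonneg_right (hψb n x) (norm_nonneg _)
    · have h3 : Tendsto (fun n => ψ n x) atTop (𝓝 (φ x)) := by
        rw [tendsto_iff_norm_sub_tendsto_zero]
        refine squeeze_zero (fun _ => norm_nonneg _) (fun n => ?_)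
          ((tendsto_schwartz_iff ψ φ).1 hψ 0 0)
        have := SchwartzMap.norm_le_seminorm ℂ (ψ n - φ) x
        simpa using this
      exact h3.mul_const _
  refine tendsto_nhds_unique h1 (h2.congr fun n => (H _ (hψc n)).symm)

/-- Gauss's laws are assumed for positive times only. They pass to the initial data by continuity at
0 and then to the representing functions almost everywhere. -/
theorem IsSolution.constr {γ β μ : ℝ} {U₀ : Fields} {U : ℝ → Fields} (hU : IsSolution γ β μ U₀ U)
    {g : Comp → Space → ℂ} (hg : ∀ c, IsRep (fun φ => U₀.components c (𝓕 φ)) (g c)) :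
    ∀ᵐ k, Constr γ β (fun i => dsym i k) (fun c => g c k) := by
  have hE : ∀ φ : 𝓢(Space, ℂ), ∑ i, U₀.E i (𝓕 (SchwartzMap.smulLeftCLM ℂ (dsym i) φ)) =
      -((β / γ : ℝ) : ℂ) * U₀.n (𝓕 φ) := by
    intro φ
    have h1 : Tendsto (fun t => ∑ i, (U t).E i (𝓕 (SchwartzMap.smulLeftCLM ℂ (dsym i) φ)))
        (𝓝[>] 0) (𝓝 (∑ i, U₀.E i (𝓕 (SchwartzMap.smulLeftCLM ℂ (dsym i) φ)))) :=
      tendsto_finsetSum _ fun i _ => hU.continuous_initial (cE i) _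
    have h2 : Tendsto (fun t => -((β / γ : ℝ) : ℂ) * (U t).n (𝓕 φ))
        (𝓝[>] 0) (𝓝 (-((β / γ : ℝ) : ℂ) * U₀.n (𝓕 φ))) :=
      (hU.continuous_initial cn _).const_mul _
    refine tendsto_nhds_unique h1 (h2.congr' ?_)
    filter_upwards [self_mem_nhdsWithin] with t ht
    have := DFunLike.congr_fun (hU.gauss_E t ht) (𝓕 φ)
    simp only [divergence, sum_apply, pderiv_fourier, neg_apply, smul_apply, smul_eq_mul] at this
    rw [this, neg_mul]
  have hB : ∀ φ : 𝓢(Space, ℂ), ∑ i, U₀.B i (𝓕 (SchwartzMap.smulLeftCLM ℂ (dsym i) φ)) = 0 := by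
    intro φ
    have h1 : Tendsto (fun t => ∑ i, (U t).B i (𝓕 (SchwartzMap.smulLeftCLM ℂ (dsym i) φ)))
        (𝓝[>] 0) (𝓝 (∑ i, U₀.B i (𝓕 (SchwartzMap.smulLeftCLM ℂ (dsym i) φ)))) :=
      tendsto_finsetSum _ fun i _ => hU.continuous_initial (cB i) _
    refine tendsto_nhds_unique h1 (tendsto_const_nhds.congr' ?_)
    filter_upwards [self_mem_nhdsWithin] with t ht
    have := DFunLike.congr_fun (hU.gauss_B t ht) (𝓕 φ)
    simp only [divergence, sum_apply, pderiv_fourier] at this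
    rw [this]; rfl
  have rE := IsRep.sum Finset.univ fun i (_ : i ∈ Finset.univ) =>
    (hg (cE i)).smulLeft (dsym_hasTemperateGrowth i)
  have rB := IsRep.sum Finset.univ fun i (_ : i ∈ Finset.univ) =>
    (hg (cB i)).smulLeft (dsym_hasTemperateGrowth i)
  have rn := (hg cn).const_mul (-((β / γ : ℝ) : ℂ))
  have e1 := rE.ae_eq (rn.congr hE)
  have e2 := rB.ae_eq (IsRep.zero.congr hB)
  filter_upwards [e1, e2] with k h1 h2
  exact ⟨by rw [← neg_mul]; exact h1, h2⟩

theorem exists_fourier_decay {γ β μ : ℝ} (hγ : 0 < γ) (hβ : 0 < β) (hμ : 0 < μ) :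
    ∃ a : ℝ, 0 < a ∧ ∀ (U₀ : Fields) (U : ℝ → Fields), IsSolution γ β μ U₀ U →
      ∀ g : Comp → Space → ℂ, (∀ c, IsRep (fun φ => U₀.components c (𝓕 φ)) (g c)) →
      ∀ t, 0 ≤ t → ∃ G : Comp → Space → ℂ,
        (∀ c, IsRep (fun φ => (U t).components c (𝓕 φ)) (G c)) ∧
        ∀ᵐ k, ∀ c, ‖G c k‖ ≤ 2 * Real.exp (-(a * ((2 * Real.pi * ‖k‖) ^ 4 /
          (1 + (2 * Real.pi * ‖k‖) ^ 2) ^ 3)) * t) * ∑ c, ‖g c k‖ := by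
  obtain ⟨a, ha, hdec⟩ := exists_flow_decay hγ hβ hμ
  -- The mode estimate bounds squares; taking roots halves the rate and replaces 3 by √3 ≤ 2.
  refine ⟨a / 2, by positivity, fun U₀ U hU g hg t ht => ?_⟩
  have hgr := symb_hasTemperateGrowth γ β μ
  set L : Space → (Comp → ℂ) →L[ℂ] (Comp → ℂ) := fun k =>
    matrixOp fun c c' => symb γ β μ (fun i => dsym i k) c c' with hL
  have hLc : Continuous L := continuous_matrixOp fun c c' => (hgr c c').1.continuous
  set G : Comp → Space → ℂ := fun c k =>
    NormedSpace.exp ((t : ℂ) • L k) (fun c' => g c' k) c with hG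
  have hbound : ∀ᵐ k, ∀ c, ‖G c k‖ ≤ 2 * Real.exp (-(a / 2 * ((2 * Real.pi * ‖k‖) ^ 4 /
          (1 + (2 * Real.pi * ‖k‖) ^ 2) ^ 3)) * t) * ∑ c, ‖g c k‖ := by
    filter_upwards [hU.constr hg] with k hk c
    have hexp0 : NormedSpace.exp (((0 : ℝ) : ℂ) • L k) (fun c' => g c' k) = fun c' => g c' k := by
      have h0 : ((0 : ℝ) : ℂ) • L k = 0 := by
        ext v c; rw [smul_apply]; simp
      rw [h0, NormedSpace.exp_zero]; rfl
    have h1 := hdec (fun i => 2 * Real.pi * k i)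
      (fun s => NormedSpace.exp ((s : ℂ) • L k) (fun c' => g c' k)) (fun s c => by
        have h2 := hasDerivAt_exp_smul_const' (𝕂 := ℂ) (L k) (s : ℂ)
        have h3 := (((ContinuousLinearMap.proj (R := ℂ) (φ := fun _ : Comp => ℂ) c).comp
          (ContinuousLinearMap.apply ℂ (Comp → ℂ) (fun c' => g c' k))
          ).hasFDerivAt.comp_hasDerivAt (s : ℂ) h2)
        refine h3.comp_ofReal.congr_deriv ?_
        change (L k) (NormedSpace.exp ((s : ℂ) • L k) (fun c' => g c' k)) c = _
        rw [hL, matrixOp_apply]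
        rfl) (by rw [hexp0]; simpa [dsym] using hk) t ht
    have h4 : ∑ i, (2 * Real.pi * k i) ^ 2 = (2 * Real.pi * ‖k‖) ^ 2 := by
      rw [mul_pow, EuclideanSpace.real_norm_sq_eq, Finset.mul_sum]
      exact Finset.sum_congr rfl fun i _ => by ring
    rw [h4] at h1
    rw [hexp0] at h1
    have h5 : ‖G c k‖ ^ 2 ≤ ∑ c, ‖G c k‖ ^ 2 :=
      Finset.single_le_sum (f := fun c => ‖G c k‖ ^ 2) (fun _ _ => sq_nonneg _) (Finset.mem_univ c)
    have h6 : ∑ c, ‖g c k‖ ^ 2 ≤ (∑ c, ‖g c k‖) ^ 2 :=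
      Finset.sum_sq_le_sq_sum_of_nonneg fun _ _ => norm_nonneg _
    have h7 : Real.exp (-(a * (((2 * Real.pi * ‖k‖) ^ 2) ^ 2 /
        (1 + (2 * Real.pi * ‖k‖) ^ 2) ^ 3)) * t) = Real.exp (-(a / 2 * ((2 * Real.pi * ‖k‖) ^ 4 /
          (1 + (2 * Real.pi * ‖k‖) ^ 2) ^ 3)) * t) ^ 2 := by
      rw [← Real.exp_nat_mul]; congr 1; push_cast; ring
    rw [h7] at h1
    refine le_of_sq_le_sq ?_ (by positivity)
    have hS : 0 ≤ (∑ c, ‖g c k‖) ^ 2 := sq_nonneg _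
    generalize Real.exp (-(a / 2 * ((2 * Real.pi * ‖k‖) ^ 4 /
          (1 + (2 * Real.pi * ‖k‖) ^ 2) ^ 3)) * t) = e at h1 ⊢
    calc ‖G c k‖ ^ 2 ≤ 3 * e ^ 2 * ∑ c, ‖g c k‖ ^ 2 := h5.trans h1
      _ ≤ 3 * e ^ 2 * (∑ c, ‖g c k‖) ^ 2 := by gcongr
      _ ≤ 4 * e ^ 2 * (∑ c, ‖g c k‖) ^ 2 := by gcongr; norm_num
      _ = _ := by ring
  have hGm : ∀ c, AEStronglyMeasurable (G c) volume := by
    intro c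
    have hQ : NormedAlgebra ℚ ((Comp → ℂ) →L[ℂ] (Comp → ℂ)) := NormedAlgebra.restrictScalars ℚ ℂ _
    have hc : Continuous fun k => NormedSpace.exp ((t : ℂ) • L k) :=
      NormedSpace.exp_continuous.comp (hLc.const_smul (t : ℂ))
    -- Expanding in the standard basis separates the factors continuous in k from the merely
    -- measurable data.
    have h1 : G c = fun k => ∑ c', g c' k *
        NormedSpace.exp ((t : ℂ) • L k) (fun j => if c' = j then 1 else 0) c := by
      ext k
      simp only [hG]
      have h2 := LinearMap.pi_apply_eq_sum_univ (NormedSpace.exp ((t : ℂ) • L k)).toLinearMap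
        (fun c' => g c' k)
      have h3 := congrFun h2 c
      rw [Finset.sum_apply] at h3
      exact h3
    rw [h1]
    refine Finset.aestronglyMeasurable_fun_sum _ fun c' _ => (hg c').meas.mul ?_
    have h2 : Continuous fun k =>
        NormedSpace.exp ((t : ℂ) • L k) (fun j => if c' = j then 1 else 0) :=
      hc.clm_apply continuous_const
    exact ((continuous_apply c).comp h2).aestronglyMeasurable
  have hle : ∀ c, ∀ᵐ k, ‖G c k‖ ≤ 2 * ∑ c, ‖g c k‖ := fun c => by
    filter_upwards [hbound] with k hk
    refine (hk c).trans (mul_le_mul_of_nonneg_right ?_ (by positivity))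
    refine mul_le_of_le_one_right zero_le_two (Real.exp_le_one_iff.2 ?_)
    have : 0 ≤ a / 2 * ((2 * Real.pi * ‖k‖) ^ 4 / (1 + (2 * Real.pi * ‖k‖) ^ 2) ^ 3) := by positivity
    rw [neg_mul]
    exact neg_nonpos.2 (mul_nonneg this ht)
  refine ⟨G, fun c => ?_, hbound⟩
  have hg0 : ∀ c, IsRep (fun φ => (𝓕 ((U 0).components c)) φ) (g c) := fun c =>
    (hg c).congr fun φ => by rw [hU.initial]; rfl
  exact IsRep.of_compactSupport (V := 𝓕 ((U t).components c)) (hGm c)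
    (IsRep.norm_le_loc hg (hGm c) (hle c)) (IsRep.norm_le_int hg (hGm c) (hle c))
    fun φ hφ => hU.evolves.eq_integral_exp hgr hg0 ht c hφ

/-! ### Scalar decay estimates -/

/-- For r ≤ 1 the rate is at least a r⁴/8. In the variable y = (1+t)^(1/4) r, the factor exp(-b y⁴)
beats both y^j and the Gaussian. The Gaussian appears squared to match the w² in the multiplier
bound. -/
theorem low_frequency_decay {a : ℝ} (ha : 0 < a) (j : ℕ) :
    ∃ C : ℝ, 0 ≤ C ∧ ∀ t, 0 ≤ t → ∀ r, 0 ≤ r → r ≤ 1 →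
      r ^ j * Real.exp (-(a * (r ^ 4 / (1 + r ^ 2) ^ 3)) * t) ≤
        C * (1 + t) ^ (-(j : ℝ) / 4) * Real.exp (-((1 + t) ^ (1 / 4 : ℝ) * r) ^ 2) ^ 2 := by
  obtain ⟨b, hb⟩ : ∃ b, b = a / 8 := ⟨_, rfl⟩
  have hb0 : 0 < b := by rw [hb]; positivity
  refine ⟨j.factorial * Real.exp (1 + b + 9 / (4 * b)), by positivity, fun t ht r hr hr1 => ?_⟩
  obtain ⟨y, hy⟩ : ∃ y, y = (1 + t) ^ (1 / 4 : ℝ) * r := ⟨_, rfl⟩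
  have hT : 0 < 1 + t := by linarith
  have hy0 : 0 ≤ y := by rw [hy]; positivity
  have hy4 : y ^ 4 = (1 + t) * r ^ 4 := by
    rw [hy, mul_pow, ← Real.rpow_natCast, ← Real.rpow_mul hT.le]; norm_num
  have hyj : r ^ j = (1 + t) ^ (-(j : ℝ) / 4) * y ^ j := by
    rw [hy, mul_pow, ← Real.rpow_natCast ((1 + t) ^ (1 / 4 : ℝ)), ← Real.rpow_mul hT.le, ← mul_assoc,
      ← Real.rpow_add hT]
    have : -(j : ℝ) / 4 + 1 / 4 * j = 0 := by ring
    rw [this, Real.rpow_zero, one_mul]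
  have h1 : r ^ 4 / 8 ≤ r ^ 4 / (1 + r ^ 2) ^ 3 := by
    have h2 : 1 + r ^ 2 ≤ 2 := by nlinarith
    have h3 : (1 + r ^ 2) ^ 3 ≤ 2 ^ 3 := by gcongr
    refine div_le_div_of_nonneg_left (by positivity) (by positivity) (by linarith)
  have hr4 : r ^ 4 ≤ 1 := pow_le_one₀ hr hr1
  have h2 : -(a * (r ^ 4 / (1 + r ^ 2) ^ 3)) * t ≤ b - b * y ^ 4 := by
    have h3 : a * (r ^ 4 / 8) * t ≤ a * (r ^ 4 / (1 + r ^ 2) ^ 3) * t := by gcongr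
    have h4 : b * r ^ 4 ≤ b := mul_le_of_le_one_right hb0.le hr4
    rw [hy4]
    have h5 : a * (r ^ 4 / 8) * t = b * r ^ 4 * t := by rw [hb]; ring
    linarith
  -- Of the 3y², one y² comes from bounding y^j and two from the squared Gaussian.
  have h3 : 3 * y ^ 2 - b * y ^ 4 ≤ 9 / (4 * b) := by
    rw [le_div_iff₀ (by positivity)]
    nlinarith [sq_nonneg (2 * b * y ^ 2 - 3)]
  have h4 : y ^ j ≤ j.factorial * Real.exp (1 + y ^ 2) := by
    have h5 : y ≤ 1 + y ^ 2 := by nlinarith [sq_nonneg (y - 1)]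
    have h6 := Real.pow_div_factorial_le_exp (1 + y ^ 2) (by positivity) j
    rw [div_le_iff₀ (by positivity)] at h6
    calc y ^ j ≤ (1 + y ^ 2) ^ j := by gcongr
      _ ≤ _ := by rw [mul_comm]; exact h6
  rw [← hy, ← Real.exp_nat_mul, hyj]
  calc (1 + t) ^ (-(j : ℝ) / 4) * y ^ j * Real.exp (-(a * (r ^ 4 / (1 + r ^ 2) ^ 3)) * t)
      ≤ (1 + t) ^ (-(j : ℝ) / 4) * (j.factorial * Real.exp (1 + y ^ 2)) *
        Real.exp (b - b * y ^ 4) := by gcongr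
    _ = j.factorial * (1 + t) ^ (-(j : ℝ) / 4) * Real.exp (1 + y ^ 2 + (b - b * y ^ 4)) := by
        rw [Real.exp_add (1 + y ^ 2)]; ring
    _ ≤ j.factorial * (1 + t) ^ (-(j : ℝ) / 4) *
        Real.exp ((1 + b + 9 / (4 * b)) + (2 : ℕ) * (-y ^ 2)) := by
        refine mul_le_mul_of_nonneg_left (Real.exp_le_exp.2 ?_) (by positivity)
        push_cast; linarith
    _ = _ := by rw [Real.exp_add (1 + b + 9 / (4 * b))]; ring

/-- For r ≥ 1 the rate is at least a/(8r²), so the exponential is a function of x = (1+t)/r²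
decaying faster than x^(-ℓ/2). This is the regularity loss. -/
theorem high_frequency_decay {a : ℝ} (ha : 0 < a) {ℓ : ℝ} (hℓ : 0 ≤ ℓ) :
    ∃ C : ℝ, 0 ≤ C ∧ ∀ t, 0 ≤ t → ∀ r, 1 ≤ r →
      Real.exp (-(a * (r ^ 4 / (1 + r ^ 2) ^ 3)) * t) ≤ C * (1 + t) ^ (-ℓ / 2) * r ^ ℓ := by
  obtain ⟨b, hb⟩ : ∃ b, b = a / 8 := ⟨_, rfl⟩
  have hb0 : 0 < b := by rw [hb]; positivity
  obtain ⟨n, hn⟩ := exists_nat_ge (ℓ / 2)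
  refine ⟨Real.exp b * (n.factorial / b ^ n * Real.exp b), by positivity, fun t ht r hr => ?_⟩
  have hr0 : 0 < r := by linarith
  have hT : 0 < 1 + t := by linarith
  obtain ⟨x, hx⟩ : ∃ x, x = (1 + t) / r ^ 2 := ⟨_, rfl⟩
  have hx0 : 0 < x := by rw [hx]; positivity
  have h1 : 1 / (8 * r ^ 2) ≤ r ^ 4 / (1 + r ^ 2) ^ 3 := by
    rw [div_le_div_iff₀ (by positivity) (by positivity)]
    have h2 : 1 + r ^ 2 ≤ 2 * r ^ 2 := by nlinarith
    have h3 : (1 + r ^ 2) ^ 3 ≤ (2 * r ^ 2) ^ 3 := by gcongr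
    calc 1 * (1 + r ^ 2) ^ 3 ≤ (2 * r ^ 2) ^ 3 := by linarith
      _ = _ := by ring
  have h2 : -(a * (r ^ 4 / (1 + r ^ 2) ^ 3)) * t ≤ b + -(b * x) := by
    have h3 : a * (1 / (8 * r ^ 2)) * t ≤ a * (r ^ 4 / (1 + r ^ 2) ^ 3) * t := by gcongr
    have h4 : a * (1 / (8 * r ^ 2)) * t = b * x - b / r ^ 2 := by
      rw [hb, hx]; field_simp; ring
    have h5 : b / r ^ 2 ≤ b := div_le_self hb0.le (by nlinarith)
    linarith
  have h3 : x ^ (ℓ / 2) ≤ n.factorial / b ^ n * Real.exp b * Real.exp (b * x) := by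
    have h4 := Real.pow_div_factorial_le_exp (b * (1 + x)) (by positivity) n
    rw [div_le_iff₀ (by positivity), mul_pow] at h4
    calc x ^ (ℓ / 2) ≤ (1 + x) ^ (ℓ / 2) := by gcongr; linarith
      _ ≤ (1 + x) ^ (n : ℝ) := Real.rpow_le_rpow_of_exponent_le (by linarith) hn
      _ = (b ^ n * (1 + x) ^ n) / b ^ n := by rw [Real.rpow_natCast]; field_simp
      _ ≤ (Real.exp (b * (1 + x)) * n.factorial) / b ^ n := by gcongr
      _ = _ := by rw [mul_add, mul_one, Real.exp_add]; ring
  have h4 : (1 + t) ^ (-ℓ / 2) * r ^ ℓ = x ^ (-(ℓ / 2)) := by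
    rw [hx, Real.div_rpow hT.le (by positivity), ← Real.rpow_natCast r 2, ← Real.rpow_mul hr0.le]
    have : ((2 : ℕ) : ℝ) * -(ℓ / 2) = -ℓ := by push_cast; ring
    rw [this, Real.rpow_neg hr0.le, div_inv_eq_mul, neg_div]
  rw [mul_assoc, h4, Real.rpow_neg hx0.le]
  have hxp : 0 < x ^ (ℓ / 2) := by positivity
  calc Real.exp (-(a * (r ^ 4 / (1 + r ^ 2) ^ 3)) * t) ≤ Real.exp (b + -(b * x)) := by gcongr
    _ = Real.exp b * Real.exp (-(b * x)) * x ^ (ℓ / 2) * (x ^ (ℓ / 2))⁻¹ := by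
        rw [Real.exp_add]; field_simp
    _ ≤ Real.exp b * Real.exp (-(b * x)) * (n.factorial / b ^ n * Real.exp b * Real.exp (b * x)) *
          (x ^ (ℓ / 2))⁻¹ := by gcongr
    _ = Real.exp b * (n.factorial / b ^ n * Real.exp b) * (Real.exp (-(b * x)) * Real.exp (b * x)) *
          (x ^ (ℓ / 2))⁻¹ := by ring
    _ = _ := by rw [← Real.exp_add, neg_add_cancel, Real.exp_zero, mul_one]

theorem eLpNorm_two_toReal_sq {w : Space → ℝ} (hw : MemLp w 2 volume) :
    (eLpNorm w 2 volume).toReal ^ 2 = ∫ x, w x ^ 2 := by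
  rw [hw.eLpNorm_eq_integral_rpow_norm two_ne_zero ENNReal.ofNat_ne_top,
    ENNReal.toReal_ofReal (by positivity)]
  simp only [ENNReal.toReal_ofNat, Real.rpow_two, Real.norm_eq_abs, sq_abs]
  rw [← Real.rpow_natCast, ← Real.rpow_mul (integral_nonneg fun _ => sq_nonneg _)]
  norm_num

/-! ### Low frequencies -/

/-- A Gaussian weight. -/
def gaussWeight (τ : ℝ) (k : Space) : ℝ := Real.exp (-(τ * (2 * Real.pi * ‖k‖)) ^ 2)

theorem gaussWeight_sq (τ : ℝ) (k : Space) :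
    gaussWeight τ k ^ 2 = Real.exp (-(8 * Real.pi ^ 2 * τ ^ 2) * ‖k‖ ^ 2) := by
  rw [gaussWeight, ← Real.exp_nat_mul]; congr 1; push_cast; ring

theorem integral_gaussWeight_sq {τ : ℝ} (hτ : 0 < τ) :
    ∫ k, gaussWeight τ k ^ 2 = (8 * Real.pi * τ ^ 2)⁻¹ ^ (3 / 2 : ℝ) := by
  simp only [gaussWeight_sq]
  rw [GaussianFourier.integral_rexp_neg_mul_sq_norm (by positivity)]
  simp only [finrank_euclideanSpace, Fintype.card_fin, Nat.cast_ofNat]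
  congr 1
  field_simp

theorem gaussWeight_memLp {τ : ℝ} (hτ : 0 < τ) : MemLp (gaussWeight τ) 2 volume := by
  have hc : Continuous (gaussWeight τ) := by unfold gaussWeight; fun_prop
  refine (memLp_two_iff_integrable_sq hc.aestronglyMeasurable).2 ?_
  -- The Bochner integral of a non-integrable function is 0, contradicting the positive value just
  -- computed.
  by_contra h
  have h1 := integral_undef h
  rw [integral_gaussWeight_sq hτ] at h1
  have : 0 < (8 * Real.pi * τ ^ 2)⁻¹ ^ (3 / 2 : ℝ) := by positivity
  linarith

theorem gaussWeight_norm_rpow {τ : ℝ} (hτ : 0 < τ) (θ : ℝ) :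
    (eLpNorm (gaussWeight τ) 2 volume).toReal ^ (2 * θ) =
      (8 * Real.pi)⁻¹ ^ (3 / 2 * θ) * τ ^ (-(3 * θ)) := by
  rw [Real.rpow_mul ENNReal.toReal_nonneg, Real.rpow_two,
    eLpNorm_two_toReal_sq (gaussWeight_memLp hτ), integral_gaussWeight_sq hτ,
    ← Real.rpow_mul (by positivity), mul_inv, Real.mul_rpow (by positivity) (by positivity),
    Real.inv_rpow (by positivity) (3 / 2 * θ), ← Real.rpow_natCast τ 2,
    Real.inv_rpow (by positivity) (3 / 2 * θ), ← Real.rpow_mul hτ.le, Real.rpow_neg hτ.le]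
  congr 3
  push_cast; ring

/-- The Gaussian weight at scale τ = (1+t)^(1/4) has ‖w‖₂ proportional to τ^(-3/2), so the
multiplier bound contributes τ^(-3(1/p-1/q)). -/
theorem low_frequency_bound {a : ℝ} (ha : 0 < a) {p q : ℝ≥0∞} (hp : 1 ≤ p) (hp2 : p ≤ 2)
    (hq : 2 ≤ q) (j : ℕ) :
    ∃ C : ℝ, 0 ≤ C ∧ ∀ t, 0 ≤ t → ∀ (F : Comp → ℝ) (D : Comp → Distr) (f : Comp → Space → ℂ),
      (∀ i, 0 ≤ F i) → (∀ i, IsFourier p (F i) (D i) (f i)) →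
      ∀ g : Space → ℂ, AEStronglyMeasurable g volume →
      (∀ᵐ k, ‖g k‖ ≤ if 2 * Real.pi * ‖k‖ < 1 then (2 * Real.pi * ‖k‖) ^ j *
        (2 * Real.exp (-(a * ((2 * Real.pi * ‖k‖) ^ 4 / (1 + (2 * Real.pi * ‖k‖) ^ 2) ^ 3)) * t) *
          ∑ i, ‖f i k‖) else 0) →
      ∃ h : Space → ℂ, MemLp h q volume ∧ eLpNorm h q volume ≤ ENNReal.ofReal
        (C * (1 + t) ^ (-(3 / 4 : ℝ) * ((p⁻¹).toReal - (q⁻¹).toReal) - (j : ℝ) / 4) * ∑ i, F i) ∧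
        IsRep (fun φ => ∫ x, 𝓕⁻ φ x * g x) h := by
  obtain ⟨C, hC, hdec⟩ := low_frequency_decay ha j
  obtain ⟨θ, hθ⟩ : ∃ θ, θ = (p⁻¹).toReal - (q⁻¹).toReal := ⟨_, rfl⟩
  refine ⟨2 * (2 * C) * (8 * Real.pi)⁻¹ ^ (3 / 2 * θ), by positivity,
    fun t ht F D f hF hf g hgm hg => ?_⟩
  have hT : 0 < 1 + t := by linarith
  have hτ : 0 < (1 + t) ^ (1 / 4 : ℝ) := by positivity
  obtain ⟨h, h1, h2, h3⟩ := exists_multiplier_bound hp hp2 hq hf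
    (w := gaussWeight ((1 + t) ^ (1 / 4 : ℝ))) (fun x => (Real.exp_pos _).le)
    (fun x => Real.exp_le_one_iff.2 (neg_nonpos.2 (sq_nonneg _))) (gaussWeight_memLp hτ) hF
    (K := 2 * C * (1 + t) ^ (-(j : ℝ) / 4)) (by positivity) hgm (by
      filter_upwards [hg] with k hk
      refine hk.trans ?_
      have hS : 0 ≤ ∑ i, ‖f i k‖ := Finset.sum_nonneg fun _ _ => norm_nonneg _
      split_ifs with hk1
      · have := hdec t ht (2 * Real.pi * ‖k‖) (by positivity) hk1.le
        calc _ = 2 * ((2 * Real.pi * ‖k‖) ^ j * Real.exp (-(a * ((2 * Real.pi * ‖k‖) ^ 4 /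
              (1 + (2 * Real.pi * ‖k‖) ^ 2) ^ 3)) * t)) * ∑ i, ‖f i k‖ := by ring
          _ ≤ 2 * (C * (1 + t) ^ (-(j : ℝ) / 4) *
              gaussWeight ((1 + t) ^ (1 / 4 : ℝ)) k ^ 2) * ∑ i, ‖f i k‖ := by
              unfold gaussWeight; gcongr
          _ = _ := by ring
      · positivity)
  refine ⟨h, h1, h2.trans (le_of_eq ?_), h3⟩
  rw [← hθ, gaussWeight_norm_rpow hτ, ← Real.rpow_mul hT.le]
  have : (1 + t) ^ (-(3 / 4 : ℝ) * θ - (j : ℝ) / 4) =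
      (1 + t) ^ (-(j : ℝ) / 4) * (1 + t) ^ (1 / 4 * -(3 * θ)) := by
    rw [← Real.rpow_add hT]; congr 1; ring
  rw [this]
  congr 1; ring

/-! ### High frequencies -/

/-- The dyadic frequency shell `2 ^ n ≤ |ξ| < 2 ^ (n + 1)`. -/
def shell (n : ℕ) : Set Space :=
  (fun k : Space => 2 * Real.pi * ‖k‖) ⁻¹' Set.Ico ((2 : ℝ) ^ n) ((2 : ℝ) ^ Order.succ n)

theorem measurableSet_shell (n : ℕ) : MeasurableSet (shell n) :=
  measurableSet_Ico.preimage (by fun_prop)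

theorem pairwise_disjoint_shell : Pairwise (Function.onFun Disjoint shell) := by
  have h : Monotone fun n : ℕ => (2 : ℝ) ^ n := pow_right_mono₀ one_le_two
  exact fun m n hmn => (h.pairwise_disjoint_on_Ico_succ hmn).preimage _

theorem mem_iUnion_shell {k : Space} (hk : 1 ≤ 2 * Real.pi * ‖k‖) : k ∈ ⋃ n, shell n := by
  obtain ⟨n, h1, h2⟩ := exists_nat_pow_near hk one_lt_two
  exact Set.mem_iUnion.2 ⟨n, h1, h2⟩

theorem volume_shell_le (n : ℕ) :
    volume (shell n) ≤ ENNReal.ofReal (8 * 8 ^ n * volume.real (Metric.ball (0 : Space) 1)) := by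
  have h1 : shell n ⊆ Metric.ball (0 : Space) (2 ^ (n + 1)) := by
    intro k hk
    have h2 : 2 * Real.pi * ‖k‖ < 2 ^ (n + 1) := hk.2
    rw [mem_ball_zero_iff]
    refine lt_of_le_of_lt (le_mul_of_one_le_left (norm_nonneg _) ?_) h2
    linarith [Real.pi_gt_three]
  refine (measure_mono h1).trans (le_of_eq ?_)
  rw [Measure.addHaar_ball volume (0 : Space) (by positivity), finrank_euclideanSpace,
    Fintype.card_fin, ENNReal.ofReal_mul (by positivity), measureReal_def,
    ENNReal.ofReal_toReal measure_ball_lt_top.ne]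
  congr 2
  rw [← pow_mul, mul_comm (n + 1), pow_mul, pow_succ]; norm_num; ring

/-- The indicator function of a shell. -/
def shellWeight (n : ℕ) : Space → ℝ := (shell n).indicator fun _ => 1

theorem shellWeight_memLp (n : ℕ) : MemLp (shellWeight n) 2 volume :=
  memLp_indicator_const 2 (measurableSet_shell n) 1
    (Or.inr ((volume_shell_le n).trans_lt ENNReal.ofReal_lt_top).ne)

theorem shellWeight_norm_rpow_le (n : ℕ) {θ : ℝ} (hθ : 0 ≤ θ) :
    (eLpNorm (shellWeight n) 2 volume).toReal ^ (2 * θ) ≤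
      (8 * volume.real (Metric.ball (0 : Space) 1)) ^ θ * ((8 : ℝ) ^ θ) ^ n := by
  have h1 : (fun k => shellWeight n k ^ 2) = (shell n).indicator fun _ => 1 := by
    ext k; by_cases h : k ∈ shell n <;> simp [shellWeight, h]
  have h2 : volume.real (shell n) ≤ 8 * 8 ^ n * volume.real (Metric.ball (0 : Space) 1) :=
    ENNReal.toReal_le_of_le_ofReal (by positivity) (volume_shell_le n)
  rw [Real.rpow_mul ENNReal.toReal_nonneg, Real.rpow_two,
    eLpNorm_two_toReal_sq (shellWeight_memLp n), h1, integral_indicator_const _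
    (measurableSet_shell n), smul_eq_mul, mul_one]
  calc volume.real (shell n) ^ θ ≤ (8 * 8 ^ n * volume.real (Metric.ball (0 : Space) 1)) ^ θ := by
        gcongr
    _ = (8 * volume.real (Metric.ball (0 : Space) 1) * 8 ^ n) ^ θ := by ring_nf
    _ = _ := by
        rw [Real.mul_rpow (by positivity) (by positivity), ← Real.rpow_natCast, ← Real.rpow_mul
          (by norm_num), ← Real.rpow_natCast, ← Real.rpow_mul (by norm_num), mul_comm θ]

theorem toReal_inv_sub_nonneg {s q : ℝ≥0∞} (hs : 1 ≤ s) (hs2 : s ≤ 2) (hq : 2 ≤ q) :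
    0 ≤ (s⁻¹).toReal - (q⁻¹).toReal := by
  refine sub_nonneg.2 (ENNReal.toReal_mono ?_ (ENNReal.inv_le_inv.2 (hs2.trans hq)))
  exact ENNReal.inv_ne_top.2 (one_pos.trans_le hs).ne'

/-- Littlewood–Paley summation of a high-frequency multiplier of sufficiently negative order. -/
theorem high_frequency_multiplier_bound {s q : ℝ≥0∞} (hs : 1 ≤ s) (hs2 : s ≤ 2) (hq : 2 ≤ q)
    {α : ℝ} (hα : α + 3 * ((s⁻¹).toReal - (q⁻¹).toReal) < 0) :
    ∃ C : ℝ, 0 ≤ C ∧ ∀ {ι : Type} [Fintype ι] (F : ι → ℝ) (D : ι → Distr) (f : ι → Space → ℂ),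
      (∀ i, 0 ≤ F i) → (∀ i, IsFourier s (F i) (D i) (f i)) → ∀ K : ℝ, 0 ≤ K →
      ∀ g : Space → ℂ, AEStronglyMeasurable g volume →
      (∀ᵐ k, ‖g k‖ ≤ if 2 * Real.pi * ‖k‖ < 1 then 0 else
        K * (2 * Real.pi * ‖k‖) ^ α * ∑ i, ‖f i k‖) →
      ∃ h : Space → ℂ, MemLp h q volume ∧
        eLpNorm h q volume ≤ ENNReal.ofReal (C * K * ∑ i, F i) ∧
        IsRep (fun φ => ∫ x, 𝓕⁻ φ x * g x) h := by
  obtain ⟨θ, hθ⟩ : ∃ θ, θ = (s⁻¹).toReal - (q⁻¹).toReal := ⟨_, rfl⟩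
  have hθ0 : 0 ≤ θ := hθ ▸ toReal_inv_sub_nonneg hs hs2 hq
  rw [← hθ] at hα
  have hα0 : α ≤ 0 := by linarith
  obtain ⟨B, hB⟩ : ∃ B, B = (8 * volume.real (Metric.ball (0 : Space) 1)) ^ θ := ⟨_, rfl⟩
  have hB0 : 0 ≤ B := by rw [hB]; positivity
  -- The ratio between consecutive shells: 2^α from the multiplier and 8^θ from the volume of the
  -- shell. The hypothesis on α is exactly ρ < 1.
  obtain ⟨ρ, hρ⟩ : ∃ ρ : ℝ, ρ = 2 ^ α * 8 ^ θ := ⟨_, rfl⟩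
  have hρ0 : 0 ≤ ρ := by rw [hρ]; positivity
  have hρ1 : ρ < 1 := by
    have h8 : (8 : ℝ) ^ θ = 2 ^ (3 * θ) := by
      rw [Real.rpow_mul zero_le_two]; norm_num
    rw [hρ, h8, ← Real.rpow_add two_pos]
    exact Real.rpow_lt_one_of_one_lt_of_neg one_lt_two hα
  have hq1 : 1 ≤ q := one_le_two.trans hq
  have : Fact (1 ≤ q) := ⟨hq1⟩
  have hρ2 : 0 < 1 - ρ := by linarith
  refine ⟨2 * B * (1 - ρ)⁻¹, by positivity, fun F D f hF hf K hK g hgm hg => ?_⟩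
  have hS : 0 ≤ ∑ i, F i := Finset.sum_nonneg fun i _ => hF i
  have hgi : ∀ φ : 𝓢(Space, ℂ), Integrable (fun x => φ x * g x) volume := by
    refine IsRep.norm_le_int (fun i => (hf i).rep) hgm (K := K) ?_
    filter_upwards [hg] with k hk
    refine hk.trans ?_
    split_ifs with h
    · positivity
    · refine mul_le_mul_of_nonneg_right (mul_le_of_le_one_right hK ?_) (by positivity)
      exact Real.rpow_le_one_of_one_le_of_nonpos (not_lt.1 h) hα0
  have hn : ∀ n, ∃ h : Space → ℂ, MemLp h q volume ∧
      eLpNorm h q volume ≤ ENNReal.ofReal (2 * B * K * (∑ i, F i) * ρ ^ n) ∧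
      IsRep (fun φ => ∫ x, 𝓕⁻ φ x * (shell n).indicator g x) h := by
    intro n
    obtain ⟨h, h1, h2, h3⟩ := exists_multiplier_bound hs hs2 hq hf (w := shellWeight n)
      (fun x => Set.indicator_nonneg (fun _ _ => zero_le_one) x)
      (fun x => Set.indicator_le_self' (fun _ _ => zero_le_one) x) (shellWeight_memLp n) hF
      (K := K * (2 ^ α) ^ n) (by positivity) (hgm.indicator (measurableSet_shell n)) (by
        filter_upwards [hg] with k hk
        by_cases hkn : k ∈ shell n
        · rw [shellWeight, Set.indicator_of_mem hkn, Set.indicator_of_mem hkn]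
          have h4 : (2 : ℝ) ^ n ≤ 2 * Real.pi * ‖k‖ := hkn.1
          have h5 : (1 : ℝ) ≤ 2 ^ n := one_le_pow₀ one_le_two
          rw [if_neg (not_lt.2 (h5.trans h4))] at hk
          refine hk.trans ?_
          have h6 : (2 * Real.pi * ‖k‖) ^ α ≤ ((2 : ℝ) ^ n) ^ α :=
            Real.rpow_le_rpow_of_nonpos (by positivity) h4 hα0
          have h7 : ((2 : ℝ) ^ n) ^ α = (2 ^ α) ^ n := by
            rw [← Real.rpow_natCast, ← Real.rpow_mul zero_le_two, mul_comm,
              Real.rpow_mul zero_le_two, Real.rpow_natCast]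
          rw [h7] at h6
          rw [one_pow, mul_one]
          gcongr
        · rw [shellWeight, Set.indicator_of_notMem hkn, Set.indicator_of_notMem hkn]
          simp)
    refine ⟨h, h1, h2.trans (ENNReal.ofReal_le_ofReal ?_), h3⟩
    rw [← hθ]
    have h4 := shellWeight_norm_rpow_le n hθ0
    rw [← hB] at h4
    calc _ ≤ 2 * (K * (2 ^ α) ^ n) * (B * ((8 : ℝ) ^ θ) ^ n) * ∑ i, F i := by gcongr
      _ = _ := by rw [hρ, mul_pow]; ring
  choose h h1 h2 h3 using hn
  let H : ℕ → Lp ℂ q (volume : Measure Space) := fun n => (h1 n).toLp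
  have hH : ∀ n, ‖H n‖ ≤ 2 * B * K * (∑ i, F i) * ρ ^ n := fun n => by
    rw [Lp.norm_toLp]
    exact ENNReal.toReal_le_of_le_ofReal (by positivity) (h2 n)
  have hgeo := (hasSum_geometric_of_lt_one hρ0 hρ1).mul_left (2 * B * K * ∑ i, F i)
  have hsum : Summable H := Summable.of_norm_bounded hgeo.summable hH
  have hnorm : ‖∑' n, H n‖ ≤ 2 * B * (1 - ρ)⁻¹ * K * ∑ i, F i := by
    refine (tsum_of_norm_bounded hgeo hH).trans (le_of_eq (by ring))
  refine ⟨(∑' n, H n : Lp ℂ q (volume : Measure Space)), Lp.memLp _, ?_,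
    IsRep.of_memLp hq1 (Lp.memLp _) fun φ => ?_⟩
  · rw [← ENNReal.ofReal_toReal (Lp.eLpNorm_ne_top (∑' n, H n)), ← Lp.norm_def]
    exact ENNReal.ofReal_le_ofReal hnorm
  -- The same series of pairings is summed twice: in L^q, and over the shells on the Fourier side.
  -- Uniqueness of sums identifies the L^q limit.
  · have e1 : HasSum (fun n => ∫ x, φ x * h n x) (∫ x, φ x * (∑' n, H n : Lp ℂ q volume) x) := by
      have e2 := (hsum.hasSum.mapL (Lp.toTemperedDistributionCLM ℂ volume q)).mapL
        (PointwiseConvergenceCLM.evalCLM (RingHom.id ℂ) ℂ φ)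
      have e6 : ∀ f : Lp ℂ q (volume : Measure Space), PointwiseConvergenceCLM.evalCLM (RingHom.id ℂ)
          ℂ φ (Lp.toTemperedDistributionCLM ℂ volume q f) = ∫ x, φ x * f x := fun f => by
        change Lp.toTemperedDistribution f φ = _
        rw [Lp.toTemperedDistribution_apply]; rfl
      have e7 : ∀ n, ∫ x, φ x * h n x = ∫ x, φ x * H n x := fun n => integral_congr_ae (by
        filter_upwards [(h1 n).coeFn_toLp] with x hx
        rw [hx])
      simp only [e6] at e2
      simp only [e7]
      exact e2
    have e3 : HasSum (fun n => ∫ x, φ x * h n x) (∫ x, 𝓕⁻ φ x * g x) := by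
      have e4 := hasSum_integral_iUnion measurableSet_shell pairwise_disjoint_shell
        (hgi (𝓕⁻ φ)).integrableOn
      have e5 : ∫ x in ⋃ n, shell n, 𝓕⁻ φ x * g x = ∫ x, 𝓕⁻ φ x * g x := by
        refine setIntegral_eq_integral_of_ae_compl_eq_zero ?_
        filter_upwards [hg] with k hk hkn
        have : 2 * Real.pi * ‖k‖ < 1 := by
          by_contra hc
          exact hkn (mem_iUnion_shell (not_lt.1 hc))
        rw [if_pos this] at hk
        rw [norm_le_zero_iff.1 hk, mul_zero]
      rw [e5] at e4
      have e6 : ∀ n, ∫ x, φ x * h n x = ∫ x in shell n, 𝓕⁻ φ x * g x := fun n => by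
        rw [← (h3 n).eq, ← integral_indicator (measurableSet_shell n)]
        refine integral_congr_ae (Eventually.of_forall fun x => ?_)
        by_cases hx : x ∈ shell n <;> simp [hx]
      simp only [e6]
      exact e4
    exact e3.unique e1

/-- Trading ℓ powers of |ξ| for time decay and m of them for derivatives of the data leaves a
multiplier of order j + ℓ - m, and m is chosen to make it admissible. -/
theorem high_frequency_bound {a : ℝ} (ha : 0 < a) {s q : ℝ≥0∞} (hs : 1 ≤ s) (hs2 : s ≤ 2)
    (hq : 2 ≤ q) {ℓ : ℝ} (hℓ : 0 ≤ ℓ) (j : ℕ) :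
    ∃ C : ℝ, 0 ≤ C ∧ ∀ {ι : Type} [Fintype ι] (F : ι → ℝ) (D : ι → Distr) (f : ι → Space → ℂ),
      (∀ i, 0 ≤ F i) → (∀ i, IsFourier s (F i) (D i) (f i)) → ∀ f₀ : Comp → Space → ℂ,
      (∀ᵐ k, (2 * Real.pi * ‖k‖) ^ regIndex (j + ℓ) s q * ∑ c, ‖f₀ c k‖ ≤ ∑ i, ‖f i k‖) →
      ∀ t, 0 ≤ t → ∀ g : Space → ℂ, AEStronglyMeasurable g volume →
      (∀ᵐ k, ‖g k‖ ≤ if 2 * Real.pi * ‖k‖ < 1 then 0 else (2 * Real.pi * ‖k‖) ^ j *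
        (2 * Real.exp (-(a * ((2 * Real.pi * ‖k‖) ^ 4 / (1 + (2 * Real.pi * ‖k‖) ^ 2) ^ 3)) * t) *
          ∑ c, ‖f₀ c k‖)) →
      ∃ h : Space → ℂ, MemLp h q volume ∧
        eLpNorm h q volume ≤ ENNReal.ofReal (C * (1 + t) ^ (-ℓ / 2) * ∑ i, F i) ∧
        IsRep (fun φ => ∫ x, 𝓕⁻ φ x * g x) h := by
  obtain ⟨C, hC, hdec⟩ := high_frequency_decay ha hℓ
  obtain ⟨m, hm⟩ : ∃ m, m = regIndex (j + ℓ) s q := ⟨_, rfl⟩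
  rw [← hm]
  have key : ∀ {ι : Type} [Fintype ι] (f : ι → Space → ℂ) (f₀ : Comp → Space → ℂ),
      (∀ᵐ k, (2 * Real.pi * ‖k‖) ^ m * ∑ c, ‖f₀ c k‖ ≤ ∑ i, ‖f i k‖) →
      ∀ t, 0 ≤ t → ∀ g : Space → ℂ,
      (∀ᵐ k, ‖g k‖ ≤ if 2 * Real.pi * ‖k‖ < 1 then 0 else (2 * Real.pi * ‖k‖) ^ j *
        (2 * Real.exp (-(a * ((2 * Real.pi * ‖k‖) ^ 4 / (1 + (2 * Real.pi * ‖k‖) ^ 2) ^ 3)) * t) *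
          ∑ c, ‖f₀ c k‖)) →
      ∀ᵐ k, ‖g k‖ ≤ if 2 * Real.pi * ‖k‖ < 1 then 0 else
        (2 * C * (1 + t) ^ (-ℓ / 2)) * (2 * Real.pi * ‖k‖) ^ ((j : ℝ) + ℓ - m) * ∑ i, ‖f i k‖ := by
    intro ι _ f f₀ hf t ht g hg
    filter_upwards [hf, hg] with k hk1 hk2
    refine hk2.trans ?_
    split_ifs with h
    · exact le_rfl
    · have hr := not_lt.1 h
      generalize 2 * Real.pi * ‖k‖ = r at hr hk1 ⊢
      have hr0 : 0 < r := by linarith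
      have hT : 0 < 1 + t := by linarith
      have h1 := hdec t ht r hr
      have h2 : r ^ j * r ^ ℓ = r ^ ((j : ℝ) + ℓ - m) * r ^ m := by
        rw [← Real.rpow_natCast r j, ← Real.rpow_natCast r m, ← Real.rpow_add hr0,
          ← Real.rpow_add hr0]
        congr 1; ring
      calc _ ≤ r ^ j * (2 * (C * (1 + t) ^ (-ℓ / 2) * r ^ ℓ) * ∑ c, ‖f₀ c k‖) := by gcongr
        _ = 2 * C * (1 + t) ^ (-ℓ / 2) * (r ^ j * r ^ ℓ) * ∑ c, ‖f₀ c k‖ := by ring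
        _ = 2 * C * (1 + t) ^ (-ℓ / 2) * r ^ ((j : ℝ) + ℓ - m) * (r ^ m * ∑ c, ‖f₀ c k‖) := by
            rw [h2]; ring
        _ ≤ _ := by gcongr
  have hθ := toReal_inv_sub_nonneg hs hs2 hq
  unfold regIndex at hm
  have hj : (0 : ℝ) ≤ j + ℓ := by positivity
  -- The first case of `regIndex` is void because j + ℓ ≥ 0 and 1/s ≥ 1/q.
  rw [if_neg (by linarith)] at hm
  split_ifs at hm with hsp
  · obtain ⟨rfl, rfl, k, hk⟩ := hsp
    have hmk : (m : ℝ) = j + ℓ := by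
      have hk0 : 0 ≤ k := by rw [hk] at hj; exact_mod_cast hj
      obtain ⟨n, rfl⟩ := Int.eq_ofNat_of_zero_le hk0
      rw [hm, hk]; simp
    refine ⟨2 * C, by positivity, fun F D f hF hf f₀ hf₀ t ht g hgm hg => ?_⟩
    have h1 := key f f₀ hf₀ t ht g hg
    have hT : 0 < 1 + t := by linarith
    refine exists_multiplier_bound_two hf hF (by positivity) hgm ?_
    filter_upwards [h1] with k hk
    refine hk.trans ?_
    split_ifs
    · positivity
    · rw [hmk, sub_self, Real.rpow_zero, mul_one]
  -- The + 1 after the integer part makes this strict, as the geometric series requires. In the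
  -- preceding case the order is exactly 0 and Plancherel suffices.
  · have hα : ((j : ℝ) + ℓ - m) + 3 * ((s⁻¹).toReal - (q⁻¹).toReal) < 0 := by
      have := Nat.lt_floor_add_one ((j : ℝ) + ℓ + 3 * ((s⁻¹).toReal - (q⁻¹).toReal))
      rw [hm]; push_cast; linarith
    obtain ⟨C', hC', H⟩ := high_frequency_multiplier_bound hs hs2 hq hα
    refine ⟨C' * (2 * C), by positivity, fun F D f hF hf f₀ hf₀ t ht g hgm hg => ?_⟩
    have hT : 0 < 1 + t := by linarith
    obtain ⟨h, h1, h2, h3⟩ := H F D f hF hf _ (by positivity) g hgm (key f f₀ hf₀ t ht g hg)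
    exact ⟨h, h1, h2.trans (le_of_eq (by congr 1; ring)), h3⟩

/-! ### Size of derivative symbols -/

theorem norm_dsym (i : Fin 3) (k : Space) : ‖dsym i k‖ = 2 * Real.pi * |k i| := by
  rw [dsym, norm_mul, Complex.norm_I, one_mul, Complex.norm_real, Real.norm_eq_abs, abs_mul,
    abs_of_pos Real.two_pi_pos]

theorem norm_dsymProd_le {j : ℕ} (I : Fin j → Fin 3) (k : Space) :
    ‖dsymProd I k‖ ≤ (2 * Real.pi * ‖k‖) ^ j := by
  rw [dsymProd, norm_prod]
  calc ∏ a, ‖dsym (I a) k‖ ≤ ∏ _a : Fin j, (2 * Real.pi * ‖k‖) := by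
        refine Finset.prod_le_prod (fun _ _ => norm_nonneg _) fun a _ => ?_
        rw [norm_dsym]
        have : |k (I a)| ≤ ‖k‖ := PiLp.norm_apply_le k (I a)
        gcongr
    _ = _ := by simp

/-- The sum over all index tuples is the m-th power of the ℓ¹ norm of ξ, which dominates the
Euclidean norm. -/
theorem le_sum_norm_dsymProd (m : ℕ) (k : Space) :
    (2 * Real.pi * ‖k‖) ^ m ≤ ∑ I : Fin m → Fin 3, ‖dsymProd I k‖ := by
  simp only [dsymProd, norm_prod]
  rw [← Fintype.sum_pow (fun i => ‖dsym i k‖) m]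
  have h : ‖k‖ ≤ ∑ i, |k i| := by
    refine le_of_sq_le_sq ?_ (Finset.sum_nonneg fun _ _ => abs_nonneg _)
    rw [EuclideanSpace.real_norm_sq_eq]
    simp only [← sq_abs (k _)]
    exact Finset.sum_sq_le_sq_sum_of_nonneg fun _ _ => abs_nonneg _
  refine pow_le_pow_left₀ (by positivity) ?_ m
  simp only [norm_dsym, ← Finset.mul_sum]
  gcongr

/-! ### The norm of a family of distributions -/

section lpNorm

variable {ι : Type} [Fintype ι] {T : ι → Distr} {p : ℝ≥0∞}

/-- Representing functions agree almost everywhere, so the infimum runs over a single class. -/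
theorem lpNorm_eq (hp : 1 ≤ p) {f : Space → EuclideanSpace ℂ ι} (hf : MemLp f p volume)
    (hT : ∀ (i : ι) (φ : 𝓢(Space, ℂ)), T i φ = ∫ x, φ x * f x i) :
    lpNorm p T = eLpNorm f p volume := by
  refine le_antisymm (iInf_le_of_le f (iInf_le_of_le hf (iInf_le_of_le hT le_rfl))) ?_
  refine le_iInf fun g => le_iInf fun hg => le_iInf fun hgT => ?_
  have h : ∀ i, (fun x => f x i) =ᵐ[volume] fun x => g x i := fun i =>
    (IsRep.of_memLp hp (hf.eval_piLp i) (hT i)).ae_eq (IsRep.of_memLp hp (hg.eval_piLp i) (hgT i))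
  refine (eLpNorm_congr_ae ?_).le
  filter_upwards [ae_all_iff.2 h] with x hx
  ext i
  exact hx i

/-- Finiteness of the `L^p` norm gives Fourier transforms of all entries as functions. -/
theorem exists_isFourier_of_lpNorm_ne_top (hp : 1 ≤ p) (hp2 : p ≤ 2) (hT : lpNorm p T ≠ ∞) :
    ∃ g : ι → Space → ℂ, ∀ i, IsFourier p (lpNorm p T).toReal (T i) (g i) := by
  obtain ⟨f, hf⟩ := iInf_lt_iff.1 (lt_top_iff_ne_top.2 hT)
  obtain ⟨hfm, hf⟩ := iInf_lt_iff.1 hf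
  obtain ⟨hfT, -⟩ := iInf_lt_iff.1 hf
  have hfi : ∀ i, MemLp (fun x => f x i) p volume := fun i => hfm.eval_piLp i
  choose g hg using fun i => exists_isFourier hp hp2 (hfi i) (hfT i)
  refine ⟨g, fun i => (hg i).weighted_mono ?_⟩
  rw [lpNorm_eq hp hfm hfT]
  refine ENNReal.toReal_mono hfm.2.ne (eLpNorm_mono fun x => ?_)
  exact PiLp.norm_apply_le (f x) i

theorem lpNorm_le_sum (hp : 1 ≤ p) {h : ι → Space → ℂ} (hh : ∀ i, MemLp (h i) p volume)
    (hT : ∀ i, IsRep (fun φ => T i φ) (h i)) :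
    lpNorm p T ≤ ∑ i, eLpNorm (h i) p volume := by
  classical
  let e : ι → Space → EuclideanSpace ℂ ι := fun i x => h i x • EuclideanSpace.single i (1 : ℂ)
  have he : ∀ i, MemLp (e i) p volume := fun i => by
    refine (hh i).of_le ((hh i).1.smul_const _) (Eventually.of_forall fun x => ?_)
    simp [e, norm_smul]
  have hei : ∀ x i, (∑ i, e i) x i = h i x := fun x i => by
    simp [e, Finset.sum_apply, Pi.single_apply]
  rw [lpNorm_eq hp (f := ∑ i, e i) (memLp_finsetSum' _ fun i _ => he i) fun i φ => by
    simp only [hei]; exact (hT i).eq φ]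
  refine (eLpNorm_sum_le (fun i _ => (he i).1) hp).trans (Finset.sum_le_sum fun i _ => ?_)
  refine eLpNorm_mono fun x => ?_
  simp [e, norm_smul]

end lpNorm

/-- The Fourier transforms of all derivatives of order `m` control `|ξ| ^ m` times the Fourier
transform. -/
theorem Fields.pow_mul_sum_le {U₀ : Fields} {m : ℕ} {g : Comp → Space → ℂ}
    (hg : ∀ c, IsRep (fun φ => U₀.components c (𝓕 φ)) (g c))
    {f : (Fin m → Fin 3) × Comp → Space → ℂ}
    (hf : ∀ i, IsRep (fun φ => U₀.grad m i (𝓕 φ)) (f i)) :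
    ∀ᵐ k, (2 * Real.pi * ‖k‖) ^ m * ∑ c, ‖g c k‖ ≤ ∑ i, ‖f i k‖ := by
  have h : ∀ i : (Fin m → Fin 3) × Comp, f i =ᵐ[volume] fun k => dsymProd i.1 k * g i.2 k :=
    fun i => (hf i).ae_eq (((hg i.2).smulLeft (dsymProd_hasTemperateGrowth i.1)).congr fun φ =>
      iterPderiv_fourier i.1 _ φ)
  filter_upwards [ae_all_iff.2 h] with k hk
  simp only [hk, norm_mul, Fintype.sum_prod_type]
  rw [← Finset.sum_mul_sum]
  exact mul_le_mul_of_nonneg_right (le_sum_norm_dsymProd m k)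
    (Finset.sum_nonneg fun _ _ => norm_nonneg _)

/-! ### Assembly of the two frequency regimes -/

theorem exists_component_bound {γ β μ : ℝ} (hγ : 0 < γ) (hβ : 0 < β) (hμ : 0 < μ)
    {p s q : ℝ≥0∞} (hp : 1 ≤ p) (hp2 : p ≤ 2) (hs : 1 ≤ s) (hs2 : s ≤ 2) (hq : 2 ≤ q)
    {ℓ : ℝ} (hℓ : 0 ≤ ℓ) (j : ℕ) :
    ∃ C : ℝ, 0 ≤ C ∧ ∀ (U₀ : Fields) (U : ℝ → Fields), IsSolution γ β μ U₀ U → ∀ t, 0 ≤ t →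
      lpNorm p U₀.components ≠ ∞ → lpNorm s (U₀.grad (regIndex ((j : ℝ) + ℓ) s q)) ≠ ∞ →
      ∀ i, ∃ h : Space → ℂ, MemLp h q volume ∧ IsRep (fun φ => (U t).grad j i φ) h ∧
        eLpNorm h q volume ≤
          ENNReal.ofReal
              (C * (1 + t) ^ (-(3 / 4 : ℝ) * ((p⁻¹).toReal - (q⁻¹).toReal) - (j : ℝ) / 4)) *
            lpNorm p U₀.components +
          ENNReal.ofReal (C * (1 + t) ^ (-ℓ / 2)) *
            lpNorm s (U₀.grad (regIndex ((j : ℝ) + ℓ) s q)) := by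
  obtain ⟨a, ha, hdec⟩ := exists_fourier_decay hγ hβ hμ
  obtain ⟨C₁, hC₁, hlow⟩ := low_frequency_bound ha hp hp2 hq j
  obtain ⟨C₂, hC₂, hhigh⟩ := high_frequency_bound ha hs hs2 hq hℓ j
  obtain ⟨m, hm⟩ : ∃ m, m = regIndex (j + ℓ) s q := ⟨_, rfl⟩
  rw [← hm] at hhigh ⊢
  obtain ⟨N₁, hN₁⟩ : ∃ N : ℝ, N = Fintype.card Comp := ⟨_, rfl⟩
  obtain ⟨N₂, hN₂⟩ : ∃ N : ℝ, N = Fintype.card ((Fin m → Fin 3) × Comp) := ⟨_, rfl⟩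
  have hN₁0 : 0 ≤ N₁ := by rw [hN₁]; positivity
  have hN₂0 : 0 ≤ N₂ := by rw [hN₂]; positivity
  -- The counts N₁ and N₂ appear because each scalar entry of the data is estimated by the norm of
  -- the whole family.
  refine ⟨C₁ * N₁ + C₂ * N₂, by positivity, fun U₀ U hU t ht hP hS i => ?_⟩
  have hT : 0 < 1 + t := by linarith
  obtain ⟨P, hPe⟩ : ∃ P, P = lpNorm p U₀.components := ⟨_, rfl⟩
  obtain ⟨S, hSe⟩ : ∃ S, S = lpNorm s (U₀.grad m) := ⟨_, rfl⟩
  obtain ⟨g, hg⟩ := exists_isFourier_of_lpNorm_ne_top hp hp2 hP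
  obtain ⟨f, hf⟩ := exists_isFourier_of_lpNorm_ne_top hs hs2 hS
  rw [← hPe] at hg hP ⊢
  rw [← hSe] at hf hS ⊢
  obtain ⟨G, hG, hGle⟩ := hdec U₀ U hU g (fun c => (hg c).rep) t ht
  obtain ⟨I, c⟩ := i
  let A : Set Space := {k | 2 * Real.pi * ‖k‖ < 1}
  have hA : MeasurableSet A := measurableSet_lt (by fun_prop) measurable_const
  let b : Space → ℂ := fun k => dsymProd I k * G c k
  have hb : IsRep (fun φ => (U t).grad j (I, c) (𝓕 φ)) b :=
    ((hG c).smulLeft (dsymProd_hasTemperateGrowth I)).congr fun φ => iterPderiv_fourier I _ φ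
  have hble : ∀ᵐ k, ‖b k‖ ≤ (2 * Real.pi * ‖k‖) ^ j * (2 * Real.exp (-(a *
      ((2 * Real.pi * ‖k‖) ^ 4 / (1 + (2 * Real.pi * ‖k‖) ^ 2) ^ 3)) * t) * ∑ c, ‖g c k‖) := by
    filter_upwards [hGle] with k hk
    simp only [b, norm_mul]
    exact mul_le_mul (norm_dsymProd_le I k) (hk c) (norm_nonneg _) (by positivity)
  obtain ⟨h₁, h₁m, h₁n, h₁r⟩ := hlow t ht (fun _ => P.toReal) U₀.components g
    (fun _ => ENNReal.toReal_nonneg) hg (A.indicator b) (hb.meas.indicator hA) (by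
      filter_upwards [hble] with k hk
      by_cases hkA : k ∈ A
      · rw [Set.indicator_of_mem hkA, if_pos (show 2 * Real.pi * ‖k‖ < 1 from hkA)]; exact hk
      · rw [Set.indicator_of_notMem hkA, if_neg (show ¬2 * Real.pi * ‖k‖ < 1 from hkA), norm_zero])
  obtain ⟨h₂, h₂m, h₂n, h₂r⟩ := hhigh (fun _ => S.toReal) (U₀.grad m) f
    (fun _ => ENNReal.toReal_nonneg) hf g
    (Fields.pow_mul_sum_le (fun c => (hg c).rep) fun i => (hf i).rep) t ht
    (Aᶜ.indicator b) (hb.meas.indicator hA.compl) (by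
      filter_upwards [hble] with k hk
      by_cases hkA : k ∈ A
      · rw [Set.indicator_of_notMem (Set.notMem_compl_iff.2 hkA), if_pos (show 2 * Real.pi * ‖k‖ < 1 from hkA), norm_zero]
      · rw [Set.indicator_of_mem hkA, if_neg (show ¬2 * Real.pi * ‖k‖ < 1 from hkA)]; exact hk)
  refine ⟨fun x => h₁ x + h₂ x, h₁m.add h₂m, (h₁r.add h₂r).congr fun φ => ?_, ?_⟩
  -- Since φ = 𝓕(𝓕⁻φ), testing with φ is integrating the transform against 𝓕⁻φ, which splits over
  -- the ball |ξ| < 1 and its complement.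
  · have h1 := hb.eq (𝓕⁻ φ)
    rw [FourierTransform.fourier_fourierInv_eq] at h1
    rw [h1, ← integral_add]
    · refine integral_congr_ae (Eventually.of_forall fun k => ?_)
      simp only [← mul_add]
      rw [← Pi.add_apply (A.indicator b), Set.indicator_self_add_compl]
    · refine ((hb.int (𝓕⁻ φ)).indicator hA).congr (Eventually.of_forall fun k => ?_)
      by_cases hkA : k ∈ A <;> simp [hkA]
    · refine ((hb.int (𝓕⁻ φ)).indicator hA.compl).congr (Eventually.of_forall fun k => ?_)
      by_cases hkA : k ∈ A <;> simp [hkA]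
  · refine (eLpNorm_add_le h₁m.1 h₂m.1 (one_le_two.trans hq)).trans (add_le_add ?_ ?_)
    · refine h₁n.trans ?_
      rw [Finset.sum_const, Finset.card_univ, nsmul_eq_mul, ← hN₁, ← mul_assoc,
        mul_right_comm C₁,
        ENNReal.ofReal_mul (by positivity), ENNReal.ofReal_toReal hP]
      gcongr
      have : 0 ≤ C₂ * N₂ := by positivity
      linarith
    · refine h₂n.trans ?_
      rw [Finset.sum_const, Finset.card_univ, nsmul_eq_mul, ← hN₂, ← mul_assoc,
        mul_right_comm C₂,
        ENNReal.ofReal_mul (by positivity), ENNReal.ofReal_toReal hS]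
      gcongr
      have : 0 ≤ C₁ * N₁ := by positivity
      linarith

end

end NSM

theorem theorem2p2 (γ β μ : ℝ) (hγ : 0 < γ) (hβ : 0 < β) (hμ : 0 < μ)
    (p s q : ℝ≥0∞) (hp : 1 ≤ p) (hp2 : p ≤ 2) (hs : 1 ≤ s) (hs2 : s ≤ 2) (hq : 2 ≤ q)
    (ℓ : ℝ) (hℓ : 0 ≤ ℓ) (j : ℕ) :
    ∃ C : ℝ, 0 < C ∧ ∀ (U₀ : NSM.Fields) (U : ℝ → NSM.Fields),
      NSM.IsSolution γ β μ U₀ U → ∀ t : ℝ, 0 ≤ t →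
        NSM.lpNorm q ((U t).grad j) ≤
          ENNReal.ofReal
              (C * (1 + t) ^ (-(3 / 4 : ℝ) * ((p⁻¹).toReal - (q⁻¹).toReal) - (j : ℝ) / 4)) *
            NSM.lpNorm p U₀.components +
          ENNReal.ofReal (C * (1 + t) ^ (-ℓ / 2)) *
            NSM.lpNorm s (U₀.grad (NSM.regIndex ((j : ℝ) + ℓ) s q)) := by
  obtain ⟨C, hC, H⟩ := NSM.exists_component_bound hγ hβ hμ hp hp2 hs hs2 hq hℓ j
  obtain ⟨N, hN⟩ : ∃ N : ℕ, N = Fintype.card ((Fin j → Fin 3) × NSM.Comp) := ⟨_, rfl⟩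
  -- N entries are summed. The + 1 keeps the constant positive, so that an infinite norm on the
  -- right makes the right side infinite instead of 0 · ∞ = 0.
  refine ⟨N * C + 1, by positivity, fun U₀ U hU t ht => ?_⟩
  have hT : 0 < 1 + t := by linarith
  by_cases hP : NSM.lpNorm p U₀.components = ∞
  · rw [hP, ENNReal.mul_top (ENNReal.ofReal_pos.2 (by positivity)).ne', top_add]
    exact le_top
  by_cases hS : NSM.lpNorm s (U₀.grad (NSM.regIndex ((j : ℝ) + ℓ) s q)) = ∞
  · rw [hS, ENNReal.mul_top (ENNReal.ofReal_pos.2 (by positivity)).ne', add_top]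
    exact le_top
  choose h hm hr hn using H U₀ U hU t ht hP hS
  refine (NSM.lpNorm_le_sum (one_le_two.trans hq) hm hr).trans
    ((Finset.sum_le_sum fun i _ => hn i).trans ?_)
  rw [Finset.sum_const, Finset.card_univ, ← hN, nsmul_eq_mul, mul_add, ← mul_assoc, ← mul_assoc,
    ← ENNReal.ofReal_natCast, ← ENNReal.ofReal_mul (by positivity),
    ← ENNReal.ofReal_mul (by positivity), ← mul_assoc, ← mul_assoc]
  gcongr <;> linarith
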